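/- **Setting.** Let $T\ge 1$, let $S=\bigcup_{l=1}^{s}\{-(M_l+N_l),\dots,-M_l\}$ be the set of missed moments, $S^+=-S$, $Z^S=\{1,2,\dots\}\setminus S^+$, $U=S\cup\{0,1,2,\dots\}$ and $\mathbb Z_-=\{-1,-2,\dots\}$. Let $\vec a(j)\in\mathbb C^T$, $j\in Z^S$, satisfy $\sum_{j\in Z^S}\sum_{k}|a_k(j)|<\infty$ and put $A(e^{i\lambda})=\sum_{j\in Z^S}\vec a(j)e^{-ij\lambda}$. A spectral density is an integrable function on $[-\pi,\pi)$ whose values are Hermitian nonnegative definite $T\times T$ matrices. For spectral densities $F$ (of the signal $\vec\xi$) and $G$ (of the uncorrelated noise $\vec\eta$), $L_2^s(F+G)$ is the closed linear span of the functions $e^{in\lambda}\delta_k$, $n\in\mathbb Z_-\setminus S$, $k=1,\dots,T$, in $L_2(F+G)$. The mean-square error of the linear estimate of $A\vec\xi=\sum_{j\in Z^S}\vec a(j)^\top\vec\xi(-j)$ from $\vec\xi(j)+\vec\eta(j)$, $j\in\mathbb Z_-\setminus S$, with spectral characteristic $h\in L_2^s(F+G)$ is $$\Delta(h;F,G)=\frac1{2\pi}\int_{-\pi}^{\pi}(A-h)^\top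 F\,\overline{(A-h)}\,d\lambda+\frac1{2\pi}\int_{-\pi}^{\pi}h^\top G\,\overline h\,d\lambda .$$ The optimal characteristic $h(F,G)$ minimizes $\Delta(h;F,G)$ over $L_2^s(F+G)$, and $\Delta(F,G)=\Delta(h(F,G);F,G)$. The pair $(F,G)$ satisfies the minimality condition if $F+G$ is invertible almost everywhere and $\int_{-\pi}^{\pi}(F+G)^{-1}d\lambda<\infty$. In that case put $$B(k,j)=\frac1{2\pi}\int_{-\pi}^{\pi} (F+G)^{-1}e^{-i(k-j)\lambda}d\lambda,\quad R(k,j)=\frac1{2\pi}\int_{-\pi}^{\pi} F(F+G)^{-1}e^{-i(k+j)\lambda}d\lambda,\quad Q(k,j)=\frac1{2\pi}\int_{-\pi}^{\pi} F(F+G)^{-1}G\,e^{-i(k-j)\lambda}d\lambda,$$ $$(\mathbf B\mathbf c)(k)^\top=\sum_{j\in U}\vec c(j)^\top B(k,j),\qquad(\mathbf R\mathbf a)(k)^\top=\sum_{j\in Z^S}\vec a(j)^\top R(k,j)\quad(k\in U),\qquad\langle\mathbf Q\mathbf a,\mathbf a\rangle=\sum_{j,k\in Z^S}\vec a(j)^\top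 Q(j,k)\overline{\vec a(k)},$$ $$C(e^{i\lambda})=\sum_{k\in U}(\mathbf B^{-1}\mathbf R\mathbf a)(k)e^{ik\lambda}.$$ Here $\mathbf B$ is a positive, possibly unbounded operator and $\mathbf B^{-1}$ is the inverse of its closure in the norm $\langle\mathbf B\mathbf c,\mathbf c\rangle^{1/2}$: $\mathbf c=\mathbf B^{-1}\mathbf y$ means that there are finitely supported sequences $\mathbf c_n$, Cauchy in this norm, with $\mathbf c_n\to\mathbf c$ and $\mathbf B\mathbf c_n\to\mathbf y$ coordinatewise, and $\langle\mathbf y,\mathbf B^{-1}\mathbf y\rangle=\lim_n\langle\mathbf y,\mathbf c_n\rangle$, where $\langle \mathbf y,\mathbf c\rangle=\sum_k \vec y(k)^\top\overline{\vec c(k)}$. The function $C$ is the integrable function whose Fourier coefficients are $(\mathbf B^{-1}\mathbf R\mathbf a)(k)$ for $k\in U$ and $0$ for $k\notin U$. Let $F_1$ be a fixed spectral density, $B_1$ a positive definite Hermitian matrix, $\langle B_1,F\rangle=\sum_{i,j}(B_1)_{ij}f_{ij}$, and let $\delta,\delta_k,\delta_{ij}$ be given numbers. The classes of spectral densities are $$D^1_{1\delta}=\Big\{F:\tfrac1{2\pi}\!\int|\mathrm{Tr}(F-F_1)|\,d\lambda\le\delta\Big\},\qquad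 D^2_{1\delta}=\Big\{F:\tfrac1{2\pi}\!\int|f_{kk}-f^1_{kk}|\,d\lambda\le\delta_k\ \forall k\Big\},$$ $$D^3_{1\delta}=\Big\{F:\tfrac1{2\pi}\!\int|\langle B_1,F-F_1\rangle|\,d\lambda\le\delta\Big\},\qquad D^4_{1\delta}=\Big\{F:\tfrac1{2\pi}\!\int|f_{ij}-f^1_{ij}|\,d\lambda\le\delta_{ij}\ \forall i,j\Big\}.$$ **Statement.** Let $G$ be known, and let $F^0$ be a spectral density such that $F^0+G$ satisfies the minimality condition. With $C$ formed from $(F^0,G)$, put $(r_G^0)^\top=(A^\top G+C^\top)(F^0+G)^{-1}$, and let $(r_G^0)^*(r_G^0)^\top$ denote the $T\times T$ matrix with entries $\overline{(r_G^0)_i}(r_G^0)_j$. Let $k\in\{1,2,3,4\}$ and suppose that the $k$-th of the following groups of relations holds almost everywhere, with some constants $\alpha$ (real), $\alpha_k$ (real), $\alpha_{ij}$ (complex): 1. $(r_G^0)^*(r_G^0)^\top=\alpha^2\gamma(\lambda)(F^0+G)^2$ and $\frac1{2\pi}\int|\mathrm{Tr}(F^0-F_1)|d\lambda=\delta$, where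 $|\gamma|\le1$ and $\gamma=\mathrm{sign}\,\mathrm{Tr}(F^0-F_1)$ where $\mathrm{Tr}(F^0-F_1)\ne0$; 2. $(r_G^0)^*(r_G^0)^\top=(F^0+G)\{\alpha_k^2\gamma_k(\lambda)\delta_{kl}\}_{k,l=1}^T(F^0+G)$ (with $\delta_{kl}$ the Kronecker symbol) and $\frac1{2\pi}\int|f^0_{kk}-f^1_{kk}|d\lambda=\delta_k$ for all $k$, where $|\gamma_k|\le1$ and $\gamma_k=\mathrm{sign}(f^0_{kk}-f^1_{kk})$ where $f^0_{kk}\ne f^1_{kk}$; 3. $(r_G^0)^*(r_G^0)^\top=\alpha^2\gamma'(\lambda)(F^0+G)B_1^\top(F^0+G)$ and $\frac1{2\pi}\int|\langle B_1,F^0-F_1\rangle|d\lambda=\delta$, where $|\gamma'|\le1$ and $\gamma'=\mathrm{sign}\langle B_1,F^0-F_1\rangle$ where $\langle B_1,F^0-F_1\rangle\ne0$; 4. $(r_G^0)^*(r_G^0)^\top=(F^0+G)\{\alpha_{ij}\gamma_{ij}(\lambda)\}_{i,j=1}^T(F^0+G)$ and $\frac1{2\pi}\int|f^0_{ij}-f^1_{ij}|d\lambda=\delta_{ij}$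 for all $i,j$, where $|\gamma_{ij}|\le1$ and $\gamma_{ij}=(f^0_{ij}-f^1_{ij})/|f^0_{ij}-f^1_{ij}|$ where $f^0_{ij}\ne f^1_{ij}$. Suppose also that $F^0\in D=D^k_{1\delta}$ and that, at $F=F^0$, the functional $\langle\mathbf R\mathbf a,\mathbf B^{-1}\mathbf R\mathbf a\rangle+\langle\mathbf Q\mathbf a,\mathbf a\rangle$ attains its maximum over all $F\in D$ for which $F+G$ satisfies the minimality condition. Then $F^0$ is least favorable in $D$, that is, $\Delta(F^0,G)=\max_{F\in D}\Delta(F,G)$. Moreover, the minimax-robust spectral characteristic, that is, the $h^0\in H_D=\bigcap_{F\in D}L_2^s(F+G)$ with $$\max_{F\in D}\Delta(h^0;F,G)=\min_{h\in H_D}\sup_{F\in D}\Delta(h;F,G),$$ exists, is unique up to null sets, and is given by $$(h^0(e^{i\lambda}))^\top=A(e^{i\lambda})^\top F^0(\lambda)(F^0(\lambda)+G(\lambda))^{-1}-C(e^{i\lambda})^\top(F^0(\lambda)+G(\lambda))^{-1}.$$ -/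

import Mathlib

open MeasureTheory Filter Topology
open scoped ComplexOrder

noncomputable section

namespace Filtering

/-! ### Index sets -/

/-- The missed moments `S = ⋃ l, {-(M l + N l), …, -M l}`. -/
def missing {s : ℕ} (M N : Fin s → ℕ) : Set ℤ :=
  ⋃ l : Fin s, Set.Icc (-((M l : ℤ) + (N l : ℤ))) (-(M l : ℤ))

/-- The observed moments `ℤ₋ \ S`, with `ℤ₋ = {…, -2, -1}`. -/
def observed (S : Set ℤ) : Set ℤ := {j | j ≤ -1} \ S

/-- The index set `Z^S = {1, 2, …} \ S⁺` of the functional, where `S⁺ = -S`. -/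
def functionalIndex (S : Set ℤ) : Set ℤ := {j | 1 ≤ j} \ {j | -j ∈ S}

/-- The index set `U = S ∪ {0, 1, 2, …}`. -/
def unobserved (S : Set ℤ) : Set ℤ := S ∪ {j | 0 ≤ j}

/-! ### Spectral densities and Fourier coefficients -/

/-- Lebesgue measure on one period. -/
def period : Measure ℝ := volume.restrict (Set.Ioc (-Real.pi) Real.pi)

/-- The exponential `e^{i n x}`. -/
def expo (n : ℤ) (x : ℝ) : ℂ := Complex.exp (Complex.I * (n : ℂ) * (x : ℂ))

/-- Normalised Fourier coefficient `(2π)⁻¹ ∫ g(x) e^{-i n x} dx`. -/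
def coeff (g : ℝ → ℂ) (n : ℤ) : ℂ :=
  (1 / (2 * (Real.pi : ℂ))) * ∫ x, g x * expo (-n) x ∂period

/-- Entrywise Fourier coefficient of a matrix function. -/
def matCoeff {T : ℕ} (W : ℝ → Matrix (Fin T) (Fin T) ℂ) (n : ℤ) : Matrix (Fin T) (Fin T) ℂ :=
  Matrix.of fun i j => coeff (fun x => W x i j) n

/-- A (matrix) spectral density: integrable, Hermitian nonnegative definite almost everywhere. -/
structure IsSpectralDensity {T : ℕ} (F : ℝ → Matrix (Fin T) (Fin T) ℂ) : Prop where
  integrable : ∀ i j, Integrable (fun x => F x i j) period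
  posSemidef : ∀ᵐ x ∂period, (F x).PosSemidef

/-- Minimality condition for `W = F + G`: the matrix `W` is invertible almost everywhere and
`∫ W⁻¹` is finite. -/
structure Minimality {T : ℕ} (W : ℝ → Matrix (Fin T) (Fin T) ℂ) : Prop where
  isUnit : ∀ᵐ x ∂period, IsUnit (W x)
  integrable_inv : ∀ i j, Integrable (fun x => (W x)⁻¹ i j) period

/-! ### The functional, the estimates and their errors -/

/-- `A(e^{ix}) = ∑_{j ∈ Z^S} a(j) e^{-ijx}`. -/
def symbolA {T : ℕ} (S : Set ℤ) (a : ℤ → Fin T → ℂ) (x : ℝ) : Fin T → ℂ :=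
  ∑' j : functionalIndex S, expo (-(j : ℤ)) x • a j

/-- `∫ v(x)ᵀ W(x) conj (v(x)) dx`, with values in `[0, ∞]`. -/
def quad {T : ℕ} (W : ℝ → Matrix (Fin T) (Fin T) ℂ) (v : ℝ → Fin T → ℂ) : ENNReal :=
  ∫⁻ x, ENNReal.ofReal ((Matrix.vecMul (v x) (W x)) ⬝ᵥ star (v x)).re ∂period

/-- Linear span of the functions `e^{inx} δ_k`, `n ∈ ℤ₋ \ S`, `k = 1, …, T`. -/
def observedPolys (T : ℕ) (S : Set ℤ) : Submodule ℂ (ℝ → Fin T → ℂ) :=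
  Submodule.span ℂ {p | ∃ n ∈ observed S, ∃ k : Fin T, p = fun x => Pi.single k (expo n x)}

/-- `h ∈ L₂ˢ(W)`: the closure in `L₂(W)` of the span of `e^{inx} δ_k`, `n ∈ ℤ₋ \ S`. -/
def MemL2s {T : ℕ} (S : Set ℤ) (W : ℝ → Matrix (Fin T) (Fin T) ℂ) (h : ℝ → Fin T → ℂ) : Prop :=
  AEStronglyMeasurable h period ∧
    ∀ ε : ENNReal, 0 < ε → ∃ p ∈ observedPolys T S, quad W (h - p) < ε

/-- The mean-square error `Δ(h; F, G)` of the estimate with spectral characteristic `h`. -/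
def mse {T : ℕ} (S : Set ℤ) (a : ℤ → Fin T → ℂ) (h : ℝ → Fin T → ℂ)
    (F G : ℝ → Matrix (Fin T) (Fin T) ℂ) : ENNReal :=
  ENNReal.ofReal (1 / (2 * Real.pi)) * (quad F (symbolA S a - h) + quad G h)

/-- `h = h(F, G)` is the spectral characteristic of the mean-square optimal linear estimate. -/
def IsOptimal {T : ℕ} (S : Set ℤ) (a : ℤ → Fin T → ℂ) (F G : ℝ → Matrix (Fin T) (Fin T) ℂ)
    (h : ℝ → Fin T → ℂ) : Prop :=
  MemL2s S (F + G) h ∧ ∀ g, MemL2s S (F + G) g → mse S a h F G ≤ mse S a g F G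

/-- The error `Δ(F, G) = Δ(h(F, G); F, G)` of the optimal linear estimate, as the minimum over all
linear estimates. -/
def optimalError {T : ℕ} (S : Set ℤ) (a : ℤ → Fin T → ℂ)
    (F G : ℝ → Matrix (Fin T) (Fin T) ℂ) : ENNReal :=
  ⨅ (h : ℝ → Fin T → ℂ) (_ : MemL2s S (F + G) h), mse S a h F G

/-- For known `G`, the density `F₀` is least favorable in the class `D`. -/
def IsLeastFavorable {T : ℕ} (S : Set ℤ) (a : ℤ → Fin T → ℂ)
    (D : Set (ℝ → Matrix (Fin T) (Fin T) ℂ)) (G F₀ : ℝ → Matrix (Fin T) (Fin T) ℂ) : Prop :=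
  F₀ ∈ D ∧ ∃ h₀, IsOptimal S a F₀ G h₀ ∧
    ∀ F ∈ D, optimalError S a F G ≤ mse S a h₀ F₀ G

/-- `H_D`, the intersection of the spaces `L₂ˢ(F + G)`, `F ∈ D`. -/
def robustChars {T : ℕ} (S : Set ℤ) (D : Set (ℝ → Matrix (Fin T) (Fin T) ℂ))
    (G : ℝ → Matrix (Fin T) (Fin T) ℂ) : Set (ℝ → Fin T → ℂ) :=
  {h | ∀ F ∈ D, MemL2s S (F + G) h}

/-- The largest error `sup_{F ∈ D} Δ(h; F, G)`, in `[0, ∞]`. -/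
def worstError {T : ℕ} (S : Set ℤ) (a : ℤ → Fin T → ℂ)
    (D : Set (ℝ → Matrix (Fin T) (Fin T) ℂ)) (G : ℝ → Matrix (Fin T) (Fin T) ℂ)
    (h : ℝ → Fin T → ℂ) : ENNReal :=
  ⨆ (F : ℝ → Matrix (Fin T) (Fin T) ℂ) (_ : F ∈ D), mse S a h F G

/-- `h₀` is a minimax-robust spectral characteristic: it lies in `H_D`, its largest error is
attained in `D`, and it minimises the largest error over `H_D`. -/
def IsMinimaxRobust {T : ℕ} (S : Set ℤ) (a : ℤ → Fin T → ℂ)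
    (D : Set (ℝ → Matrix (Fin T) (Fin T) ℂ)) (G : ℝ → Matrix (Fin T) (Fin T) ℂ)
    (h₀ : ℝ → Fin T → ℂ) : Prop :=
  h₀ ∈ robustChars S D G ∧
    (∃ F ∈ D, mse S a h₀ F G = worstError S a D G h₀) ∧
    ∀ h ∈ robustChars S D G, worstError S a D G h₀ ≤ worstError S a D G h

/-! ### The operators `B`, `R`, `Q`

Coefficient vectors act as rows, in accordance with `hᵀ = Aᵀ F (F+G)⁻¹ - Cᵀ (F+G)⁻¹`. -/

/-- `B(k,j)`, the Fourier coefficients of `(F+G)⁻¹`. -/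
def blockB {T : ℕ} (F G : ℝ → Matrix (Fin T) (Fin T) ℂ) (k j : ℤ) : Matrix (Fin T) (Fin T) ℂ :=
  matCoeff (fun x => (F x + G x)⁻¹) (k - j)

/-- `R(k,j)`, the Fourier coefficients of `F (F+G)⁻¹`. -/
def blockR {T : ℕ} (F G : ℝ → Matrix (Fin T) (Fin T) ℂ) (k j : ℤ) : Matrix (Fin T) (Fin T) ℂ :=
  matCoeff (fun x => F x * (F x + G x)⁻¹) (k + j)

/-- `Q(k,j)`, the Fourier coefficients of `F (F+G)⁻¹ G`. -/
def blockQ {T : ℕ} (F G : ℝ → Matrix (Fin T) (Fin T) ℂ) (k j : ℤ) : Matrix (Fin T) (Fin T) ℂ :=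
  matCoeff (fun x => F x * (F x + G x)⁻¹ * G x) (k - j)

/-- The sequence `R a`, indexed by `U`. -/
def vecRa {T : ℕ} (S : Set ℤ) (a : ℤ → Fin T → ℂ) (F G : ℝ → Matrix (Fin T) (Fin T) ℂ)
    (k : unobserved S) : Fin T → ℂ :=
  ∑' j : functionalIndex S, Matrix.vecMul (a j) (blockR F G k j)

/-- The form `⟨Q a, a⟩ = ∑_{j,k} a(j)ᵀ Q(j,k) conj (a(k))`. -/
def formQ {T : ℕ} (S : Set ℤ) (a : ℤ → Fin T → ℂ) (F G : ℝ → Matrix (Fin T) (Fin T) ℂ) : ℂ :=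
  ∑' k : functionalIndex S,
    (∑' j : functionalIndex S, Matrix.vecMul (a j) (blockQ F G j k)) ⬝ᵥ star (a k)

/-- The operator with block matrix `B` on finitely supported sequences:
`(B c)(k) = ∑_j c(j)ᵀ B(k,j)`. -/
def applyB {T : ℕ} {S : Set ℤ} (F G : ℝ → Matrix (Fin T) (Fin T) ℂ)
    (c : unobserved S →₀ (Fin T → ℂ)) (k : unobserved S) : Fin T → ℂ :=
  c.sum fun j v => Matrix.vecMul v (blockB F G k j)

/-- The pairing `⟨y, c⟩ = ∑_k y(k)ᵀ conj (c(k))` with a finitely supported sequence `c`. -/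
def pairing {T : ℕ} {I : Type*} (y : I → Fin T → ℂ) (c : I →₀ (Fin T → ℂ)) : ℂ :=
  c.sum fun k v => y k ⬝ᵥ star v

/-- The finitely supported sequences `c n` approximate `B⁻¹ y`: they are Cauchy for the norm
`⟨B c, c⟩^{1/2}` of the positive operator `B`, and `B (c n)` tends to `y` coordinatewise.

Under the minimality condition `B` is a positive, possibly unbounded operator and its inverse is
that of its closure in this norm. If `B` is bounded with a bounded inverse, the norm is equivalent
to that of `ℓ₂` and one gets the usual inverse in `ℓ₂`. -/
def ApproximatesInverse {T : ℕ} {S : Set ℤ} (F G : ℝ → Matrix (Fin T) (Fin T) ℂ)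
    (y : unobserved S → Fin T → ℂ) (c : ℕ → (unobserved S →₀ (Fin T → ℂ))) : Prop :=
  (∀ ε : ℝ, 0 < ε → ∃ n₀ : ℕ, ∀ m ≥ n₀, ∀ n ≥ n₀,
    (pairing (applyB F G (c m - c n)) (c m - c n)).re < ε) ∧
  ∀ k, Tendsto (fun n => applyB F G (c n) k) atTop (𝓝 (y k))

/-- `c = B⁻¹ y`. -/
def IsInverseImage {T : ℕ} {S : Set ℤ} (F G : ℝ → Matrix (Fin T) (Fin T) ℂ)
    (y c : unobserved S → Fin T → ℂ) : Prop :=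
  ∃ u : ℕ → (unobserved S →₀ (Fin T → ℂ)), ApproximatesInverse F G y u ∧
    ∀ k, Tendsto (fun n => u n k) atTop (𝓝 (c k))

/-- `v = ⟨y, B⁻¹ y⟩`. -/
def IsInverseForm {T : ℕ} {S : Set ℤ} (F G : ℝ → Matrix (Fin T) (Fin T) ℂ)
    (y : unobserved S → Fin T → ℂ) (v : ℂ) : Prop :=
  ∃ u : ℕ → (unobserved S →₀ (Fin T → ℂ)), ApproximatesInverse F G y u ∧
    Tendsto (fun n => pairing y (u n)) atTop (𝓝 v)

/-- `C(x) = ∑_{k ∈ U} c(k) e^{ikx}`, as the integrable function with these Fourier coefficients. -/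
def IsSumOfSeries {T : ℕ} {S : Set ℤ} (c : unobserved S → Fin T → ℂ)
    (C : ℝ → Fin T → ℂ) : Prop :=
  (∀ i, Integrable (fun x => C x i) period) ∧
  (∀ (k : unobserved S) (i : Fin T), coeff (fun x => C x i) k = c k i) ∧
  ∀ k : ℤ, k ∉ unobserved S → ∀ i : Fin T, coeff (fun x => C x i) k = 0

/-- `C(x) = ∑_{k ∈ U} (B⁻¹ R a)(k) e^{ikx}`. -/
def IsSeriesC {T : ℕ} (S : Set ℤ) (a : ℤ → Fin T → ℂ) (F G : ℝ → Matrix (Fin T) (Fin T) ℂ)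
    (C : ℝ → Fin T → ℂ) : Prop :=
  ∃ c : unobserved S → Fin T → ℂ, IsInverseImage F G (vecRa S a F G) c ∧ IsSumOfSeries c C

/-- The formula `hᵀ = Aᵀ F (F+G)⁻¹ - Cᵀ (F+G)⁻¹`. -/
def charFormula {T : ℕ} (S : Set ℤ) (a : ℤ → Fin T → ℂ) (F G : ℝ → Matrix (Fin T) (Fin T) ℂ)
    (C : ℝ → Fin T → ℂ) (x : ℝ) : Fin T → ℂ :=
  Matrix.vecMul (symbolA S a x) (F x * (F x + G x)⁻¹) - Matrix.vecMul (C x) (F x + G x)⁻¹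

/-- `r_Gᵀ = (Aᵀ G + Cᵀ) (F+G)⁻¹`. -/
def rG {T : ℕ} (S : Set ℤ) (a : ℤ → Fin T → ℂ) (F G : ℝ → Matrix (Fin T) (Fin T) ℂ)
    (C : ℝ → Fin T → ℂ) (x : ℝ) : Fin T → ℂ :=
  Matrix.vecMul (Matrix.vecMul (symbolA S a x) (G x) + C x) (F x + G x)⁻¹

/-- The `T × T` matrix `r_G^* r_Gᵀ`, with entries `conj (r_i) r_j`. -/
def gramG {T : ℕ} (S : Set ℤ) (a : ℤ → Fin T → ℂ) (F G : ℝ → Matrix (Fin T) (Fin T) ℂ)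
    (C : ℝ → Fin T → ℂ) (x : ℝ) : Matrix (Fin T) (Fin T) ℂ :=
  Matrix.vecMulVec (star (rG S a F G C x)) (rG S a F G C x)

/-- `t = ⟨R a, B⁻¹ R a⟩ + ⟨Q a, a⟩`, the objective of the extremum problem. -/
def IsObjective {T : ℕ} (S : Set ℤ) (a : ℤ → Fin T → ℂ) (F G : ℝ → Matrix (Fin T) (Fin T) ℂ)
    (t : ℝ) : Prop :=
  ∃ v : ℂ, IsInverseForm F G (vecRa S a F G) v ∧ t = (v + formQ S a F G).re

/-- For known `G`, the pair `(F₀, G)` solves the extremum problem: the objective attains at `F₀`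
its maximum over the `F ∈ D` for which it is defined, that is, with `F + G` minimal. -/
def SolvesExtremum {T : ℕ} (S : Set ℤ) (a : ℤ → Fin T → ℂ)
    (D : Set (ℝ → Matrix (Fin T) (Fin T) ℂ)) (G F₀ : ℝ → Matrix (Fin T) (Fin T) ℂ) : Prop :=
  F₀ ∈ D ∧ ∃ t₀, IsObjective S a F₀ G t₀ ∧
    ∀ F ∈ D, Minimality (F + G) → ∀ t, IsObjective S a F G t → t ≤ t₀

/-! ### The classes `D_{1δ}^k` -/

/-- `⟨B, F⟩ = ∑_{i,j} b_{ij} f_{ij}`. -/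
def bracket {T : ℕ} (B W : Matrix (Fin T) (Fin T) ℂ) : ℂ := ∑ i, ∑ j, B i j * W i j

/-- `(2π)⁻¹ ∫ |g(x)| dx`. -/
def meanAbs (g : ℝ → ℂ) : ℝ := (1 / (2 * Real.pi)) * ∫ x, ‖g x‖ ∂period

/-- The class `D_{1δ}^1`. -/
def class1 {T : ℕ} (F₁ : ℝ → Matrix (Fin T) (Fin T) ℂ) (δ : ℝ) :
    Set (ℝ → Matrix (Fin T) (Fin T) ℂ) :=
  {F | IsSpectralDensity F ∧ meanAbs (fun x => (F x - F₁ x).trace) ≤ δ}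

/-- The class `D_{1δ}^2`. -/
def class2 {T : ℕ} (F₁ : ℝ → Matrix (Fin T) (Fin T) ℂ) (δ : Fin T → ℝ) :
    Set (ℝ → Matrix (Fin T) (Fin T) ℂ) :=
  {F | IsSpectralDensity F ∧ ∀ k, meanAbs (fun x => F x k k - F₁ x k k) ≤ δ k}

/-- The class `D_{1δ}^3`. -/
def class3 {T : ℕ} (F₁ : ℝ → Matrix (Fin T) (Fin T) ℂ) (B₁ : Matrix (Fin T) (Fin T) ℂ) (δ : ℝ) :
    Set (ℝ → Matrix (Fin T) (Fin T) ℂ) :=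
  {F | IsSpectralDensity F ∧ meanAbs (fun x => bracket B₁ (F x - F₁ x)) ≤ δ}

/-- The class `D_{1δ}^4`. -/
def class4 {T : ℕ} (F₁ : ℝ → Matrix (Fin T) (Fin T) ℂ) (δ : Fin T → Fin T → ℝ) :
    Set (ℝ → Matrix (Fin T) (Fin T) ℂ) :=
  {F | IsSpectralDensity F ∧ ∀ i j, meanAbs (fun x => F x i j - F₁ x i j) ≤ δ i j}

/-! ### The relations for the least favorable density -/

/-- `r_G^* r_Gᵀ = α² γ (F₀+G)²` and `(2π)⁻¹ ∫ |Tr (F₀ - F₁)| = δ`, where `|γ| ≤ 1` and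
`γ = sign Tr (F₀ - F₁)` where `Tr (F₀ - F₁) ≠ 0`. -/
def Relations1 {T : ℕ} (S : Set ℤ) (a : ℤ → Fin T → ℂ) (F₁ G F₀ : ℝ → Matrix (Fin T) (Fin T) ℂ)
    (δ : ℝ) : Prop :=
  (∃ C, IsSeriesC S a F₀ G C ∧ ∃ (α : ℝ) (γ : ℝ → ℝ), ∀ᵐ x ∂period,
    |γ x| ≤ 1 ∧
    ((F₀ x - F₁ x).trace ≠ 0 → γ x = Real.sign (F₀ x - F₁ x).trace.re) ∧
    gramG S a F₀ G C x = ((α ^ 2 * γ x : ℝ) : ℂ) • (F₀ x + G x) ^ 2) ∧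
  meanAbs (fun x => (F₀ x - F₁ x).trace) = δ

/-- `r_G^* r_Gᵀ = (F₀+G) diag(α_k² γ_k) (F₀+G)` and `(2π)⁻¹ ∫ |f⁰_{kk} - f¹_{kk}| = δ_k`, where
`|γ_k| ≤ 1` and `γ_k = sign (f⁰_{kk} - f¹_{kk})` where `f⁰_{kk} ≠ f¹_{kk}`. -/
def Relations2 {T : ℕ} (S : Set ℤ) (a : ℤ → Fin T → ℂ) (F₁ G F₀ : ℝ → Matrix (Fin T) (Fin T) ℂ)
    (δ : Fin T → ℝ) : Prop :=
  (∃ C, IsSeriesC S a F₀ G C ∧ ∃ (α : Fin T → ℝ) (γ : Fin T → ℝ → ℝ), ∀ᵐ x ∂period,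
    (∀ k, |γ k x| ≤ 1) ∧
    (∀ k, F₀ x k k - F₁ x k k ≠ 0 → γ k x = Real.sign (F₀ x k k - F₁ x k k).re) ∧
    gramG S a F₀ G C x =
      (F₀ x + G x) * Matrix.diagonal (fun k => ((α k ^ 2 * γ k x : ℝ) : ℂ)) * (F₀ x + G x)) ∧
  ∀ k, meanAbs (fun x => F₀ x k k - F₁ x k k) = δ k

/-- `r_G^* r_Gᵀ = α² γ' (F₀+G) B₁ᵀ (F₀+G)` and `(2π)⁻¹ ∫ |⟨B₁, F₀ - F₁⟩| = δ`, where `|γ'| ≤ 1`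
and `γ' = sign ⟨B₁, F₀ - F₁⟩` where `⟨B₁, F₀ - F₁⟩ ≠ 0`. -/
def Relations3 {T : ℕ} (S : Set ℤ) (a : ℤ → Fin T → ℂ) (F₁ G F₀ : ℝ → Matrix (Fin T) (Fin T) ℂ)
    (B₁ : Matrix (Fin T) (Fin T) ℂ) (δ : ℝ) : Prop :=
  (∃ C, IsSeriesC S a F₀ G C ∧ ∃ (α : ℝ) (γ : ℝ → ℝ), ∀ᵐ x ∂period,
    |γ x| ≤ 1 ∧
    (bracket B₁ (F₀ x - F₁ x) ≠ 0 → γ x = Real.sign (bracket B₁ (F₀ x - F₁ x)).re) ∧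
    gramG S a F₀ G C x =
      ((α ^ 2 * γ x : ℝ) : ℂ) • ((F₀ x + G x) * B₁.transpose * (F₀ x + G x))) ∧
  meanAbs (fun x => bracket B₁ (F₀ x - F₁ x)) = δ

/-- `r_G^* r_Gᵀ = (F₀+G) {α_{ij} γ_{ij}} (F₀+G)` and `(2π)⁻¹ ∫ |f⁰_{ij} - f¹_{ij}| = δ_{ij}`, where
`|γ_{ij}| ≤ 1` and `γ_{ij} = (f⁰_{ij} - f¹_{ij}) / |f⁰_{ij} - f¹_{ij}|` where
`f⁰_{ij} ≠ f¹_{ij}`. -/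
def Relations4 {T : ℕ} (S : Set ℤ) (a : ℤ → Fin T → ℂ) (F₁ G F₀ : ℝ → Matrix (Fin T) (Fin T) ℂ)
    (δ : Fin T → Fin T → ℝ) : Prop :=
  (∃ C, IsSeriesC S a F₀ G C ∧ ∃ (α : Fin T → Fin T → ℂ) (γ : Fin T → Fin T → ℝ → ℂ),
    ∀ᵐ x ∂period,
    (∀ i j, ‖γ i j x‖ ≤ 1) ∧
    (∀ i j, F₀ x i j - F₁ x i j ≠ 0 →
      γ i j x = (F₀ x i j - F₁ x i j) / ((‖F₀ x i j - F₁ x i j‖ : ℝ) : ℂ)) ∧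
    gramG S a F₀ G C x =
      (F₀ x + G x) * Matrix.of (fun i j => α i j * γ i j x) * (F₀ x + G x)) ∧
  ∀ i j, meanAbs (fun x => F₀ x i j - F₁ x i j) = δ i j

/-- The minimax-robust spectral characteristic for the class `D` exists, is unique up to null
sets, and is given by `hᵀ = Aᵀ F₀ (F₀+G)⁻¹ - (∑_{k ∈ U} (B⁻¹ R a)(k) e^{ikx})ᵀ (F₀+G)⁻¹`. -/
def MinimaxGivenByFormula {T : ℕ} (S : Set ℤ) (a : ℤ → Fin T → ℂ)
    (D : Set (ℝ → Matrix (Fin T) (Fin T) ℂ)) (G F₀ : ℝ → Matrix (Fin T) (Fin T) ℂ) : Prop :=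
  ∃ C, IsSeriesC S a F₀ G C ∧
    ∀ h : ℝ → Fin T → ℂ, IsMinimaxRobust S a D G h ↔ h =ᵐ[period] charFormula S a F₀ G C

end Filtering

end

noncomputable section

namespace Filtering

/-! ### Fourier coefficients -/

/-! Put P = F + G and let σ be its Hermitian square root, τ = σ⁻¹. Completing the square gives
2πΔ(h; F, G) = ‖hσ - ξ‖² + residual, where ξ = AᵀFτ and the residual does not depend on h
(`error_decomposition`, `mse_eq`). As v ↦ vσ is an isometry of L₂(P) onto L₂, the optimal estimate
is the projection of ξ on the closed span K of the observed exponentials times σ.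

The duality `expoSpan_observed_orthogonal` says that Kᗮ is the closed span of the unobserved
exponentials times τ. One inclusion is biorthogonality. For the other, a vector κ orthogonal to both
spans yields integrable functions κτ and κσ with complementary spectra whose pointwise product is
|κ|². Because S is finite, the spectra separate, up to finitely many frequencies, into a negative
and a nonnegative half-line, and the integral of the product should vanish. The factors are only
integrable, so Parseval does not apply directly; they are first multiplied by squares of outer
functions that tend to 1 (`exists_outer`, `integral_sum_mul_eq_zero`).

Up to the factor 2π, B is the Gram matrix of the vectors spanning Kᗮ, and Ra lists the products of ξ
with them. Thus B⁻¹Ra describes the projection of ξ on Kᗮ (`approximatesInverse_iff`), the stated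
formula is the projection on K, and the objective of the extremum problem is the minimal error
(`isObjective_iff`, `mse_eq_ofReal_objective`).

It remains to pass from a maximum of minimal errors to the saddle-point inequality Δ(h₀; F, G) ≤
Δ(h₀; F⁰, G). The classes are convex, and (1-ε)F⁰ + εF satisfies minimality together with G for
every ε < 1, even if F does not. Its optimal estimate h_ε minimises (1-ε)Δ(·; F⁰, G) + εΔ(·; F, G),
and by extremality the minimum is at most Δ(h₀; F⁰, G). As ε decreases to 0 the numbers Δ(h_ε; F, G)
increase and stay bounded, which, as in Tikhonov regularisation, makes h_ε Cauchy in L₂(F+G), while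
h_ε → h₀ in L₂(F⁰+G). Fatou's lemma joins the two limits (`memL2s_and_mse_le_of_mix`). The saddle
point makes h₀ minimax, and the Pythagorean identity at F⁰ makes it unique. -/

lemma expo_zero (x : ℝ) : expo 0 x = 1 := by simp [expo]

lemma expo_add (m n : ℤ) (x : ℝ) : expo (m + n) x = expo m x * expo n x := by
  simp only [expo, ← Complex.exp_add]
  push_cast
  ring_nf

lemma norm_expo (n : ℤ) (x : ℝ) : ‖expo n x‖ = 1 := by
  have : Complex.I * (n : ℂ) * (x : ℂ) = ((n * x : ℝ) : ℂ) * Complex.I := by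
    push_cast; ring
  rw [expo, this, Complex.norm_exp_ofReal_mul_I]

lemma star_expo (n : ℤ) (x : ℝ) : star (expo n x) = expo (-n) x := by
  simp only [expo, Complex.star_def, ← Complex.exp_conj, map_mul, Complex.conj_I,
    Complex.conj_ofReal, map_intCast]
  push_cast
  ring_nf

lemma continuous_expo (n : ℤ) : Continuous (expo n) := by
  unfold expo
  fun_prop

instance : IsFiniteMeasure period := by
  unfold period
  infer_instance

lemma period_univ : period Set.univ = ENNReal.ofReal (2 * Real.pi) := by
  simp only [period, Measure.restrict_apply_univ, Real.volume_Ioc]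
  congr 1; ring

lemma period_real_univ : period.real Set.univ = 2 * Real.pi := by
  rw [Measure.real, period_univ, ENNReal.toReal_ofReal (by positivity)]

lemma Integrable.mul_expo {g : ℝ → ℂ} (hg : Integrable g period) (n : ℤ) :
    Integrable (fun x => g x * expo n x) period :=
  hg.mul_bdd (c := 1) (continuous_expo n).aestronglyMeasurable
    (Eventually.of_forall fun x => (norm_expo n x).le)

lemma Integrable.expo_mul {g : ℝ → ℂ} (hg : Integrable g period) (n : ℤ) :
    Integrable (fun x => expo n x * g x) period := by
  simpa only [mul_comm] using Integrable.mul_expo hg n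

lemma integral_mul_expo (g : ℝ → ℂ) (n : ℤ) :
    ∫ x, g x * expo (-n) x ∂period = 2 * Real.pi * coeff g n := by
  have : (Real.pi : ℂ) ≠ 0 := by exact_mod_cast Real.pi_ne_zero
  rw [coeff]
  field_simp

lemma coeff_eq_zero_iff {g : ℝ → ℂ} {n : ℤ} :
    coeff g n = 0 ↔ ∫ x, g x * expo (-n) x ∂period = 0 := by
  have : (Real.pi : ℂ) ≠ 0 := by exact_mod_cast Real.pi_ne_zero
  simp [integral_mul_expo, this]

lemma coeff_congr {f g : ℝ → ℂ} (h : f =ᵐ[period] g) (n : ℤ) : coeff f n = coeff g n := by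
  unfold coeff
  congr 1
  exact integral_congr_ae (h.mono fun x hx => by simp only [hx])

lemma coeff_sub {f g : ℝ → ℂ} (hf : Integrable f period) (hg : Integrable g period) (n : ℤ) :
    coeff (fun x => f x - g x) n = coeff f n - coeff g n := by
  unfold coeff
  rw [← mul_sub, ← integral_sub (Integrable.mul_expo hf _) (Integrable.mul_expo hg _)]
  simp only [sub_mul]

lemma coeff_const_mul (c : ℂ) (f : ℝ → ℂ) (n : ℤ) :
    coeff (fun x => c * f x) n = c * coeff f n := by
  unfold coeff
  simp only [mul_assoc, integral_const_mul]
  ring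

lemma coeff_mul_const (c : ℂ) (f : ℝ → ℂ) (n : ℤ) :
    coeff (fun x => f x * c) n = coeff f n * c := by
  simp only [mul_comm _ c, coeff_const_mul]

lemma coeff_sum {ι : Type*} (s : Finset ι) {f : ι → ℝ → ℂ}
    (hf : ∀ i ∈ s, Integrable (f i) period) (n : ℤ) :
    coeff (fun x => ∑ i ∈ s, f i x) n = ∑ i ∈ s, coeff (f i) n := by
  unfold coeff
  rw [← Finset.mul_sum, ← integral_finsetSum _ fun i hi => Integrable.mul_expo (hf i hi) _]
  simp only [Finset.sum_mul]

lemma coeff_expo_mul (m : ℤ) (g : ℝ → ℂ) (n : ℤ) :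
    coeff (fun x => expo m x * g x) n = coeff g (n - m) := by
  unfold coeff
  congr 2
  ext x
  rw [show -(n - m) = m + -n by ring, expo_add]
  ring

lemma coeff_star (g : ℝ → ℂ) (n : ℤ) : coeff (fun x => star (g x)) n = star (coeff g (-n)) := by
  unfold coeff
  have : ∀ x, star (g x) * expo (-n) x = star (g x * expo (-(-n)) x) := fun x => by
    rw [star_mul', star_expo, neg_neg]
  have h2 : ∫ x, star (g x * expo (-(-n)) x) ∂period = star (∫ x, g x * expo (-(-n)) x ∂period) :=
    integral_conj
  have h3 : star (1 / (2 * (Real.pi : ℂ))) = 1 / (2 * (Real.pi : ℂ)) := by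
    simp [Complex.conj_ofReal]
  rw [star_mul', h3, ← h2]
  simp only [this]

lemma integral_expo {n : ℤ} (hn : n ≠ 0) : ∫ x, expo n x ∂period = 0 := by
  have hc : Complex.I * (n : ℂ) ≠ 0 := mul_ne_zero Complex.I_ne_zero (by exact_mod_cast hn)
  have h := integral_exp_mul_complex (a := -Real.pi) (b := Real.pi) hc
  rw [intervalIntegral.integral_of_le (by linarith [Real.pi_pos])] at h
  rw [period]
  refine h.trans ?_
  rw [div_eq_zero_iff, sub_eq_zero]
  left
  rw [Complex.exp_eq_exp_iff_exists_int]
  exact ⟨n, by push_cast; ring⟩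

lemma coeff_expo_of_ne {m n : ℤ} (h : m ≠ n) : coeff (expo m) n = 0 := by
  rw [coeff_eq_zero_iff]
  simp only [← expo_add]
  exact integral_expo (by omega)

lemma coeff_expo_self (n : ℤ) : coeff (expo n) n = 1 := by
  have : (Real.pi : ℂ) ≠ 0 := by exact_mod_cast Real.pi_ne_zero
  simp only [coeff, ← expo_add, add_neg_cancel, expo_zero, integral_const, period_real_univ]
  simp
  field_simp

instance : Fact (0 < 2 * Real.pi) := ⟨by positivity⟩

lemma fourier_coe_eq_expo (n : ℤ) (x : ℝ) :
    fourier n (x : AddCircle (2 * Real.pi)) = expo n x := by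
  rw [fourier_coe_apply, expo]
  congr 1
  have : (Real.pi : ℂ) ≠ 0 := by exact_mod_cast Real.pi_ne_zero
  push_cast
  field_simp

/-- Integration against f is a functional on C(circle) bounded by the L¹ norm of f. It kills every
exponential, and these span a dense subspace. -/
lemma integral_mul_continuous_eq_zero {f : ℝ → ℂ} (hf : Integrable f period)
    (h : ∀ n, coeff f n = 0) (φ : C(AddCircle (2 * Real.pi), ℂ)) :
    ∫ x, f x * φ (x : AddCircle (2 * Real.pi)) ∂period = 0 := by
  have hint : ∀ φ : C(AddCircle (2 * Real.pi), ℂ),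
      Integrable (fun x => f x * φ (x : AddCircle (2 * Real.pi))) period := fun φ =>
    hf.mul_bdd (c := ‖φ‖)
      ((φ.continuous.comp (AddCircle.continuous_mk' _)).aestronglyMeasurable)
      (Eventually.of_forall fun x => φ.norm_coe_le_norm _)
  let L : C(AddCircle (2 * Real.pi), ℂ) →ₗ[ℂ] ℂ :=
    { toFun := fun φ => ∫ x, f x * φ (x : AddCircle (2 * Real.pi)) ∂period
      map_add' := fun φ ψ => by
        rw [← integral_add (hint φ) (hint ψ)]
        simp only [ContinuousMap.add_apply, mul_add]
      map_smul' := fun c φ => by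
        simp only [ContinuousMap.smul_apply, smul_eq_mul, RingHom.id_apply,
          ← integral_const_mul]
        congr 1; ext x; ring }
  have hL : Continuous L := by
    refine AddMonoidHomClass.continuous_of_bound L (∫ x, ‖f x‖ ∂period) fun φ => ?_
    refine (norm_integral_le_integral_norm _).trans ?_
    rw [← integral_mul_const]
    refine integral_mono (hint φ).norm (hf.norm.mul_const _) fun x => ?_
    simp only [norm_mul]
    gcongr
    exact φ.norm_coe_le_norm _
  have hmem : φ ∈ (Submodule.span ℂ (Set.range (@fourier (2 * Real.pi)))).topologicalClosure := by
    rw [span_fourier_closure_eq_top]; trivial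
  have hle : (Submodule.span ℂ (Set.range (@fourier (2 * Real.pi)))).topologicalClosure
      ≤ LinearMap.ker L := by
    refine Submodule.topologicalClosure_minimal _ ?_ (isClosed_singleton.preimage hL)
    rw [Submodule.span_le]
    rintro _ ⟨n, rfl⟩
    have := coeff_eq_zero_iff.1 (h (-n))
    simpa [L, fourier_coe_eq_expo, -fourier_apply] using this
  exact hle hmem

/-- An integrable function is determined by its Fourier coefficients. -/
lemma ae_eq_zero_of_coeff_eq_zero {f : ℝ → ℂ} (hf : Integrable f period)
    (h : ∀ n, coeff f n = 0) : f =ᵐ[period] 0 := by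
  have key : ∀ᵐ x ∂(volume : Measure ℝ), x ∈ Set.Ioo (-Real.pi) Real.pi → f x = 0 := by
    refine isOpen_Ioo.ae_eq_zero_of_integral_contDiff_smul_eq_zero ?_ ?_
    · refine IntegrableOn.locallyIntegrableOn ?_
      exact IntegrableOn.mono_set (t := Set.Ioc (-Real.pi) Real.pi) hf Set.Ioo_subset_Ioc_self
    · intro g hg _ hsupp
      have hzero : ∀ x, x ∉ Set.Ioo (-Real.pi) Real.pi → g x = 0 := fun x hx =>
        image_eq_zero_of_notMem_tsupport fun hx' => hx (hsupp hx')
      -- A test function supported in the open interval vanishes at both endpoints, so it closes up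
      -- to a continuous function on the circle.
      have hcont : Continuous (AddCircle.liftIoc (2 * Real.pi) (-Real.pi) (fun x => (g x : ℂ))) := by
        refine AddCircle.liftIoc_continuous ?_ ?_
        · have h1 : g (-Real.pi) = 0 := hzero _ (by simp)
          have h2 : g (-Real.pi + 2 * Real.pi) = 0 := hzero _ fun hx => by linarith [hx.2]
          simp only [h1, h2]
        · have := hg.continuous
          fun_prop
      have := integral_mul_continuous_eq_zero hf h ⟨_, hcont⟩
      rw [← setIntegral_eq_integral_of_forall_compl_eq_zero (s := Set.Ioc (-Real.pi) Real.pi)]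
      · rw [← this, period]
        refine setIntegral_congr_fun measurableSet_Ioc fun x hx => ?_
        simp only [ContinuousMap.coe_mk]
        rw [AddCircle.liftIoc_coe_apply (by rwa [show -Real.pi + 2 * Real.pi = Real.pi by ring])]
        simp [mul_comm]
      · intro x hx
        rw [hzero x fun hx' => hx (Set.Ioo_subset_Ioc_self hx'), zero_smul]
  rw [period, ← Measure.restrict_congr_set Ioo_ae_eq_Ioc]
  exact (ae_restrict_iff' measurableSet_Ioo).2 key

lemma ae_eq_of_coeff_eq {f g : ℝ → ℂ} (hf : Integrable f period) (hg : Integrable g period)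
    (h : ∀ n, coeff f n = coeff g n) : f =ᵐ[period] g := by
  have := ae_eq_zero_of_coeff_eq_zero (hf.sub hg) fun n => by
    rw [show f - g = fun x => f x - g x from rfl, coeff_sub hf hg, h, sub_self]
  exact this.mono fun x hx => sub_eq_zero.1 hx

/-- Square integrable functions whose Fourier coefficients have disjoint supports are
orthogonal. -/
lemma integral_mul_eq_zero_of_coeff {f g : ℝ → ℂ} (hf : MemLp f 2 period) (hg : MemLp g 2 period)
    {N : Set ℤ} (hfN : ∀ n, n ∉ N → coeff f n = 0) (hgN : ∀ n ∈ N, coeff g (-n) = 0) :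
    ∫ x, f x * g x ∂period = 0 := by
  have he : ∀ n, MemLp (expo n) 2 period := fun n =>
    MemLp.of_bound (continuous_expo n).aestronglyMeasurable 1
      (Eventually.of_forall fun x => (norm_expo n x).le)
  let e : ℤ → Lp ℂ 2 period := fun n => (he n).toLp
  have hinner : ∀ (n : ℤ) (φ : Lp ℂ 2 period), inner ℂ (e n) φ = 2 * Real.pi * coeff φ n := by
    intro n φ
    rw [L2.inner_def, ← integral_mul_expo]
    refine integral_congr_ae ((he n).coeFn_toLp.mono fun x hx => ?_)
    simp only [e, hx, RCLike.inner_apply, ← star_expo]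
    rfl
  have hpi : (2 * Real.pi : ℂ) ≠ 0 := by simp [Real.pi_ne_zero]
  let K : Submodule ℂ (Lp ℂ 2 period) := (Submodule.span ℂ (e '' N)).topologicalClosure
  have : CompleteSpace K := (Submodule.isClosed_topologicalClosure _).completeSpace_coe
  set φ : Lp ℂ 2 period := hf.toLp with hφ
  have hgs : MemLp (fun x => star (g x)) 2 period := hg.star
  set γ : Lp ℂ 2 period := hgs.toLp with hγ
  -- The residue of f after projection has no Fourier coefficients at all: those in N vanish by
  -- orthogonality, the others because neither f nor the span has any.
  have hφK : φ ∈ K := by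
    have hp := K.sub_starProjection_mem_orthogonal φ
    have hP : K.starProjection φ ∈ K := Submodule.starProjection_apply_mem K φ
    have hKc : ∀ n, n ∉ N → ∀ ψ ∈ K, inner ℂ (e n) ψ = 0 := by
      intro n hn ψ hψ
      have hle : K ≤ (ℂ ∙ (e n))ᗮ := by
        refine Submodule.topologicalClosure_minimal _ ?_ (Submodule.isClosed_orthogonal _)
        rw [Submodule.span_le]
        rintro _ ⟨m, hm, rfl⟩
        rw [SetLike.mem_coe, Submodule.mem_orthogonal_singleton_iff_inner_right, hinner,
          coeff_congr (he m).coeFn_toLp]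
        simp [coeff_expo_of_ne (show m ≠ n from fun h => hn (h ▸ hm))]
      exact Submodule.mem_orthogonal_singleton_iff_inner_right.1 (hle hψ)
    have hzero : φ - K.starProjection φ = 0 := by
      rw [Lp.eq_zero_iff_ae_eq_zero]
      refine ae_eq_zero_of_coeff_eq_zero ((Lp.memLp _).integrable one_le_two) fun n => ?_
      refine (mul_eq_zero.1 ((hinner n _).symm.trans ?_)).resolve_left hpi
      by_cases hn : n ∈ N
      · exact hp _ (Submodule.le_topologicalClosure _ (Submodule.subset_span ⟨n, hn, rfl⟩))
      · rw [inner_sub_right, hKc n hn _ hP, hinner, coeff_congr hf.coeFn_toLp, hfN n hn]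
        simp
    rw [sub_eq_zero.1 hzero]
    exact hP
  have hle : K ≤ (ℂ ∙ γ)ᗮ := by
    refine Submodule.topologicalClosure_minimal _ ?_ (Submodule.isClosed_orthogonal _)
    rw [Submodule.span_le]
    rintro _ ⟨m, hm, rfl⟩
    rw [SetLike.mem_coe, Submodule.mem_orthogonal_singleton_iff_inner_left, hinner,
      coeff_congr hgs.coeFn_toLp, coeff_star, hgN m hm]
    simp
  have := Submodule.mem_orthogonal_singleton_iff_inner_right.1 (hle hφK)
  rw [L2.inner_def] at this
  rw [← this]
  refine integral_congr_ae ?_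
  filter_upwards [hf.coeFn_toLp, hgs.coeFn_toLp] with x hx hx'
  simp only [hφ, hγ, hx, hx', RCLike.inner_apply]
  simp

/-! ### Analytic functions with integrable boundary values -/

/-- The integral is the inner product with conj b, hence continuous in the other factor. This lets
products of limits be evaluated one factor at a time. -/
lemma integral_mul_eq_zero_of_mem_closure {A : Set (Lp ℂ 2 period)} {φ : Lp ℂ 2 period}
    (hφ : φ ∈ (Submodule.span ℂ A).topologicalClosure) {b : ℝ → ℂ} (hb : MemLp b 2 period)
    (h : ∀ u ∈ A, ∫ x, u x * b x ∂period = 0) : ∫ x, φ x * b x ∂period = 0 := by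
  have hbs : MemLp (fun x => star (b x)) 2 period := hb.star
  have hinner : ∀ u : Lp ℂ 2 period, inner ℂ hbs.toLp u = ∫ x, u x * b x ∂period := fun u => by
    rw [L2.inner_def]
    refine integral_congr_ae (hbs.coeFn_toLp.mono fun x hx => ?_)
    simp only [hx, RCLike.inner_apply]
    simp
  have hle : (Submodule.span ℂ A).topologicalClosure ≤ (ℂ ∙ hbs.toLp)ᗮ := by
    refine Submodule.topologicalClosure_minimal _ ?_ (Submodule.isClosed_orthogonal _)
    rw [Submodule.span_le]
    intro u hu
    rw [SetLike.mem_coe, Submodule.mem_orthogonal_singleton_iff_inner_right, hinner]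
    exact h u hu
  rw [← hinner]
  exact Submodule.mem_orthogonal_singleton_iff_inner_right.1 (hle hφ)

/-- The functions `e^{inx} s(x)`, `n ≤ 0`, as elements of `L²`. -/
def weightedExpos (s : ℝ → ℝ) (N : Set ℤ) : Set (Lp ℂ 2 period) :=
  {φ | ∃ n ∈ N, φ =ᵐ[period] fun x => expo n x * s x}

lemma memLp_expo_mul {s : ℝ → ℂ} (hs : MemLp s 2 period) (n : ℤ) :
    MemLp (fun x => expo n x * s x) 2 period :=
  hs.of_le ((continuous_expo n).aestronglyMeasurable.mul hs.1)
    (Eventually.of_forall fun x => by simp [norm_expo])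

lemma MemLp.integrable_mul_two {f g : ℝ → ℂ} (hf : MemLp f 2 period) (hg : MemLp g 2 period) :
    Integrable (fun x => f x * g x) period :=
  hf.integrable_mul hg

/-- A bounded function with spectrum in `{n ≤ 0}` whose modulus is a constant multiple of
`(1 + g)^{-1/2}`. It is obtained by projecting in the space `L²` with weight `1 + g`. -/
lemma exists_outer {g : ℝ → ℝ} (hg : Integrable g period) (hg0 : ∀ x, 0 ≤ g x) :
    ∃ φ ∈ (Submodule.span ℂ (weightedExpos (fun x => √(1 + g x)) {n | n ≤ 0})).topologicalClosure,
    ∃ ψ : ℝ → ℂ, AEStronglyMeasurable ψ period ∧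
      (φ =ᵐ[period] fun x => ψ x * (√(1 + g x) : ℝ)) ∧
      ∃ c : ℝ, (∀ᵐ x ∂period, ‖ψ x‖ ^ 2 * (1 + g x) = c) ∧ c ≤ 1 + ∫ x, g x ∂period ∧
        ∫ x, ‖ψ x - 1‖ ^ 2 ∂period ≤ ∫ x, g x ∂period := by
  set s : ℝ → ℝ := fun x => √(1 + g x) with hs
  have hs1 : ∀ x, 1 ≤ s x := fun x => Real.one_le_sqrt.2 (by linarith [hg0 x])
  have hs0 : ∀ x, (s x : ℂ) ≠ 0 := fun x => by
    exact_mod_cast (zero_lt_one.trans_le (hs1 x)).ne'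
  have hs2 : ∀ x, s x ^ 2 = 1 + g x := fun x => Real.sq_sqrt (by linarith [hg0 x])
  have hsm : AEStronglyMeasurable s period :=
    Real.continuous_sqrt.comp_aestronglyMeasurable (hg.1.const_add 1)
  have hsL : MemLp (fun x => (s x : ℂ)) 2 period := by
    refine MemLp.ofReal ?_
    rw [memLp_two_iff_integrable_sq hsm]
    simp only [hs2]
    exact (integrable_const _).add hg
  have hsi : MemLp (fun x => ((s x)⁻¹ : ℂ)) 2 period := by
    refine MemLp.of_bound ?_ 1 (Eventually.of_forall fun x => ?_)
    · have := (hsm.aemeasurable.inv).aestronglyMeasurable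
      exact (Complex.continuous_ofReal.comp_aestronglyMeasurable this).congr
        (Eventually.of_forall fun x => by simp)
    · rw [norm_inv, Complex.norm_real, Real.norm_eq_abs]
      exact inv_le_one_of_one_le₀ ((hs1 x).trans (le_abs_self _))
  set A := weightedExpos s {n | n ≤ -1} with hA
  set A₀ := weightedExpos s {n | n ≤ 0} with hA₀
  let K : Submodule ℂ (Lp ℂ 2 period) := (Submodule.span ℂ A).topologicalClosure
  have : CompleteSpace K := (Submodule.isClosed_topologicalClosure _).completeSpace_coe
  let e : ℤ → Lp ℂ 2 period := fun n => (memLp_expo_mul hsL n).toLp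
  have he : ∀ n, e n =ᵐ[period] fun x => expo n x * s x := fun n => MemLp.coeFn_toLp _
  -- Szegő's prediction problem: z is the error in predicting s from the functions e^{inx} s with n
  -- ≤ -1.
  let z := e 0 - K.starProjection (e 0)
  have hzK : z ∈ Kᗮ := K.sub_starProjection_mem_orthogonal _
  have hPK : K.starProjection (e 0) ∈ K := Submodule.starProjection_apply_mem K _
  have hzA₀ : z ∈ (Submodule.span ℂ A₀).topologicalClosure := by
    refine Submodule.sub_mem _ (Submodule.le_topologicalClosure _
      (Submodule.subset_span ⟨0, show (0 : ℤ) ≤ 0 from le_rfl, he 0⟩)) ?_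
    refine Submodule.topologicalClosure_mono (Submodule.span_mono ?_) hPK
    rintro u ⟨n, hn, hu⟩
    have hn' : n ≤ -1 := hn
    exact ⟨n, show n ≤ 0 by omega, hu⟩
  have hzLp : MemLp z 2 period := Lp.memLp z
  have hzs : MemLp (fun x => star (z x)) 2 period := hzLp.star
  have horth : ∀ n : ℤ, n ≤ -1 → ∫ x, star (z x) * (expo n x * s x) ∂period = 0 := by
    intro n hn
    have h1 : inner ℂ (e n) z = 0 :=
      hzK _ (Submodule.le_topologicalClosure _ (Submodule.subset_span ⟨n, hn, he n⟩))
    rw [← inner_conj_symm, map_eq_zero, L2.inner_def] at h1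
    rw [← h1]
    refine integral_congr_ae ((he n).mono fun x hx => ?_)
    simp only [hx, RCLike.inner_apply]
    simp [mul_comm]
  -- z is a limit of combinations of e^{imx} s with m ≤ 0. After the shift by -n with n ≥ 1 only
  -- exponents ≤ -1 remain, and z is orthogonal to those.
  have hcoef : ∀ n : ℤ, 1 ≤ n → coeff (fun x => z x * star (z x)) n = 0 := by
    intro n hn
    rw [coeff_eq_zero_iff]
    have := integral_mul_eq_zero_of_mem_closure hzA₀ (memLp_expo_mul hzs (-n)) ?_
    · rw [← this]
      refine integral_congr_ae (Eventually.of_forall fun x => ?_)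
      simp only; ring
    · rintro u ⟨m, hm, hu⟩
      have hm' : m ≤ 0 := hm
      rw [← horth (m - n) (by omega)]
      refine integral_congr_ae (hu.mono fun x hx => ?_)
      simp only [hx, sub_eq_add_neg, expo_add]
      ring
  have hzint : Integrable (fun x => z x * star (z x)) period := MemLp.integrable_mul_two hzLp hzs
  set c : ℝ := 1 / (2 * Real.pi) * ∫ x, ‖z x‖ ^ 2 ∂period with hc
  have hzz : ∀ x, z x * star (z x) = ((‖z x‖ ^ 2 : ℝ) : ℂ) := fun x => by
    rw [Complex.star_def, Complex.mul_conj, Complex.normSq_eq_norm_sq]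
  have hc0 : coeff (fun x => z x * star (z x)) 0 = c := by
    simp only [coeff, neg_zero, expo_zero, mul_one, hzz, integral_complex_ofReal, hc]
    push_cast; ring
  -- |z|² is real, so its negative coefficients vanish together with the positive ones, and only the
  -- mean survives.
  have hconst : (fun x => z x * star (z x)) =ᵐ[period] fun _ => (c : ℂ) := by
    refine ae_eq_of_coeff_eq hzint (integrable_const _) fun n => ?_
    have hcn : coeff (fun _ => (c : ℂ)) n = c * coeff (expo 0) n := by
      rw [← coeff_const_mul]; simp only [expo_zero, mul_one]
    rcases lt_trichotomy n 0 with hn | rfl | hn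
    · rw [hcn, coeff_expo_of_ne hn.ne', mul_zero]
      have h2 := hcoef (-n) (by omega)
      have h3 : (fun x => z x * star (z x)) = fun x => star (z x * star (z x)) := by
        ext x; rw [star_mul', star_star, mul_comm]
      rw [h3, coeff_star, h2, star_zero]
    · rw [hcn, coeff_expo_self, hc0, mul_one]
    · rw [hcn, coeff_expo_of_ne hn.ne, mul_zero, hcoef n hn]
  have hnormsq : ∀ u : Lp ℂ 2 period, ‖u‖ ^ 2 = ∫ x, ‖u x‖ ^ 2 ∂period := fun u => by
    rw [← inner_self_eq_norm_sq (𝕜 := ℂ), L2.inner_def, ← integral_re (L2.integrable_inner u u)]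
    simp only [inner_self_eq_norm_sq]
  have hzle : ∫ x, ‖z x‖ ^ 2 ∂period ≤ 2 * Real.pi + ∫ x, g x ∂period := by
    rw [← hnormsq]
    have h1 : ‖z‖ ≤ ‖e 0‖ := by
      have h2 := Submodule.norm_sq_eq_add_norm_sq_starProjection (e 0) K
      have h3 : Kᗮ.starProjection (e 0) = z := by
        rw [Submodule.starProjection_orthogonal']; rfl
      rw [h3] at h2
      nlinarith [norm_nonneg z, norm_nonneg (e 0), sq_nonneg ‖K.starProjection (e 0)‖]
    calc ‖z‖ ^ 2 ≤ ‖e 0‖ ^ 2 := by gcongr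
      _ = ∫ x, (1 + g x) ∂period := by
          rw [hnormsq]
          refine integral_congr_ae ((he 0).mono fun x hx => ?_)
          simp only [hx, expo_zero, one_mul, Complex.norm_real, Real.norm_eq_abs, sq_abs, hs2]
      _ = _ := by
          rw [integral_add (integrable_const _) hg, integral_const, period_real_univ]
          simp
  set ψ : ℝ → ℂ := fun x => z x * (s x : ℂ)⁻¹ with hψ
  have hψm : AEStronglyMeasurable ψ period := hzLp.1.mul hsi.1
  have hψz : ∀ x, ‖ψ x‖ ≤ ‖z x‖ := fun x => by
    rw [hψ]
    simp only [norm_mul, norm_inv, Complex.norm_real, Real.norm_eq_abs]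
    exact mul_le_of_le_one_right (norm_nonneg _)
      (inv_le_one_of_one_le₀ ((hs1 x).trans (le_abs_self _)))
  have hψL : MemLp ψ 2 period := hzLp.of_le hψm (Eventually.of_forall hψz)
  -- Division by s turns the subtracted part into a limit of e^{inx} with n ≤ -1, so ψ has the same
  -- mean as the constant 1.
  have hψint : ∫ x, ψ x ∂period = 2 * Real.pi := by
    have h1 : ∫ x, K.starProjection (e 0) x * (s x : ℂ)⁻¹ ∂period = 0 := by
      refine integral_mul_eq_zero_of_mem_closure hPK hsi ?_
      rintro u ⟨n, hn, hu⟩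
      have hn' : n ≤ -1 := hn
      rw [← integral_expo (n := n) (by omega)]
      refine integral_congr_ae (hu.mono fun x hx => ?_)
      simp only [hx]
      rw [mul_assoc, mul_inv_cancel₀ (hs0 x), mul_one]
    have h2 : ψ =ᵐ[period] fun x => 1 - K.starProjection (e 0) x * (s x : ℂ)⁻¹ := by
      filter_upwards [he 0, Lp.coeFn_sub (e 0) (K.starProjection (e 0))] with x h1 h2
      simp only [hψ, z, h2, Pi.sub_apply, h1, expo_zero, sub_mul, one_mul,
        mul_inv_cancel₀ (hs0 x)]
    rw [integral_congr_ae h2, integral_sub (integrable_const _)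
      (MemLp.integrable_mul_two (Lp.memLp _) hsi), h1]
    simp [period_real_univ]
  refine ⟨z, hzA₀, ψ, hψm, Eventually.of_forall fun x => ?_, c, ?_, ?_, ?_⟩
  · simp only [hψ]
    rw [mul_assoc, inv_mul_cancel₀ (hs0 x), mul_one]
  · filter_upwards [hconst] with x hx
    rw [hzz] at hx
    have hx' : ‖z x‖ ^ 2 = c := by exact_mod_cast hx
    rw [← hs2, ← hx', hψ]
    simp only [norm_mul, norm_inv, Complex.norm_real, Real.norm_eq_abs]
    rw [mul_pow, inv_pow, sq_abs, mul_assoc, inv_mul_cancel₀, mul_one]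
    have := hs1 x
    positivity
  · have hgi : 0 ≤ ∫ x, g x ∂period := integral_nonneg hg0
    have hpi : 1 ≤ 2 * Real.pi := by linarith [Real.pi_gt_three]
    rw [hc, one_div, inv_mul_le_iff₀ (by positivity)]
    nlinarith
  -- Since ψ has mean 1, ∫|ψ - 1|² = ∫|ψ|² - 2π ≤ ∫|z|² - 2π ≤ ∫g. The outer function is therefore
  -- close to 1 when g is small.
  · have h1 : ∀ x, ‖ψ x - 1‖ ^ 2 = ‖ψ x‖ ^ 2 - 2 * (ψ x).re + 1 := fun x => by
      rw [← Complex.normSq_eq_norm_sq, ← Complex.normSq_eq_norm_sq, Complex.normSq_apply,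
        Complex.normSq_apply]
      simp
      ring
    have i1 : Integrable (fun x => ‖ψ x‖ ^ 2) period := hψL.integrable_norm_pow two_ne_zero
    have i2 : Integrable ψ period := hψL.integrable one_le_two
    have i3 : Integrable (fun x => ‖z x‖ ^ 2) period := hzLp.integrable_norm_pow two_ne_zero
    have i4 : Integrable (fun x => 2 * (ψ x).re) period := i2.re.const_mul 2
    have h4 : ∫ x, (ψ x).re ∂period = 2 * Real.pi := by
      have := integral_re i2
      simp only [RCLike.re_eq_complex_re] at this
      rw [this, hψint]
      simp
    have h5 : ∫ x, ‖ψ x‖ ^ 2 ∂period ≤ ∫ x, ‖z x‖ ^ 2 ∂period :=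
      integral_mono i1 i3 fun x => by
        have := hψz x
        simp only
        gcongr
    simp only [h1]
    have i5 : Integrable (fun x => ‖ψ x‖ ^ 2 - 2 * (ψ x).re) period := i1.sub i4
    rw [integral_add i5 (integrable_const _), integral_sub i1 i4,
      integral_const_mul, h4, integral_const, period_real_univ]
    simp only [smul_eq_mul, mul_one]
    linarith

/-- The factor ψ² has spectrum in {n ≤ 0}, so it can only move the spectrum of f to the left. To
justify this, write ψ²f = φ²b with b = f/(1+g) bounded and approximate the two factors φ in turn by
combinations of e^{ikx} s, k ≤ 0; the weights recombine to s²b = f. -/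
lemma coeff_outer_sq_mul {g : ℝ → ℝ} (hg : Integrable g period) (hg0 : ∀ x, 0 ≤ g x)
    {φ : Lp ℂ 2 period} (hφ : φ ∈ (Submodule.span ℂ
      (weightedExpos (fun x => √(1 + g x)) {n | n ≤ 0})).topologicalClosure)
    {ψ : ℝ → ℂ} (hψ : φ =ᵐ[period] fun x => ψ x * (√(1 + g x) : ℝ)) {f : ℝ → ℂ}
    (hf : AEStronglyMeasurable f period) {C : ℝ} (hfC : ∀ x, ‖f x‖ ≤ C * (1 + g x))
    {m : ℤ} (h0 : ∀ n, m ≤ n → coeff f n = 0) (n : ℤ) (hn : m ≤ n) :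
    coeff (fun x => ψ x ^ 2 * f x) n = 0 := by
  have hw : ∀ x, 0 < 1 + g x := fun x => by linarith [hg0 x]
  have hwc : ∀ x, ((1 + g x : ℝ) : ℂ) ≠ 0 := fun x => by exact_mod_cast (hw x).ne'
  have hss : ∀ x, ((√(1 + g x) : ℝ) : ℂ) * (√(1 + g x) : ℝ) = ((1 + g x : ℝ) : ℂ) := fun x => by
    rw [← Complex.ofReal_mul, Real.mul_self_sqrt (hw x).le]
  set b : ℝ → ℂ := fun x => f x * ((1 + g x : ℝ) : ℂ)⁻¹ with hb
  have hbm : AEStronglyMeasurable b period := by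
    refine hf.mul ?_
    have h1 : AEStronglyMeasurable (fun x => (1 + g x)⁻¹) period :=
      ((hg.1.const_add 1).aemeasurable.inv).aestronglyMeasurable
    exact (Complex.continuous_ofReal.comp_aestronglyMeasurable h1).congr
      (Eventually.of_forall fun x => by simp)
  have hbC : ∀ x, ‖b x‖ ≤ C := fun x => by
    rw [hb]
    simp only [norm_mul, norm_inv, Complex.norm_real, Real.norm_eq_abs, abs_of_pos (hw x)]
    rw [mul_inv_le_iff₀ (hw x)]
    exact hfC x
  have hmul : ∀ {u : ℝ → ℂ}, MemLp u 2 period → ∀ k : ℤ,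
      MemLp (fun x => u x * (b x * expo k x)) 2 period := fun {u} hu k => by
    refine (hu.of_le_mul (c := C) (hu.1.mul (hbm.mul (continuous_expo k).aestronglyMeasurable))
      (Eventually.of_forall fun x => ?_))
    simp only [norm_mul, norm_expo, mul_one]
    rw [mul_comm]
    gcongr
    exact hbC x
  have hsL : MemLp (fun x => ((√(1 + g x) : ℝ) : ℂ)) 2 period := by
    refine MemLp.ofReal ?_
    rw [memLp_two_iff_integrable_sq
      (Real.continuous_sqrt.comp_aestronglyMeasurable (hg.1.const_add 1))]
    simp only [fun x => Real.sq_sqrt (hw x).le]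
    exact (integrable_const _).add hg
  rw [coeff_eq_zero_iff]
  have key : ∫ x, φ x * (φ x * (b x * expo (-n) x)) ∂period = 0 := by
    refine integral_mul_eq_zero_of_mem_closure hφ (hmul (Lp.memLp φ) _) ?_
    rintro u ⟨k, hk, hu⟩
    have hk' : k ≤ 0 := hk
    have h2 : ∫ x, φ x * ((expo k x * (√(1 + g x) : ℝ)) * (b x * expo (-n) x)) ∂period = 0 := by
      refine integral_mul_eq_zero_of_mem_closure hφ (hmul (memLp_expo_mul hsL k) _) ?_
      rintro v ⟨l, hl, hv⟩
      have hl' : l ≤ 0 := hl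
      have h3 := coeff_eq_zero_iff.1 (h0 (n - k - l) (by omega))
      rw [← h3]
      refine integral_congr_ae (hv.mono fun x hx => ?_)
      have e1 : -(n - k - l) = k + l + -n := by ring
      simp only [hx, hb, e1, expo_add]
      calc expo l x * (√(1 + g x) : ℝ) * (expo k x * (√(1 + g x) : ℝ) *
            (f x * ((1 + g x : ℝ) : ℂ)⁻¹ * expo (-n) x))
          = f x * (expo k x * expo l x * expo (-n) x) *
            ((((√(1 + g x) : ℝ) : ℂ) * (√(1 + g x) : ℝ)) * ((1 + g x : ℝ) : ℂ)⁻¹) := by ring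
        _ = _ := by rw [hss, mul_inv_cancel₀ (hwc x), mul_one]
    rw [← h2]
    refine integral_congr_ae (hu.mono fun x hx => ?_)
    simp only [hx]
    ring
  rw [← key]
  refine integral_congr_ae (hψ.mono fun x hx => ?_)
  simp only [hx, hb]
  calc ψ x ^ 2 * f x * expo (-n) x
      = ψ x ^ 2 * f x * expo (-n) x * (((1 + g x : ℝ) : ℂ) * ((1 + g x : ℝ) : ℂ)⁻¹) := by
        rw [mul_inv_cancel₀ (hwc x), mul_one]
    _ = _ := by rw [← hss]; ring

/-- If `f` and `r` are integrable, `f` has spectrum in `{n < 0}`, `r` has spectrum in `{n ≤ 0}` and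
the product `∑ f_i r_i` is integrable, then its integral vanishes. -/
lemma integral_sum_mul_eq_zero {ι : Type*} [Fintype ι] {f r : ι → ℝ → ℂ}
    (hf : ∀ i, Integrable (f i) period) (hr : ∀ i, Integrable (r i) period)
    (hf0 : ∀ i n, 0 ≤ n → coeff (f i) n = 0) (hr0 : ∀ i n, 1 ≤ n → coeff (r i) n = 0)
    (hfr : Integrable (fun x => ∑ i, f i x * r i x) period) :
    ∫ x, ∑ i, f i x * r i x ∂period = 0 := by
  set G : ℝ → ℝ := fun x => ∑ i, (‖f i x‖ + ‖r i x‖) with hG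
  have hGi : Integrable G period := integrable_finsetSum _ fun i _ => (hf i).norm.add (hr i).norm
  have hG0 : ∀ x, 0 ≤ G x := fun x => Finset.sum_nonneg fun i _ => by positivity
  have hfG : ∀ i x, ‖f i x‖ ≤ G x := fun i x =>
    (le_add_of_nonneg_right (norm_nonneg _)).trans
      (Finset.single_le_sum (f := fun i => ‖f i x‖ + ‖r i x‖)
        (fun j _ => by positivity) (Finset.mem_univ i))
  have hrG : ∀ i x, ‖r i x‖ ≤ G x := fun i x =>
    (le_add_of_nonneg_left (norm_nonneg _)).trans
      (Finset.single_le_sum (f := fun i => ‖f i x‖ + ‖r i x‖)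
        (fun j _ => by positivity) (Finset.mem_univ i))
  set I := ∫ x, G x ∂period with hI
  have hI0 : 0 ≤ I := integral_nonneg hG0
  -- The weight g = G/(k+1) serves two ends: ∫g → 0 forces ψ → 1, and |ψ|²(1+g) = c makes ψ²f_i and
  -- ψ²r_i bounded by (k+1)c, so that they lie in L².
  have step : ∀ k : ℕ, ∃ ψ : ℝ → ℂ, AEStronglyMeasurable ψ period ∧
      (∀ᵐ x ∂period, ‖ψ x‖ ^ 2 ≤ 1 + I) ∧ ∫ x, ‖ψ x - 1‖ ^ 2 ∂period ≤ (k + 1 : ℝ)⁻¹ * I ∧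
      ∫ x, ψ x ^ 4 * ∑ i, f i x * r i x ∂period = 0 := by
    intro k
    have hk : (0 : ℝ) < k + 1 := by positivity
    set g : ℝ → ℝ := fun x => (k + 1 : ℝ)⁻¹ * G x with hg
    have hgi : Integrable g period := hGi.const_mul _
    have hg0 : ∀ x, 0 ≤ g x := fun x => mul_nonneg (by positivity) (hG0 x)
    have hgI : ∫ x, g x ∂period = (k + 1 : ℝ)⁻¹ * I := integral_const_mul _ _
    have hGg : ∀ x, G x ≤ (k + 1) * (1 + g x) := fun x => by
      rw [hg]
      simp only [mul_add, mul_inv_cancel_left₀ hk.ne']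
      linarith
    obtain ⟨φ, hφ, ψ, hψm, hψφ, c, hc, hcI, hψ1⟩ := exists_outer hgi hg0
    have hcle : c ≤ 1 + I := by
      refine hcI.trans ?_
      rw [hgI]
      have : (k + 1 : ℝ)⁻¹ ≤ 1 := inv_le_one_of_one_le₀ (by linarith [(k.cast_nonneg : (0:ℝ) ≤ k)])
      nlinarith
    have hψc : ∀ᵐ x ∂period, ‖ψ x‖ ^ 2 ≤ c := hc.mono fun x hx => by
      rw [← hx]
      exact le_mul_of_one_le_right (by positivity) (by linarith [hg0 x])
    have hbd : ∀ {u : ℝ → ℂ}, AEStronglyMeasurable u period → (∀ x, ‖u x‖ ≤ G x) →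
        MemLp (fun x => ψ x ^ 2 * u x) 2 period := fun {u} hu huG =>
      MemLp.of_bound ((hψm.pow 2).mul hu) ((k + 1) * c) (hc.mono fun x hx => by
        rw [norm_mul, norm_pow, ← hx]
        calc ‖ψ x‖ ^ 2 * ‖u x‖ ≤ ‖ψ x‖ ^ 2 * ((k + 1) * (1 + g x)) := by
              gcongr; exact (huG x).trans (hGg x)
          _ = _ := by ring)
    refine ⟨ψ, hψm, hψc.mono fun x hx => hx.trans hcle, hgI ▸ hψ1, ?_⟩
    -- The fourth power of ψ splits as two squares, one for each factor. The products keep the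
    -- one-sided spectra, and the L² orthogonality applies.
    have hterm : ∀ i, ∫ x, (ψ x ^ 2 * f i x) * (ψ x ^ 2 * r i x) ∂period = 0 := fun i => by
      refine integral_mul_eq_zero_of_coeff (hbd (hf i).1 (hfG i)) (hbd (hr i).1 (hrG i))
        (N := {n | n < 0}) (fun n hn => ?_) fun n hn => ?_
      · exact coeff_outer_sq_mul hgi hg0 hφ hψφ (hf i).1
          (fun x => (hfG i x).trans (hGg x)) (hf0 i) n (not_lt.1 hn)
      · have hn' : n < 0 := hn
        exact coeff_outer_sq_mul hgi hg0 hφ hψφ (hr i).1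
          (fun x => (hrG i x).trans (hGg x)) (hr0 i) (-n) (by omega)
    calc ∫ x, ψ x ^ 4 * ∑ i, f i x * r i x ∂period
        = ∫ x, ∑ i, (ψ x ^ 2 * f i x) * (ψ x ^ 2 * r i x) ∂period := by
          congr 1; ext x
          rw [Finset.mul_sum]
          exact Finset.sum_congr rfl fun i _ => by ring
      _ = 0 := by
          rw [integral_finsetSum _ fun i _ => MemLp.integrable_mul_two (hbd (hf i).1 (hfG i))
            (hbd (hr i).1 (hrG i))]
          exact Finset.sum_eq_zero fun i _ => hterm i
  choose ψ hψm hψb hψ1 hψ0 using step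
  have hlim : TendstoInMeasure period ψ atTop (fun _ => (1 : ℂ)) := by
    refine tendstoInMeasure_of_tendsto_eLpNorm (p := 2) two_ne_zero hψm
      aestronglyMeasurable_const ?_
    have hL : ∀ k, MemLp (ψ k - fun _ => (1 : ℂ)) 2 period := fun k => by
      refine MemLp.sub ?_ (memLp_const _)
      refine MemLp.of_bound (hψm k) (1 + I) ((hψb k).mono fun x hx => ?_)
      nlinarith [norm_nonneg (ψ k x), sq_nonneg (‖ψ k x‖ - 1)]
    have h1 : ∀ k, eLpNorm (ψ k - fun _ => (1 : ℂ)) 2 period ≤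
        ENNReal.ofReal (√((k + 1 : ℝ)⁻¹ * I)) := fun k => by
      rw [(hL k).eLpNorm_eq_integral_rpow_norm two_ne_zero (by simp)]
      refine ENNReal.ofReal_le_ofReal ?_
      rw [Real.sqrt_eq_rpow]
      simp only [ENNReal.toReal_ofNat, Real.rpow_ofNat, one_div]
      exact Real.rpow_le_rpow (integral_nonneg fun x => by positivity) (hψ1 k) (by norm_num)
    refine tendsto_of_tendsto_of_tendsto_of_le_of_le tendsto_const_nhds ?_
      (fun _ => zero_le) h1
    rw [← ENNReal.ofReal_zero]
    refine ENNReal.tendsto_ofReal ?_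
    have h2 : Tendsto (fun k : ℕ => (k + 1 : ℝ)⁻¹ * I) atTop (𝓝 0) := by
      simpa [one_div] using (tendsto_one_div_add_atTop_nhds_zero_nat (𝕜 := ℝ)).mul_const I
    simpa [Function.comp_def] using (Real.continuous_sqrt.tendsto 0).comp h2
  obtain ⟨ns, -, hns⟩ := hlim.exists_seq_tendsto_ae
  -- The bound |ψ|² ≤ 1 + I is uniform in k, so (1+I)² times the integrable product dominates.
  have hdct : Tendsto (fun k => ∫ x, ψ (ns k) x ^ 4 * ∑ i, f i x * r i x ∂period) atTop
      (𝓝 (∫ x, 1 ^ 4 * ∑ i, f i x * r i x ∂period)) := by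
    refine tendsto_integral_of_dominated_convergence
      (fun x => (1 + I) ^ 2 * ‖∑ i, f i x * r i x‖)
      (fun k => ((hψm _).pow 4).mul hfr.1) (hfr.norm.const_mul _) (fun k => ?_) ?_
    · filter_upwards [hψb (ns k)] with x hx
      rw [norm_mul, norm_pow]
      gcongr
      calc ‖ψ (ns k) x‖ ^ 4 = (‖ψ (ns k) x‖ ^ 2) ^ 2 := by ring
        _ ≤ _ := by gcongr
    · filter_upwards [hns] with x hx
      exact (hx.pow 4).mul_const _
  simp only [hψ0, one_pow, one_mul] at hdct
  exact tendsto_nhds_unique hdct tendsto_const_nhds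

/-! ### Orthogonality of integrable functions with complementary spectra -/

lemma integrable_star {f : ℝ → ℂ} (hf : Integrable f period) :
    Integrable (fun x => star (f x)) period :=
  hf.mono (continuous_star.comp_aestronglyMeasurable hf.1)
    (Eventually.of_forall fun _ => (norm_star _).le)

/-- The part of the Fourier series of `f` with frequencies in `s`. -/
def partialSeries (s : Finset ℤ) (f : ℝ → ℂ) (x : ℝ) : ℂ := ∑ n ∈ s, coeff f n * expo n x

lemma integrable_expo (n : ℤ) : Integrable (expo n) period := by
  simpa using Integrable.mul_expo (integrable_const (1 : ℂ)) n

lemma integrable_partialSeries (s : Finset ℤ) (f : ℝ → ℂ) :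
    Integrable (partialSeries s f) period :=
  integrable_finsetSum _ fun n _ => (integrable_expo n).const_mul _

lemma coeff_partialSeries (s : Finset ℤ) (f : ℝ → ℂ) (k : ℤ) :
    coeff (partialSeries s f) k = if k ∈ s then coeff f k else 0 := by
  unfold partialSeries
  rw [coeff_sum s fun n _ => (integrable_expo n).const_mul _]
  simp only [coeff_const_mul]
  split_ifs with h
  · rw [Finset.sum_eq_single k, coeff_expo_self, mul_one]
    · intro n _ hn
      rw [coeff_expo_of_ne hn, mul_zero]
    · exact fun h' => absurd h h'
  · refine Finset.sum_eq_zero fun n hn => ?_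
    rw [coeff_expo_of_ne (show n ≠ k from fun h' => h (h' ▸ hn)), mul_zero]

lemma integral_mul_partialSeries (s : Finset ℤ) {f g : ℝ → ℂ} (hf : Integrable f period) :
    ∫ x, f x * star (partialSeries s g x) ∂period =
      ∑ n ∈ s, 2 * Real.pi * (coeff f n * star (coeff g n)) := by
  have h1 : ∀ x, f x * star (partialSeries s g x) =
      ∑ n ∈ s, star (coeff g n) * (f x * expo (-n) x) := fun x => by
    simp only [partialSeries, star_sum, star_mul', star_expo, Finset.mul_sum]
    exact Finset.sum_congr rfl fun n _ => by ring
  simp only [h1]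
  rw [integral_finsetSum _ fun n _ => (Integrable.mul_expo hf _).const_mul _]
  refine Finset.sum_congr rfl fun n _ => ?_
  rw [integral_const_mul, integral_mul_expo]
  ring

lemma Integrable.mul_star_partialSeries (s : Finset ℤ) {f : ℝ → ℂ} (g : ℝ → ℂ)
    (hf : Integrable f period) : Integrable (fun x => f x * star (partialSeries s g x)) period := by
  simp only [partialSeries, star_sum, star_mul', star_expo, Finset.mul_sum]
  refine integrable_finsetSum _ fun n _ => ?_
  refine ((Integrable.mul_expo hf (-n)).const_mul (star (coeff g n))).congr
    (Eventually.of_forall fun x => ?_)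
  simp only
  ring

/-- Integrable functions whose spectra are complementary, one of them bounded above and the other
bounded below, are orthogonal as soon as their product is integrable. -/
lemma integral_dotProduct_star_eq_zero {T : ℕ} {S : Set ℤ} (hSf : S.Finite)
    {f q : ℝ → Fin T → ℂ} (hf : ∀ i, Integrable (fun x => f x i) period)
    (hq : ∀ i, Integrable (fun x => q x i) period)
    (hf0 : ∀ i, ∀ n ∈ unobserved S, coeff (fun x => f x i) n = 0)
    (hq0 : ∀ i, ∀ n ∈ observed S, coeff (fun x => q x i) n = 0)
    (hfq : Integrable (fun x => f x ⬝ᵥ star (q x)) period) :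
    ∫ x, f x ⬝ᵥ star (q x) ∂period = 0 := by
  obtain ⟨m, hm⟩ := hSf.bddBelow
  -- The window [m, -1] contains every negative frequency of S. Once it is removed, f' has spectrum
  -- below m, hence in {n < 0}, and q' has spectrum in {n ≥ 0}.
  set s : Finset ℤ := Finset.Icc m (-1) with hs
  have hdich : ∀ n, n ∈ unobserved S ∨ n ∈ observed S := fun n => by
    by_cases h1 : n ∈ S
    · exact Or.inl (Or.inl h1)
    · rcases lt_or_ge n 0 with h | h
      · exact Or.inr ⟨show n ≤ -1 by omega, h1⟩
      · exact Or.inl (Or.inr h)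
  let pf : Fin T → ℝ → ℂ := fun i => partialSeries s (fun x => f x i)
  let pq : Fin T → ℝ → ℂ := fun i => partialSeries s (fun x => q x i)
  let f' : Fin T → ℝ → ℂ := fun i x => f x i - pf i x
  let q' : Fin T → ℝ → ℂ := fun i x => q x i - pq i x
  have hpf : ∀ i, Integrable (pf i) period := fun i => integrable_partialSeries _ _
  have hpq : ∀ i, Integrable (pq i) period := fun i => integrable_partialSeries _ _
  have hf' : ∀ i, Integrable (f' i) period := fun i => (hf i).sub (hpf i)
  have hq' : ∀ i, Integrable (q' i) period := fun i => (hq i).sub (hpq i)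
  have hf'0 : ∀ i n, (n ∈ s ∨ 0 ≤ n) → coeff (f' i) n = 0 := fun i n hn => by
    have h1 := coeff_sub (hf i) (hpf i) n
    rw [coeff_partialSeries] at h1
    refine h1.trans ?_
    split_ifs with h
    · exact sub_self _
    · rw [hf0 i n (Or.inr (hn.resolve_left h)), sub_zero]
  have hq'0 : ∀ i n, n < 0 → coeff (q' i) n = 0 := fun i n hn => by
    have h1 := coeff_sub (hq i) (hpq i) n
    rw [coeff_partialSeries] at h1
    refine h1.trans ?_
    split_ifs with h
    · exact sub_self _
    · have hnm : n < m := by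
        by_contra h'
        exact h (Finset.mem_Icc.2 ⟨not_lt.1 h', by omega⟩)
      rw [hq0 i n ⟨show n ≤ -1 by omega, fun h' => absurd (hm h') (not_le.2 hnm)⟩, sub_zero]
  have i1 : ∀ i, Integrable (fun x => pf i x * star (q x i)) period := fun i => by
    refine (integrable_star (Integrable.mul_star_partialSeries s (fun x => f x i) (hq i))).congr
      (Eventually.of_forall fun x => ?_)
    simp only [star_mul', star_star, pf]
    ring
  have i2 : ∀ i, Integrable (fun x => f' i x * star (pq i x)) period := fun i =>
    Integrable.mul_star_partialSeries s _ (hf' i)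
  have v1 : ∀ i, ∫ x, pf i x * star (q x i) ∂period = 0 := fun i => by
    have h1 : ∀ x, pf i x * star (q x i) = star (q x i * star (pf i x)) := fun x => by
      rw [star_mul', star_star, mul_comm]
    have h2 : ∫ x, star (q x i * star (pf i x)) ∂period =
      star (∫ x, q x i * star (pf i x) ∂period) := integral_conj
    simp only [h1]
    rw [h2, integral_mul_partialSeries s (hq i), star_eq_zero]
    refine Finset.sum_eq_zero fun n _ => ?_
    rcases hdich n with h | h
    · rw [hf0 i n h]; simp
    · rw [hq0 i n h]; simp
  have v2 : ∀ i, ∫ x, f' i x * star (pq i x) ∂period = 0 := fun i => by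
    rw [integral_mul_partialSeries s (hf' i)]
    refine Finset.sum_eq_zero fun n hn => ?_
    rw [hf'0 i n (Or.inl hn)]; simp
  -- The first two sums involve a trigonometric polynomial, so finite Parseval sums evaluate them.
  -- The third is integrable as a difference, and the one-sided result handles it.
  have hsplit : ∀ x, f x ⬝ᵥ star (q x) = ∑ i, pf i x * star (q x i) +
      ∑ i, f' i x * star (pq i x) + ∑ i, f' i x * star (q' i x) := fun x => by
    simp only [dotProduct, Pi.star_apply, ← Finset.sum_add_distrib]
    refine Finset.sum_congr rfl fun i _ => ?_
    simp only [f', q', star_sub]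
    ring
  have j1 : Integrable (fun x => ∑ i, pf i x * star (q x i)) period :=
    integrable_finsetSum _ fun i _ => i1 i
  have j2 : Integrable (fun x => ∑ i, f' i x * star (pq i x)) period :=
    integrable_finsetSum _ fun i _ => i2 i
  have j3 : Integrable (fun x => ∑ i, f' i x * star (q' i x)) period := by
    refine ((hfq.sub j1).sub j2).congr (Eventually.of_forall fun x => ?_)
    simp only [Pi.sub_apply, hsplit x]
    ring
  simp only [hsplit]
  have j12 : Integrable (fun x => ∑ i, pf i x * star (q x i) +
      ∑ i, f' i x * star (pq i x)) period := j1.add j2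
  rw [integral_add j12 j3, integral_add j1 j2,
    integral_finsetSum _ fun i _ => i1 i, integral_finsetSum _ fun i _ => i2 i]
  simp only [v1, v2, Finset.sum_const_zero, zero_add]
  refine integral_sum_mul_eq_zero hf' (fun i => integrable_star (hq' i)) (fun i n hn => hf'0 i n (Or.inr hn))
    (fun i n hn => ?_) j3
  exact (coeff_star (q' i) n).trans (by rw [hq'0 i (-n) (by omega), star_zero])

/-! ### Square roots of spectral densities -/

open scoped MatrixOrder Matrix.Norms.L2Operator in
-- The square root is continuous on the closed cone of nonnegative matrices; extension by 0 outside
-- the cone makes it a Borel function on all matrices. Measurability is stated over `Fin T → Fin T →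
-- ℂ` so that the product σ-algebra applies.
lemma measurable_sqrt_piecewise (T : ℕ) :
    ∃ f : Matrix (Fin T) (Fin T) ℂ → Matrix (Fin T) (Fin T) ℂ,
      (∀ i j, Measurable fun A : Fin T → Fin T → ℂ => f (Matrix.of A) i j) ∧
      ∀ A, A.PosSemidef → (f A).IsHermitian ∧ f A * f A = A := by
  classical
  let X := Matrix (Fin T) (Fin T) ℂ
  let _ : MeasurableSpace X := borel X
  have : BorelSpace X := ⟨rfl⟩
  let s : Set X := {a | 0 ≤ a}
  have hs : IsClosed s := CStarAlgebra.isClosed_nonneg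
  have hm : Measurable (s.piecewise (CFC.sqrt : X → X) (fun _ => 0)) :=
    CFC.continuousOn_sqrt.measurable_piecewise continuousOn_const hs.measurableSet
  refine ⟨s.piecewise CFC.sqrt (fun _ => 0), fun i j => ?_, fun A hA => ?_⟩
  · have h1 : Continuous fun A : X => A i j := by fun_prop
    have h2 : Continuous fun A : Fin T → Fin T → ℂ => (Matrix.of A : X) := by fun_prop
    exact h1.measurable.comp (hm.comp h2.measurable)
  · have h0 : (0 : X) ≤ A := hA.nonneg
    rw [Set.piecewise_eq_of_mem s _ _ h0]
    refine ⟨?_, CFC.sqrt_mul_sqrt_self A h0⟩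
    exact (Matrix.nonneg_iff_posSemidef.1 (CFC.sqrt_nonneg A)).isHermitian


/-- `σ` is a Hermitian square root of the density `P` and `τ` is its inverse, both with square
integrable entries. -/
structure IsRoot {T : ℕ} (P σ τ : ℝ → Matrix (Fin T) (Fin T) ℂ) : Prop where
  memLp_root : ∀ i j, MemLp (fun x => σ x i j) 2 period
  memLp_inv : ∀ i j, MemLp (fun x => τ x i j) 2 period
  ae_isHermitian_root : ∀ᵐ x ∂period, (σ x).IsHermitian
  ae_isHermitian_inv : ∀ᵐ x ∂period, (τ x).IsHermitian
  ae_root_mul_root : ∀ᵐ x ∂period, σ x * σ x = P x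
  ae_root_mul_inv : ∀ᵐ x ∂period, σ x * τ x = 1
  ae_inv_mul_root : ∀ᵐ x ∂period, τ x * σ x = 1
  ae_inv_mul_inv : ∀ᵐ x ∂period, τ x * τ x = (P x)⁻¹

/-- For Hermitian M with M² = W, the diagonal entry W_ii is the squared norm of the i-th row of M,
so it dominates each |M_ij|². -/
lemma memLp_entry_of_mul_self {T : ℕ} {W M : ℝ → Matrix (Fin T) (Fin T) ℂ}
    (hW : ∀ i, Integrable (fun x => W x i i) period)
    (hM : ∀ i j, AEStronglyMeasurable (fun x => M x i j) period)
    (h : ∀ᵐ x ∂period, (M x).IsHermitian ∧ M x * M x = W x) (i j : Fin T) :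
    MemLp (fun x => M x i j) 2 period := by
  rw [memLp_two_iff_integrable_sq_norm (hM i j)]
  refine (hW i).mono ((hM i j).norm.pow 2) (h.mono fun x ⟨hx, hx'⟩ => ?_)
  have h1 : W x i i = ((∑ k, ‖M x i k‖ ^ 2 : ℝ) : ℂ) := by
    rw [← hx', Matrix.mul_apply]
    push_cast
    refine Finset.sum_congr rfl fun k _ => ?_
    rw [← hx.apply k i, Complex.star_def, Complex.mul_conj, Complex.normSq_eq_norm_sq]
    push_cast
    rfl
  rw [h1, Complex.norm_real, Real.norm_of_nonneg (by positivity),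
    Real.norm_of_nonneg (Finset.sum_nonneg fun k _ => by positivity)]
  exact Finset.single_le_sum (f := fun k => ‖M x i k‖ ^ 2) (fun k _ => by positivity)
    (Finset.mem_univ j)

lemma aestronglyMeasurable_mul {T : ℕ} {V W : ℝ → Matrix (Fin T) (Fin T) ℂ}
    (hV : ∀ i j, AEStronglyMeasurable (fun x => V x i j) period)
    (hW : ∀ i j, AEStronglyMeasurable (fun x => W x i j) period) (i j : Fin T) :
    AEStronglyMeasurable (fun x => (V x * W x) i j) period := by
  simp only [Matrix.mul_apply]
  exact Finset.aestronglyMeasurable_fun_sum _ fun k _ => (hV i k).mul (hW k j)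

/-- Integrability of P makes the entries of σ square integrable, and integrability of P⁻¹ does the
same for τ. -/
lemma exists_isRoot {T : ℕ} {P : ℝ → Matrix (Fin T) (Fin T) ℂ} (hP : IsSpectralDensity P)
    (hmin : Minimality P) : ∃ σ τ, IsRoot P σ τ := by
  obtain ⟨f, hfm, hf⟩ := measurable_sqrt_piecewise T
  have hσm : ∀ i j, AEStronglyMeasurable (fun x => f (P x) i j) period := fun i j => by
    have h1 : AEMeasurable (fun x i j => P x i j : ℝ → Fin T → Fin T → ℂ) period :=
      aemeasurable_pi_lambda _ fun i => aemeasurable_pi_lambda _ fun j =>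
        (hP.integrable i j).1.aemeasurable
    exact ((hfm i j).comp_aemeasurable h1).aestronglyMeasurable
  -- Writing τ as P⁻¹σ instead of σ⁻¹ gives its measurability from that of P⁻¹, which is part of
  -- minimality.
  have hτm : ∀ i j, AEStronglyMeasurable (fun x => ((P x)⁻¹ * f (P x)) i j) period :=
    aestronglyMeasurable_mul (fun i j => (hmin.integrable_inv i j).1) hσm
  have hinv : ∀ᵐ x ∂period, (f (P x)).IsHermitian ∧ f (P x) * f (P x) = P x ∧
      (P x)⁻¹ * f (P x) = (f (P x))⁻¹ ∧ IsUnit (f (P x)).det := by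
    filter_upwards [hP.posSemidef, hmin.isUnit] with x hx hu
    obtain ⟨h1, h2⟩ := hf _ hx
    have hdet : IsUnit (f (P x)).det := by
      rw [Matrix.isUnit_iff_isUnit_det, ← h2, Matrix.det_mul] at hu
      exact isUnit_of_mul_isUnit_left hu
    refine ⟨h1, h2, ?_, hdet⟩
    rw [← h2, Matrix.mul_inv_rev, h2, Matrix.mul_assoc, Matrix.nonsing_inv_mul _ hdet,
      Matrix.mul_one]
  refine ⟨fun x => f (P x), fun x => (P x)⁻¹ * f (P x), ?_, ?_, ?_, ?_, ?_, ?_, ?_, ?_⟩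
  · exact memLp_entry_of_mul_self (fun i => hP.integrable i i) hσm
      (hinv.mono fun x hx => ⟨hx.1, hx.2.1⟩)
  · refine memLp_entry_of_mul_self (fun i => hmin.integrable_inv i i) hτm
      (hinv.mono fun x ⟨h1, h2, h3, h4⟩ => ⟨?_, ?_⟩)
    · rw [h3]; exact h1.inv
    · rw [h3, ← Matrix.mul_inv_rev, h2]
  · exact hinv.mono fun x hx => hx.1
  · refine hinv.mono fun x ⟨h1, h2, h3, h4⟩ => ?_
    rw [h3]; exact h1.inv
  · exact hinv.mono fun x hx => hx.2.1
  · refine hinv.mono fun x ⟨h1, h2, h3, h4⟩ => ?_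
    rw [h3]; exact Matrix.mul_nonsing_inv _ h4
  · refine hinv.mono fun x ⟨h1, h2, h3, h4⟩ => ?_
    rw [h3]; exact Matrix.nonsing_inv_mul _ h4
  · refine hinv.mono fun x ⟨h1, h2, h3, h4⟩ => ?_
    rw [h3, ← Matrix.mul_inv_rev, h2]

/-! ### The embedding of `L₂(P)` into `L₂` -/

/-- The function `v M` with values in Euclidean space. -/
def emb {T : ℕ} (M : ℝ → Matrix (Fin T) (Fin T) ℂ) (v : ℝ → Fin T → ℂ) (x : ℝ) :
    EuclideanSpace ℂ (Fin T) :=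
  WithLp.toLp 2 (Matrix.vecMul (v x) (M x))

lemma emb_sub {T : ℕ} (M : ℝ → Matrix (Fin T) (Fin T) ℂ) (v w : ℝ → Fin T → ℂ) (x : ℝ) :
    emb M (v - w) x = emb M v x - emb M w x := by
  simp [emb, Matrix.sub_vecMul]

lemma aestronglyMeasurable_vecMul {T : ℕ} {v : ℝ → Fin T → ℂ}
    {M : ℝ → Matrix (Fin T) (Fin T) ℂ}
    (hv : ∀ i, AEStronglyMeasurable (fun x => v x i) period)
    (hM : ∀ i j, AEStronglyMeasurable (fun x => M x i j) period) (j : Fin T) :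
    AEStronglyMeasurable (fun x => Matrix.vecMul (v x) (M x) j) period := by
  simp only [Matrix.vecMul, dotProduct]
  exact Finset.aestronglyMeasurable_fun_sum _ fun i _ => (hv i).mul (hM i j)

lemma aestronglyMeasurable_piLp {T : ℕ} {f : ℝ → EuclideanSpace ℂ (Fin T)}
    (hf : ∀ i, AEStronglyMeasurable (fun x => f x i) period) : AEStronglyMeasurable f period := by
  have h1 : AEMeasurable (fun x i => f x i : ℝ → Fin T → ℂ) period :=
    aemeasurable_pi_lambda _ fun i => (hf i).aemeasurable
  exact (PiLp.continuous_toLp 2 (fun _ : Fin T => ℂ)).comp_aestronglyMeasurable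
    h1.aestronglyMeasurable

lemma aestronglyMeasurable_pi_iff {T : ℕ} {f : ℝ → Fin T → ℂ} :
    AEStronglyMeasurable f period ↔ ∀ i, AEStronglyMeasurable (fun x => f x i) period := by
  refine ⟨fun h i => (continuous_apply i).comp_aestronglyMeasurable h, fun h => ?_⟩
  exact (aemeasurable_pi_lambda _ fun i => (h i).aemeasurable).aestronglyMeasurable

lemma dotProduct_star_vecMul {T : ℕ} {M : Matrix (Fin T) (Fin T) ℂ} (hM : M.IsHermitian)
    (v w : Fin T → ℂ) : v ⬝ᵥ star (Matrix.vecMul w M) = Matrix.vecMul v M ⬝ᵥ star w := by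
  rw [Matrix.star_vecMul, hM.eq, Matrix.dotProduct_mulVec]

lemma integrable_dotProduct_star {T : ℕ} {v w : ℝ → Fin T → ℂ}
    (hv : ∀ i, MemLp (fun x => v x i) 2 period) (hw : ∀ i, MemLp (fun x => w x i) 2 period) :
    Integrable (fun x => v x ⬝ᵥ star (w x)) period := by
  simp only [dotProduct]
  exact integrable_finsetSum _ fun i _ => MemLp.integrable_mul_two (hv i) (hw i).star

lemma integrable_vecMul {T : ℕ} {v : ℝ → Fin T → ℂ} {M : ℝ → Matrix (Fin T) (Fin T) ℂ}
    (hv : ∀ i, MemLp (fun x => v x i) 2 period)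
    (hM : ∀ i j, MemLp (fun x => M x i j) 2 period) (j : Fin T) :
    Integrable (fun x => Matrix.vecMul (v x) (M x) j) period := by
  simp only [Matrix.vecMul, dotProduct]
  exact integrable_finsetSum _ fun i _ => MemLp.integrable_mul_two (hv i) (hM i j)

lemma memLp_coord {T : ℕ} (φ : Lp (EuclideanSpace ℂ (Fin T)) 2 period) (i : Fin T) :
    MemLp (fun x => φ x i) 2 period :=
  memLp_piLp_iff.1 (Lp.memLp φ) i

/-- The functions `e^{inx} δ_k M(x)`, `n ∈ N`, as elements of `L²`. -/
def expoRows {T : ℕ} (M : ℝ → Matrix (Fin T) (Fin T) ℂ) (N : Set ℤ) :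
    Set (Lp (EuclideanSpace ℂ (Fin T)) 2 period) :=
  {φ | ∃ n ∈ N, ∃ k : Fin T, φ =ᵐ[period] emb M fun x => Pi.single k (expo n x)}

/-- The closed span of the functions `e^{inx} δ_k M(x)`, `n ∈ N`. -/
def expoSpan {T : ℕ} (M : ℝ → Matrix (Fin T) (Fin T) ℂ) (N : Set ℤ) :
    Submodule ℂ (Lp (EuclideanSpace ℂ (Fin T)) 2 period) :=
  (Submodule.span ℂ (expoRows M N)).topologicalClosure

instance {T : ℕ} (M : ℝ → Matrix (Fin T) (Fin T) ℂ) (N : Set ℤ) :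
    CompleteSpace (expoSpan M N) :=
  (Submodule.isClosed_topologicalClosure _).completeSpace_coe

lemma memLp_emb_of_bound {T : ℕ} {M : ℝ → Matrix (Fin T) (Fin T) ℂ}
    (hM : ∀ i j, MemLp (fun x => M x i j) 2 period) {v : ℝ → Fin T → ℂ}
    (hv : ∀ i, AEStronglyMeasurable (fun x => v x i) period) {C : ℝ}
    (hC : ∀ x i, ‖v x i‖ ≤ C) : MemLp (emb M v) 2 period := by
  refine memLp_piLp_iff.2 fun j => ?_
  simp only [emb, Matrix.vecMul, dotProduct]
  refine memLp_finsetSum _ fun i _ => ?_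
  refine (hM i j).of_le_mul (c := C) ((hv i).mul (hM i j).1) (Eventually.of_forall fun x => ?_)
  rw [norm_mul]
  gcongr
  exact hC x i

lemma aestronglyMeasurable_single_expo {T : ℕ} (n : ℤ) (k i : Fin T) :
    AEStronglyMeasurable (fun x => (Pi.single k (expo n x) : Fin T → ℂ) i) period := by
  by_cases h : i = k
  · subst h
    simpa using (continuous_expo n).aestronglyMeasurable
  · simpa [h] using aestronglyMeasurable_const

lemma norm_single_expo_le {T : ℕ} (n : ℤ) (k i : Fin T) (x : ℝ) :
    ‖(Pi.single k (expo n x) : Fin T → ℂ) i‖ ≤ 1 := by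
  by_cases h : i = k
  · subst h
    simp [norm_expo]
  · simp [h]

lemma exists_mem_expoRows {T : ℕ} {M : ℝ → Matrix (Fin T) (Fin T) ℂ}
    (hM : ∀ i j, MemLp (fun x => M x i j) 2 period) {N : Set ℤ} {n : ℤ} (hn : n ∈ N)
    (k : Fin T) : ∃ u ∈ expoRows M N, u =ᵐ[period] emb M fun x => Pi.single k (expo n x) := by
  have h := memLp_emb_of_bound hM (aestronglyMeasurable_single_expo n k)
    (fun x i => norm_single_expo_le n k i x)
  exact ⟨h.toLp, ⟨n, hn, k, h.coeFn_toLp⟩, h.coeFn_toLp⟩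

/-- As M is Hermitian it can be moved to the other factor. Orthogonality to the weighted
exponentials thus becomes vanishing of Fourier coefficients of φM. -/
lemma inner_expoRow {T : ℕ} {M : ℝ → Matrix (Fin T) (Fin T) ℂ}
    (hM : ∀ᵐ x ∂period, (M x).IsHermitian) {n : ℤ} {k : Fin T}
    {u : Lp (EuclideanSpace ℂ (Fin T)) 2 period}
    (hu : u =ᵐ[period] emb M fun x => Pi.single k (expo n x))
    (φ : Lp (EuclideanSpace ℂ (Fin T)) 2 period) :
    inner ℂ u φ = 2 * Real.pi * coeff (fun x => Matrix.vecMul (φ x) (M x) k) n := by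
  rw [L2.inner_def, ← integral_mul_expo]
  refine integral_congr_ae ?_
  filter_upwards [hM, hu] with x hx hux
  rw [hux, EuclideanSpace.inner_eq_star_dotProduct, emb, dotProduct_star_vecMul hx]
  rw [← star_expo, ← Pi.single_star]
  simp

lemma mem_expoSpan_orthogonal {T : ℕ} {M : ℝ → Matrix (Fin T) (Fin T) ℂ}
    (hM : ∀ i j, MemLp (fun x => M x i j) 2 period)
    (hMh : ∀ᵐ x ∂period, (M x).IsHermitian) {N : Set ℤ}
    {φ : Lp (EuclideanSpace ℂ (Fin T)) 2 period} :
    φ ∈ (expoSpan M N)ᗮ ↔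
      ∀ n ∈ N, ∀ k, coeff (fun x => Matrix.vecMul (φ x) (M x) k) n = 0 := by
  have hpi : (2 * Real.pi : ℂ) ≠ 0 := by simp [Real.pi_ne_zero]
  constructor
  · intro h n hn k
    obtain ⟨u, hu, hu'⟩ := exists_mem_expoRows hM hn k
    have := h u (Submodule.le_topologicalClosure _ (Submodule.subset_span hu))
    rw [inner_expoRow hMh hu'] at this
    exact (mul_eq_zero.1 this).resolve_left hpi
  · intro h
    rw [expoSpan, Submodule.orthogonal_closure, Submodule.mem_orthogonal]
    intro u hu
    have hle : Submodule.span ℂ (expoRows M N) ≤ (ℂ ∙ φ)ᗮ := by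
      rw [Submodule.span_le]
      rintro u ⟨n, hn, k, hu⟩
      rw [SetLike.mem_coe, Submodule.mem_orthogonal_singleton_iff_inner_left,
        inner_expoRow hMh hu, h n hn k, mul_zero]
    exact Submodule.mem_orthogonal_singleton_iff_inner_left.1 (hle hu)

/-- In `L₂(P)` the orthogonal complement of the observed exponentials is the closed span of the
unobserved exponentials, divided by `P`. -/
theorem expoSpan_observed_orthogonal {T : ℕ} {P σ τ : ℝ → Matrix (Fin T) (Fin T) ℂ}
    (h : IsRoot P σ τ) {S : Set ℤ} (hS : S.Finite) :
    (expoSpan σ (observed S))ᗮ = expoSpan τ (unobserved S) := by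
  -- Biorthogonality: (e^{inx} δ_k τ)σ = e^{inx} δ_k has the single frequency n, which is not
  -- observed.
  have hle : expoSpan τ (unobserved S) ≤ (expoSpan σ (observed S))ᗮ := by
    refine Submodule.topologicalClosure_minimal _ ?_ (Submodule.isClosed_orthogonal _)
    rw [Submodule.span_le]
    rintro u ⟨n, hn, k, hu⟩
    rw [SetLike.mem_coe, mem_expoSpan_orthogonal h.memLp_root h.ae_isHermitian_root]
    intro m hm l
    have h1 : (fun x => Matrix.vecMul (u x) (σ x) l) =ᵐ[period]
        fun x => expo n x * (Pi.single k (1 : ℂ) : Fin T → ℂ) l := by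
      filter_upwards [hu, h.ae_inv_mul_root] with x hx hx'
      rw [hx, emb]
      simp only [Matrix.vecMul_vecMul, hx', Matrix.vecMul_one]
      rw [← mul_one (expo n x), ← smul_eq_mul (expo n x) 1, Pi.single_smul]
      simp
    have hnm : n ≠ m := by
      rintro rfl
      rcases hn with hn | hn
      · exact hm.2 hn
      · have h1 : n ≤ -1 := hm.1
        have h2 : 0 ≤ n := hn
        omega
    rw [coeff_congr h1, coeff_mul_const, coeff_expo_of_ne hnm, zero_mul]
  refine le_antisymm (fun φ hφ => ?_) hle
  set K := expoSpan τ (unobserved S)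
  set κ := φ - K.starProjection φ
  have hPK : K.starProjection φ ∈ K := Submodule.starProjection_apply_mem K φ
  have h1 : κ ∈ Kᗮ := K.sub_starProjection_mem_orthogonal φ
  have h2 : κ ∈ (expoSpan σ (observed S))ᗮ := Submodule.sub_mem _ hφ (hle hPK)
  rw [mem_expoSpan_orthogonal h.memLp_root h.ae_isHermitian_root] at h2
  rw [mem_expoSpan_orthogonal h.memLp_inv h.ae_isHermitian_inv] at h1
  -- κτ has no unobserved coefficients and κσ has no observed ones, yet their pointwise product is
  -- |κ|². Complementary spectra then force ∫|κ|² = 0.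
  have hae : ∀ᵐ x ∂period, Matrix.vecMul (κ x) (τ x) ⬝ᵥ star (Matrix.vecMul (κ x) (σ x)) =
      (κ x).ofLp ⬝ᵥ star (κ x).ofLp := by
    filter_upwards [h.ae_isHermitian_root, h.ae_inv_mul_root] with x hx hx'
    rw [dotProduct_star_vecMul hx, Matrix.vecMul_vecMul, hx', Matrix.vecMul_one]
  have hint : Integrable (fun x => (κ x).ofLp ⬝ᵥ star (κ x).ofLp) period :=
    integrable_dotProduct_star (memLp_coord κ) (memLp_coord κ)
  have h3 := integral_dotProduct_star_eq_zero hS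
    (fun i => integrable_vecMul (memLp_coord κ) h.memLp_inv i)
    (fun i => integrable_vecMul (memLp_coord κ) h.memLp_root i)
    (fun i n hn => h1 n hn i) (fun i n hn => h2 n hn i)
    (hint.congr (hae.mono fun x hx => hx.symm))
  rw [integral_congr_ae hae] at h3
  have h4 : κ = 0 := by
    rw [← inner_self_eq_zero (𝕜 := ℂ), L2.inner_def, ← h3]
    rfl
  have h5 : φ = K.starProjection φ := sub_eq_zero.1 h4
  rw [h5]
  exact hPK

/-! ### The symbol of the functional -/

/-- Absolute summability of b and integrability of g allow termwise integration; each exponential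
shifts the index of the coefficient. -/
lemma hasSum_coeff_mul {J : Type*} [Countable J] {b : J → ℂ} (hb : Summable fun j => ‖b j‖)
    (m : J → ℤ) {g : ℝ → ℂ} (hg : Integrable g period) (n : ℤ) :
    HasSum (fun j => b j * coeff g (n - m j))
      (coeff (fun x => (∑' j, b j * expo (m j) x) * g x) n) := by
  have hF : ∀ j, Integrable (fun x => b j * (expo (m j) x * g x * expo (-n) x)) period := fun j =>
    (Integrable.mul_expo (Integrable.expo_mul hg _) _).const_mul _
  have hnorm : ∀ j x, ‖b j * (expo (m j) x * g x * expo (-n) x)‖ = ‖b j‖ * ‖g x‖ := fun j x => by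
    simp only [norm_mul, norm_expo, one_mul, mul_one]
  have h := hasSum_integral_of_summable_integral_norm hF (by
    simp only [hnorm, integral_const_mul]
    exact hb.mul_right _)
  have h' := h.mul_left (1 / (2 * (Real.pi : ℂ)))
  have e1 : (fun j => b j * coeff g (n - m j)) = fun j => 1 / (2 * (Real.pi : ℂ)) *
      ∫ x, b j * (expo (m j) x * g x * expo (-n) x) ∂period := by
    ext j
    rw [integral_const_mul, ← coeff_expo_mul (m j) g n, coeff]
    ring
  have e2 : coeff (fun x => (∑' j, b j * expo (m j) x) * g x) n = 1 / (2 * (Real.pi : ℂ)) *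
      ∫ x, ∑' j, b j * (expo (m j) x * g x * expo (-n) x) ∂period := by
    rw [coeff]
    congr 2
    ext x
    have hs : Summable fun j => b j * expo (m j) x := by
      refine Summable.of_norm ?_
      simpa only [norm_mul, norm_expo, mul_one] using hb
    rw [← tsum_mul_right, ← tsum_mul_right]
    exact tsum_congr fun j => by ring
  rwa [e1, e2]

section Symbol

variable {T : ℕ} {S : Set ℤ} {a : ℤ → Fin T → ℂ}

lemma summable_norm_coord (ha : Summable fun j : functionalIndex S => ∑ k : Fin T, ‖a j k‖)
    (i : Fin T) : Summable fun j : functionalIndex S => ‖a j i‖ :=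
  ha.of_nonneg_of_le (fun _ => norm_nonneg _) fun j =>
    Finset.single_le_sum (f := fun k => ‖a j k‖) (fun _ _ => norm_nonneg _) (Finset.mem_univ i)

lemma symbolA_apply (ha : Summable fun j : functionalIndex S => ∑ k : Fin T, ‖a j k‖)
    (x : ℝ) (i : Fin T) :
    symbolA S a x i = ∑' j : functionalIndex S, a j i * expo (-(j : ℤ)) x := by
  have hs : Summable fun j : functionalIndex S => expo (-(j : ℤ)) x • a j := by
    refine Pi.summable.2 fun i => Summable.of_norm ?_
    simpa only [Pi.smul_apply, smul_eq_mul, norm_mul, norm_expo, one_mul]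
      using summable_norm_coord ha i
  rw [symbolA, tsum_apply hs]
  exact tsum_congr fun j => by rw [Pi.smul_apply, smul_eq_mul, mul_comm]

lemma continuous_symbolA (ha : Summable fun j : functionalIndex S => ∑ k : Fin T, ‖a j k‖)
    (i : Fin T) : Continuous fun x => symbolA S a x i := by
  simp only [symbolA_apply ha]
  refine continuous_tsum (fun j => continuous_const.mul (continuous_expo _))
    (summable_norm_coord ha i) fun j x => ?_
  rw [norm_mul, norm_expo, mul_one]

lemma norm_symbolA_le (ha : Summable fun j : functionalIndex S => ∑ k : Fin T, ‖a j k‖)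
    (x : ℝ) (i : Fin T) :
    ‖symbolA S a x i‖ ≤ ∑' j : functionalIndex S, ∑ k : Fin T, ‖a j k‖ := by
  rw [symbolA_apply ha]
  refine (tsum_of_norm_bounded ha.hasSum fun j => ?_)
  rw [norm_mul, norm_expo, mul_one]
  exact Finset.single_le_sum (f := fun k => ‖a j k‖) (fun _ _ => norm_nonneg _) (Finset.mem_univ i)

lemma integrable_symbolA_mul (ha : Summable fun j : functionalIndex S => ∑ k : Fin T, ‖a j k‖)
    {g : ℝ → ℂ} (hg : Integrable g period) (i : Fin T) :
    Integrable (fun x => symbolA S a x i * g x) period :=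
  hg.bdd_mul (continuous_symbolA ha i).aestronglyMeasurable
    (Eventually.of_forall fun x => norm_symbolA_le ha x i)

lemma integrable_vecMul_symbolA
    (ha : Summable fun j : functionalIndex S => ∑ k : Fin T, ‖a j k‖)
    {W : ℝ → Matrix (Fin T) (Fin T) ℂ} (hW : ∀ i j, Integrable (fun x => W x i j) period)
    (i : Fin T) : Integrable (fun x => Matrix.vecMul (symbolA S a x) (W x) i) period := by
  simp only [Matrix.vecMul, dotProduct]
  exact integrable_finsetSum _ fun l _ => integrable_symbolA_mul ha (hW l i) l

/-- Since A carries frequency -j, the index becomes n + j. With n = k this produces the blocks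
R(k,j), and with n = -k the blocks Q(j,k). -/
lemma hasSum_vecMul_matCoeff
    (ha : Summable fun j : functionalIndex S => ∑ k : Fin T, ‖a j k‖)
    {W : ℝ → Matrix (Fin T) (Fin T) ℂ} (hW : ∀ i j, Integrable (fun x => W x i j) period)
    (n : ℤ) :
    HasSum (fun j : functionalIndex S => Matrix.vecMul (a j) (matCoeff W (n + j)))
      (fun i => coeff (fun x => Matrix.vecMul (symbolA S a x) (W x) i) n) := by
  rw [Pi.hasSum]
  intro i
  simp only [Matrix.vecMul, dotProduct]
  rw [coeff_sum _ fun l _ => integrable_symbolA_mul ha (hW l i) l]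
  refine hasSum_sum fun l _ => ?_
  have h := hasSum_coeff_mul (summable_norm_coord ha l) (fun j => -(j : ℤ)) (hW l i) n
  simp only [sub_neg_eq_add] at h
  simpa only [symbolA_apply ha, matCoeff, Matrix.of_apply] using h

lemma tsum_coeff_mul_star (ha : Summable fun j : functionalIndex S => ∑ k : Fin T, ‖a j k‖)
    {f : ℝ → Fin T → ℂ} (hf : ∀ i, Integrable (fun x => f x i) period) :
    ∑' k : functionalIndex S, (fun i => coeff (fun x => f x i) (-(k : ℤ))) ⬝ᵥ star (a k) =
      coeff (fun x => f x ⬝ᵥ star (symbolA S a x)) 0 := by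
  simp only [dotProduct]
  have hst : ∀ x i, star (symbolA S a x) i =
      ∑' j : functionalIndex S, star (a j i) * expo (j : ℤ) x := fun x i => by
    rw [Pi.star_apply, symbolA_apply ha, tsum_star]
    exact tsum_congr fun j => by rw [star_mul', star_expo, neg_neg]
  have hint : ∀ i, Integrable (fun x => f x i * star (symbolA S a x) i) period := fun i => by
    refine (hf i).mul_bdd (c := ∑' j : functionalIndex S, ∑ k : Fin T, ‖a j k‖)
      (continuous_symbolA ha i).star.aestronglyMeasurable
      (Eventually.of_forall fun x => ?_)
    simpa using norm_symbolA_le ha x i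
  rw [coeff_sum _ fun i _ => hint i]
  refine (hasSum_sum fun i _ => ?_).tsum_eq
  have h := hasSum_coeff_mul (b := fun j : functionalIndex S => star (a j i))
    (by simpa using summable_norm_coord ha i) (fun j => (j : ℤ)) (hf i) 0
  simp only [zero_sub] at h
  have h2 : (fun x => f x i * star (symbolA S a x) i) =
      fun x => (∑' j : functionalIndex S, star (a j i) * expo (j : ℤ) x) * f x i := by
    ext x
    rw [hst, mul_comm]
  rw [h2]
  simpa only [mul_comm, Pi.star_apply] using h

end Symbol

/-! ### Completing the square -/

lemma mul_inv_mul_eq {T : ℕ} {F G : Matrix (Fin T) (Fin T) ℂ} (hu : IsUnit (F + G)) :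
    F * (F + G)⁻¹ * G = F - F * (F + G)⁻¹ * F := by
  have hd := (Matrix.isUnit_iff_isUnit_det _).1 hu
  have h1 : F * (F + G)⁻¹ * (F + G) = F := by
    rw [Matrix.mul_assoc, Matrix.nonsing_inv_mul _ hd, Matrix.mul_one]
  rw [eq_sub_iff_add_eq, add_comm, ← Matrix.mul_add, h1]

/-- This is the parallel sum of F and G, symmetric in the two. Multiplying it on the right by P⁻¹(F
+ G) = 1 exhibits it as a sum of two congruences, one of G and one of F. -/
lemma posSemidef_mul_inv_mul {T : ℕ} {F G : Matrix (Fin T) (Fin T) ℂ} (hF : F.PosSemidef)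
    (hG : G.PosSemidef) (hu : IsUnit (F + G)) : (F * (F + G)⁻¹ * G).PosSemidef := by
  have hd := (Matrix.isUnit_iff_isUnit_det _).1 hu
  set P := F + G with hP
  have hPh : P⁻¹.conjTranspose = P⁻¹ := (hF.isHermitian.add hG.isHermitian).inv.eq
  have h1 : P⁻¹ * P = 1 := Matrix.nonsing_inv_mul _ hd
  have h2 : F * P⁻¹ * G = G * P⁻¹ * F := by
    have e1 : F * P⁻¹ * G = F - F * P⁻¹ * F := mul_inv_mul_eq hu
    have e2 : G * P⁻¹ * F = F - F * P⁻¹ * F := by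
      have : P * P⁻¹ * F = F := by rw [Matrix.mul_nonsing_inv _ hd, Matrix.one_mul]
      rw [eq_sub_iff_add_eq, ← Matrix.add_mul, ← Matrix.add_mul, add_comm G F, ← hP, this]
    rw [e1, e2]
  have key : F * P⁻¹ * G = F * P⁻¹ * G * (F * P⁻¹).conjTranspose +
      G * P⁻¹ * F * (G * P⁻¹).conjTranspose := by
    rw [Matrix.conjTranspose_mul, Matrix.conjTranspose_mul, hPh, hF.isHermitian.eq,
      hG.isHermitian.eq]
    rw [← h2, ← Matrix.mul_add, ← Matrix.mul_add, ← hP, h1, Matrix.mul_one]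
  rw [key]
  exact (hG.mul_mul_conjTranspose_same _).add (hF.mul_mul_conjTranspose_same _)

lemma re_form_nonneg {T : ℕ} {W : Matrix (Fin T) (Fin T) ℂ} (hW : W.PosSemidef)
    (v : Fin T → ℂ) : 0 ≤ (Matrix.vecMul v W ⬝ᵥ star v).re := by
  rw [← Matrix.dotProduct_mulVec]
  simpa using (Complex.le_def.1 (hW.dotProduct_mulVec_nonneg (star v))).1

lemma form_sub_sub {T : ℕ} (W : Matrix (Fin T) (Fin T) ℂ) (v w : Fin T → ℂ) :
    Matrix.vecMul (v - w) W ⬝ᵥ star (v - w) = Matrix.vecMul v W ⬝ᵥ star v -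
      Matrix.vecMul v W ⬝ᵥ star w - Matrix.vecMul w W ⬝ᵥ star v + Matrix.vecMul w W ⬝ᵥ star w := by
  simp only [Matrix.sub_vecMul, star_sub, sub_dotProduct, dotProduct_sub]
  ring

/-- The square is completed around AᵀF(F+G)⁻¹, the unconstrained pointwise minimiser; the leftover F
- F(F+G)⁻¹F equals F(F+G)⁻¹G. -/
lemma error_decomposition {T : ℕ} {F G : Matrix (Fin T) (Fin T) ℂ} (hF : F.IsHermitian)
    (hG : G.IsHermitian) (hu : IsUnit (F + G)) (A h : Fin T → ℂ) :
    Matrix.vecMul (A - h) F ⬝ᵥ star (A - h) + Matrix.vecMul h G ⬝ᵥ star h =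
      Matrix.vecMul (h - Matrix.vecMul A (F * (F + G)⁻¹)) (F + G) ⬝ᵥ
        star (h - Matrix.vecMul A (F * (F + G)⁻¹)) +
      Matrix.vecMul A (F * (F + G)⁻¹ * G) ⬝ᵥ star A := by
  have hd := (Matrix.isUnit_iff_isUnit_det _).1 hu
  rw [mul_inv_mul_eq hu]
  set P := F + G with hP
  have hPh : P.conjTranspose = P := (hF.add hG).eq
  have hPi : P⁻¹.conjTranspose = P⁻¹ := (hF.add hG).inv.eq
  have h1 : F * P⁻¹ * P = F := by
    rw [Matrix.mul_assoc, Matrix.nonsing_inv_mul _ hd, Matrix.mul_one]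
  have h3 : P * (F * P⁻¹).conjTranspose = F := by
    rw [Matrix.conjTranspose_mul, hPi, hF.eq, ← Matrix.mul_assoc, Matrix.mul_nonsing_inv _ hd,
      Matrix.one_mul]
  have h4 : ∀ v, Matrix.vecMul v P ⬝ᵥ star (Matrix.vecMul A (F * P⁻¹)) =
      Matrix.vecMul v F ⬝ᵥ star A := fun v => by
    rw [Matrix.star_vecMul, Matrix.dotProduct_mulVec, Matrix.vecMul_vecMul, h3]
  rw [form_sub_sub, form_sub_sub, h4, h4, Matrix.vecMul_vecMul, Matrix.vecMul_vecMul, h1,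
    Matrix.vecMul_sub, sub_dotProduct, hP, Matrix.vecMul_add, add_dotProduct]
  ring

/-! ### The estimation problem for fixed densities -/

/-- Trigonometric polynomials with frequencies in `N`. -/
def expoPolys (T : ℕ) (N : Set ℤ) : Submodule ℂ (ℝ → Fin T → ℂ) :=
  Submodule.span ℂ {p | ∃ n ∈ N, ∃ k : Fin T, p = fun x => Pi.single k (expo n x)}

lemma exists_mem_span_of_mem_expoPolys {T : ℕ} {M : ℝ → Matrix (Fin T) (Fin T) ℂ}
    (hM : ∀ i j, MemLp (fun x => M x i j) 2 period) {N : Set ℤ} {p : ℝ → Fin T → ℂ}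
    (hp : p ∈ expoPolys T N) :
    ∃ u ∈ Submodule.span ℂ (expoRows M N), u =ᵐ[period] emb M p := by
  induction hp using Submodule.span_induction with
  | mem p hp =>
    obtain ⟨n, hn, k, rfl⟩ := hp
    obtain ⟨u, hu, hu'⟩ := exists_mem_expoRows hM hn k
    exact ⟨u, Submodule.subset_span hu, hu'⟩
  | zero =>
    refine ⟨0, Submodule.zero_mem _, (Lp.coeFn_zero (EuclideanSpace ℂ (Fin T)) 2 period).mono fun x hx => ?_⟩
    rw [hx]
    simp [emb]
  | add p q _ _ ihp ihq =>
    obtain ⟨u, hu, hu'⟩ := ihp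
    obtain ⟨v, hv, hv'⟩ := ihq
    refine ⟨u + v, Submodule.add_mem _ hu hv, ?_⟩
    filter_upwards [Lp.coeFn_add u v, hu', hv'] with x h1 h2 h3
    rw [h1, Pi.add_apply, h2, h3]
    simp [emb, Matrix.add_vecMul]
  | smul c p _ ihp =>
    obtain ⟨u, hu, hu'⟩ := ihp
    refine ⟨c • u, Submodule.smul_mem _ c hu, ?_⟩
    filter_upwards [Lp.coeFn_smul c u, hu'] with x h1 h2
    rw [h1, Pi.smul_apply, h2]
    simp [emb, Matrix.smul_vecMul]

lemma exists_mem_expoPolys_of_mem_span {T : ℕ} {M : ℝ → Matrix (Fin T) (Fin T) ℂ} {N : Set ℤ}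
    {u : Lp (EuclideanSpace ℂ (Fin T)) 2 period} (hu : u ∈ Submodule.span ℂ (expoRows M N)) :
    ∃ p ∈ expoPolys T N, u =ᵐ[period] emb M p := by
  induction hu using Submodule.span_induction with
  | mem u hu =>
    obtain ⟨n, hn, k, hu⟩ := hu
    exact ⟨_, Submodule.subset_span ⟨n, hn, k, rfl⟩, hu⟩
  | zero =>
    refine ⟨0, Submodule.zero_mem _, (Lp.coeFn_zero (EuclideanSpace ℂ (Fin T)) 2 period).mono fun x hx => ?_⟩
    rw [hx]
    simp [emb]
  | add u v _ _ ihu ihv =>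
    obtain ⟨p, hp, hp'⟩ := ihu
    obtain ⟨q, hq, hq'⟩ := ihv
    refine ⟨p + q, Submodule.add_mem _ hp hq, ?_⟩
    filter_upwards [Lp.coeFn_add u v, hp', hq'] with x h1 h2 h3
    rw [h1, Pi.add_apply, h2, h3]
    simp [emb, Matrix.add_vecMul]
  | smul c u _ ihu =>
    obtain ⟨p, hp, hp'⟩ := ihu
    refine ⟨c • p, Submodule.smul_mem _ c hp, ?_⟩
    filter_upwards [Lp.coeFn_smul c u, hp'] with x h1 h2
    rw [h1, Pi.smul_apply, h2]
    simp [emb, Matrix.smul_vecMul]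

lemma lintegral_norm_sq_Lp {T : ℕ} (φ : Lp (EuclideanSpace ℂ (Fin T)) 2 period) :
    ∫⁻ x, ENNReal.ofReal (‖φ x‖ ^ 2) ∂period = ENNReal.ofReal (‖φ‖ ^ 2) := by
  rw [← ofReal_integral_eq_lintegral_ofReal ((Lp.memLp φ).integrable_norm_pow two_ne_zero)
    (Eventually.of_forall fun x => by positivity)]
  congr 1
  rw [← inner_self_eq_norm_sq (𝕜 := ℂ), L2.inner_def, ← integral_re (L2.integrable_inner φ φ)]
  simp only [inner_self_eq_norm_sq]

lemma norm_toLp_sq {T : ℕ} (v : Fin T → ℂ) :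
    ‖(WithLp.toLp 2 v : EuclideanSpace ℂ (Fin T))‖ ^ 2 = (v ⬝ᵥ star v).re := by
  rw [← inner_self_eq_norm_sq (𝕜 := ℂ), EuclideanSpace.inner_eq_star_dotProduct]
  rfl

/-! ### The isometry of `L₂(P)` with `L₂` given by a square root -/

section Root

variable {T : ℕ} {P σ τ : ℝ → Matrix (Fin T) (Fin T) ℂ}

lemma IsRoot.norm_emb_sq (R : IsRoot P σ τ) :
    ∀ᵐ x ∂period, ∀ v : ℝ → Fin T → ℂ,
      ‖emb σ v x‖ ^ 2 = (Matrix.vecMul (v x) (P x) ⬝ᵥ star (v x)).re := by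
  filter_upwards [R.ae_isHermitian_root, R.ae_root_mul_root] with x h1 h2 v
  rw [emb, norm_toLp_sq, dotProduct_star_vecMul h1, Matrix.vecMul_vecMul, h2]

lemma IsRoot.quad_eq_lintegral (R : IsRoot P σ τ) (v : ℝ → Fin T → ℂ) :
    quad P v = ∫⁻ x, ENNReal.ofReal (‖emb σ v x‖ ^ 2) ∂period :=
  lintegral_congr_ae (R.norm_emb_sq.mono fun x hx => by simp only [hx v])

lemma IsRoot.quad_eq (R : IsRoot P σ τ) {v : ℝ → Fin T → ℂ}
    {φ : Lp (EuclideanSpace ℂ (Fin T)) 2 period} (h : φ =ᵐ[period] emb σ v) :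
    quad P v = ENNReal.ofReal (‖φ‖ ^ 2) := by
  rw [R.quad_eq_lintegral, ← lintegral_norm_sq_Lp]
  exact lintegral_congr_ae (h.mono fun x hx => by simp only [hx])

lemma IsRoot.aestronglyMeasurable_emb (R : IsRoot P σ τ) {v : ℝ → Fin T → ℂ}
    (hv : AEStronglyMeasurable v period) : AEStronglyMeasurable (emb σ v) period :=
  aestronglyMeasurable_piLp fun i =>
    aestronglyMeasurable_vecMul (aestronglyMeasurable_pi_iff.1 hv) (fun i j => (R.memLp_root i j).1) i

/-- The function `φ τ` that corresponds to `φ` in `L₂(P)`. -/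
def unemb (τ : ℝ → Matrix (Fin T) (Fin T) ℂ) (φ : Lp (EuclideanSpace ℂ (Fin T)) 2 period) (x : ℝ) :
    Fin T → ℂ :=
  Matrix.vecMul (φ x) (τ x)

lemma IsRoot.emb_unemb (R : IsRoot P σ τ) (φ : Lp (EuclideanSpace ℂ (Fin T)) 2 period) :
    φ =ᵐ[period] emb σ (unemb τ φ) := by
  filter_upwards [R.ae_inv_mul_root] with x hx
  rw [emb, unemb, Matrix.vecMul_vecMul, hx, Matrix.vecMul_one]

lemma IsRoot.aestronglyMeasurable_unemb (R : IsRoot P σ τ)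
    (φ : Lp (EuclideanSpace ℂ (Fin T)) 2 period) : AEStronglyMeasurable (unemb τ φ) period :=
  aestronglyMeasurable_pi_iff.2 fun j =>
    aestronglyMeasurable_vecMul (fun i => (memLp_coord φ i).1) (fun i j => (R.memLp_inv i j).1) j

/-- The quadratic form of P is the squared L² norm after multiplication by σ, so closure in L₂(P) is
closure in L². -/
lemma IsRoot.memL2s_iff (R : IsRoot P σ τ) {S : Set ℤ} {h : ℝ → Fin T → ℂ} :
    MemL2s S P h ↔ AEStronglyMeasurable h period ∧
      ∃ φ ∈ expoSpan σ (observed S), φ =ᵐ[period] emb σ h := by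
  constructor
  · rintro ⟨hm, hh⟩
    refine ⟨hm, ?_⟩
    -- A polynomial at finite distance from h is already in L₂(P), so h is too.
    have hL : MemLp (emb σ h) 2 period := by
      obtain ⟨p, hp, hq⟩ := hh 1 one_pos
      obtain ⟨u, -, hu⟩ := exists_mem_span_of_mem_expoPolys R.memLp_root (N := observed S) hp
      refine ⟨R.aestronglyMeasurable_emb hm, ?_⟩
      have h1 : MemLp (emb σ (h - p)) 2 period := by
        refine ⟨?_, ?_⟩
        · refine ((R.aestronglyMeasurable_emb hm).sub ((Lp.memLp u).1.congr hu)).congr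
            (Eventually.of_forall fun x => (emb_sub _ _ _ _).symm)
        · rw [eLpNorm_lt_top_iff_lintegral_rpow_enorm_lt_top two_ne_zero (by simp)]
          rw [R.quad_eq_lintegral] at hq
          refine lt_of_le_of_lt (le_of_eq ?_) (hq.trans ENNReal.one_lt_top)
          refine lintegral_congr fun x => ?_
          rw [ENNReal.ofReal_pow (norm_nonneg _), ofReal_norm]
          simp
      have h2 := h1.add ((memLp_congr_ae hu).1 (Lp.memLp u))
      refine ((memLp_congr_ae (Eventually.of_forall fun x => ?_)).1 h2).2
      rw [Pi.add_apply, emb_sub, sub_add_cancel]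
    refine ⟨hL.toLp, ?_, hL.coeFn_toLp⟩
    refine Metric.mem_closure_iff.2 fun ε hε => ?_
    obtain ⟨p, hp, hq⟩ := hh (ENNReal.ofReal (ε ^ 2)) (by simp; positivity)
    obtain ⟨u, hu, hu'⟩ := exists_mem_span_of_mem_expoPolys R.memLp_root (N := observed S) hp
    refine ⟨u, hu, ?_⟩
    have h3 : (hL.toLp - u : Lp (EuclideanSpace ℂ (Fin T)) 2 period) =ᵐ[period]
        emb σ (h - p) := by
      filter_upwards [Lp.coeFn_sub hL.toLp u, hL.coeFn_toLp, hu'] with x h1 h2 h3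
      rw [h1, Pi.sub_apply, h2, h3, emb_sub]
    rw [R.quad_eq h3, ENNReal.ofReal_lt_ofReal_iff (by positivity)] at hq
    rw [dist_eq_norm]
    exact lt_of_pow_lt_pow_left₀ 2 hε.le hq
  · rintro ⟨hm, φ, hφ, hφh⟩
    refine ⟨hm, fun ε hε => ?_⟩
    obtain ⟨u, hu, hlim⟩ := mem_closure_iff_seq_limit.1
      (show φ ∈ closure (Submodule.span ℂ (expoRows σ (observed S)) : Set _) from hφ)
    have h1 : Tendsto (fun n => ENNReal.ofReal (‖φ - u n‖ ^ 2)) atTop (𝓝 0) := by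
      have h2 : Tendsto (fun n => ‖φ - u n‖ ^ 2) atTop (𝓝 0) := by
        simpa using ((tendsto_const_nhds (x := φ)).sub hlim).norm.pow 2
      simpa using ENNReal.tendsto_ofReal h2
    obtain ⟨n, hn⟩ := (h1.eventually_lt_const hε).exists
    obtain ⟨p, hp, hp'⟩ := exists_mem_expoPolys_of_mem_span (hu n)
    refine ⟨p, hp, ?_⟩
    have h3 : (φ - u n : Lp (EuclideanSpace ℂ (Fin T)) 2 period) =ᵐ[period]
        emb σ (h - p) := by
      filter_upwards [Lp.coeFn_sub φ (u n), hφh, hp'] with x h1 h2 h3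
      rw [h1, Pi.sub_apply, h2, h3, emb_sub]
    rwa [R.quad_eq h3]

end Root

/-! ### The error as a squared distance -/

section Estimation

variable {T : ℕ} {S : Set ℤ} {a : ℤ → Fin T → ℂ} {F G σ τ : ℝ → Matrix (Fin T) (Fin T) ℂ}

/-- Positivity of the parallel sum means F(F+G)⁻¹F ≤ F. The left side is (Fτ)(Fτ)*, so each row of
Fτ has squared norm at most F_ii, which is integrable. -/
lemma memLp_mul_inv_root (hF : IsSpectralDensity F) (hG : IsSpectralDensity G)
    (hmin : Minimality (F + G)) (R : IsRoot (F + G) σ τ) (i j : Fin T) :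
    MemLp (fun x => (F x * τ x) i j) 2 period := by
  have hm := aestronglyMeasurable_mul (fun i j => (hF.integrable i j).1)
    (fun i j => (R.memLp_inv i j).1) i j
  rw [memLp_two_iff_integrable_sq_norm hm]
  refine (hF.integrable i i).mono (hm.norm.pow 2) ?_
  filter_upwards [hF.posSemidef, hG.posSemidef, hmin.isUnit, R.ae_isHermitian_inv,
    R.ae_inv_mul_inv] with x h1 h2 h3 h4 h5
  have hK := (posSemidef_mul_inv_mul h1 h2 h3).diag_nonneg (i := i)
  rw [mul_inv_mul_eq h3] at hK
  have e1 : F x * (F x + G x)⁻¹ * F x = (F x * τ x) * (F x * τ x).conjTranspose := by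
    rw [Matrix.conjTranspose_mul, h4.eq, h1.isHermitian.eq, Matrix.mul_assoc (F x) (τ x),
      ← Matrix.mul_assoc (τ x), h5]
    simp only [Pi.add_apply, Matrix.mul_assoc]
  have e2 : ((F x * τ x) * (F x * τ x).conjTranspose) i i =
      ((∑ k, ‖(F x * τ x) i k‖ ^ 2 : ℝ) : ℂ) := by
    rw [Matrix.mul_apply]
    push_cast
    refine Finset.sum_congr rfl fun k _ => ?_
    rw [Matrix.conjTranspose_apply, Complex.star_def, Complex.mul_conj,
      Complex.normSq_eq_norm_sq]
    push_cast
    rfl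
  rw [e1, Matrix.sub_apply, e2, sub_nonneg] at hK
  have hre := (Complex.le_def.1 hK).1
  rw [Complex.ofReal_re] at hre
  rw [Real.norm_of_nonneg (by positivity)]
  calc ‖(F x * τ x) i j‖ ^ 2 ≤ ∑ k, ‖(F x * τ x) i k‖ ^ 2 :=
        Finset.single_le_sum (f := fun k => ‖(F x * τ x) i k‖ ^ 2) (fun k _ => by positivity)
          (Finset.mem_univ j)
    _ ≤ (F x i i).re := hre
    _ ≤ ‖F x i i‖ := Complex.re_le_norm _

lemma integrable_mul_inv (hF : IsSpectralDensity F) (hG : IsSpectralDensity G)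
    (hmin : Minimality (F + G)) (R : IsRoot (F + G) σ τ) (i j : Fin T) :
    Integrable (fun x => (F x * (F x + G x)⁻¹) i j) period := by
  have h1 : Integrable (fun x => ((F x * τ x) * τ x) i j) period := by
    have e1 : ∀ x, ((F x * τ x) * τ x) i j = ∑ k, (F x * τ x) i k * τ x k j := fun x =>
      Matrix.mul_apply
    simp only [e1]
    exact integrable_finsetSum _ fun k _ => MemLp.integrable_mul_two
      (memLp_mul_inv_root hF hG hmin R i k) (R.memLp_inv k j)
  refine h1.congr (R.ae_inv_mul_inv.mono fun x hx => ?_)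
  simp only [Matrix.mul_assoc, hx, Pi.add_apply]

lemma integrable_mul_inv_mul (hF : IsSpectralDensity F) (hG : IsSpectralDensity G)
    (hmin : Minimality (F + G)) (R : IsRoot (F + G) σ τ) (i j : Fin T) :
    Integrable (fun x => (F x * (F x + G x)⁻¹ * G x) i j) period := by
  have hL := memLp_mul_inv_root hF hG hmin R
  have h1 : Integrable (fun x => F x i j - ∑ k, (F x * τ x) i k * star ((F x * τ x) j k)) period :=
    (hF.integrable i j).sub
      (integrable_finsetSum _ fun k _ => MemLp.integrable_mul_two (hL i k) (hL j k).star)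
  refine h1.congr ?_
  filter_upwards [hF.posSemidef, hmin.isUnit, R.ae_isHermitian_inv,
    R.ae_inv_mul_inv] with x h1 h3 h4 h5
  have e1 : F x * (F x + G x)⁻¹ * F x = (F x * τ x) * (F x * τ x).conjTranspose := by
    rw [Matrix.conjTranspose_mul, h4.eq, h1.isHermitian.eq, Matrix.mul_assoc (F x) (τ x),
      ← Matrix.mul_assoc (τ x), h5]
    simp only [Pi.add_apply, Matrix.mul_assoc]
  rw [mul_inv_mul_eq h3, e1, Matrix.sub_apply, Matrix.mul_apply (M := F x * τ x)]
  rfl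

/-- This is the image in L² of the unconstrained optimum AᵀF(F+G)⁻¹, because F(F+G)⁻¹σ = Fτ.
Boundedness of A suffices. -/
lemma memLp_centre (ha : Summable fun j : functionalIndex S => ∑ k : Fin T, ‖a j k‖)
    (hF : IsSpectralDensity F) (hG : IsSpectralDensity G)
    (hmin : Minimality (F + G)) (R : IsRoot (F + G) σ τ) :
    MemLp (emb (fun x => F x * τ x) (symbolA S a)) 2 period :=
  memLp_emb_of_bound (memLp_mul_inv_root hF hG hmin R)
    (fun i => (continuous_symbolA ha i).aestronglyMeasurable) (norm_symbolA_le ha)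

/-- The part `(2π)⁻¹ ∫ Aᵀ F (F+G)⁻¹ G conj A` of the error that does not depend on the
estimate, without the factor `(2π)⁻¹`. -/
def residual (S : Set ℤ) (a : ℤ → Fin T → ℂ) (F G : ℝ → Matrix (Fin T) (Fin T) ℂ) : ℝ :=
  ∫ x, (Matrix.vecMul (symbolA S a x) (F x * (F x + G x)⁻¹ * G x) ⬝ᵥ
    star (symbolA S a x)).re ∂period

lemma integrable_residual (ha : Summable fun j : functionalIndex S => ∑ k : Fin T, ‖a j k‖)
    (hF : IsSpectralDensity F) (hG : IsSpectralDensity G)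
    (hmin : Minimality (F + G)) (R : IsRoot (F + G) σ τ) :
    Integrable (fun x => Matrix.vecMul (symbolA S a x) (F x * (F x + G x)⁻¹ * G x) ⬝ᵥ
      star (symbolA S a x)) period := by
  have h := integrable_vecMul_symbolA ha (integrable_mul_inv_mul hF hG hmin R)
  simp only [dotProduct]
  refine integrable_finsetSum _ fun i _ => ?_
  refine (h i).mul_bdd (c := ∑' j : functionalIndex S, ∑ k : Fin T, ‖a j k‖)
      (continuous_symbolA ha i).star.aestronglyMeasurable
      (Eventually.of_forall fun x => ?_)
  simpa using norm_symbolA_le ha x i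

lemma residual_nonneg (hF : IsSpectralDensity F) (hG : IsSpectralDensity G)
    (hmin : Minimality (F + G)) : 0 ≤ residual S a F G := by
  refine integral_nonneg_of_ae ?_
  filter_upwards [hF.posSemidef, hG.posSemidef, hmin.isUnit] with x h1 h2 h3
  exact re_form_nonneg (posSemidef_mul_inv_mul h1 h2 h3) _

lemma aemeasurable_form {W : ℝ → Matrix (Fin T) (Fin T) ℂ} {v : ℝ → Fin T → ℂ}
    (hW : ∀ i j, AEStronglyMeasurable (fun x => W x i j) period)
    (hv : AEStronglyMeasurable v period) :
    AEMeasurable (fun x => ENNReal.ofReal (Matrix.vecMul (v x) (W x) ⬝ᵥ star (v x)).re) period := by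
  have hv' := aestronglyMeasurable_pi_iff.1 hv
  have h1 : AEStronglyMeasurable (fun x => Matrix.vecMul (v x) (W x) ⬝ᵥ star (v x)) period := by
    simp only [dotProduct]
    exact Finset.aestronglyMeasurable_fun_sum _ fun i _ =>
      (aestronglyMeasurable_vecMul hv' hW i).mul (hv' i).star
  exact ENNReal.measurable_ofReal.comp_aemeasurable
    (Complex.measurable_re.comp_aemeasurable h1.aemeasurable)

/-- Integrated form of the completed square: minimising the error over estimates becomes a
projection problem for ξ. -/
lemma mse_eq (ha : Summable fun j : functionalIndex S => ∑ k : Fin T, ‖a j k‖)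
    (hF : IsSpectralDensity F) (hG : IsSpectralDensity G)
    (hmin : Minimality (F + G)) (R : IsRoot (F + G) σ τ) {h : ℝ → Fin T → ℂ}
    (hm : AEStronglyMeasurable h period) {φ ξ : Lp (EuclideanSpace ℂ (Fin T)) 2 period}
    (hφ : φ =ᵐ[period] emb σ h)
    (hξ : ξ =ᵐ[period] emb (fun x => F x * τ x) (symbolA S a)) :
    mse S a h F G = ENNReal.ofReal (1 / (2 * Real.pi) * (‖φ - ξ‖ ^ 2 + residual S a F G)) := by
  rw [mse, ENNReal.ofReal_mul (by positivity)]
  congr 1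
  have hA : AEStronglyMeasurable (symbolA S a) period :=
    aestronglyMeasurable_pi_iff.2 fun i => (continuous_symbolA ha i).aestronglyMeasurable
  have hre : Integrable (fun x => (Matrix.vecMul (symbolA S a x) (F x * (F x + G x)⁻¹ * G x) ⬝ᵥ
    star (symbolA S a x)).re) period := (integrable_residual ha hF hG hmin R).re
  rw [quad, quad, ← lintegral_add_left'
    (aemeasurable_form (fun i j => (hF.integrable i j).1) (hA.sub hm)),
    ENNReal.ofReal_add (by positivity) (residual_nonneg hF hG hmin), residual, ← lintegral_norm_sq_Lp,
    ofReal_integral_eq_lintegral_ofReal hre ?_,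
    ← lintegral_add_left']
  · refine lintegral_congr_ae ?_
    filter_upwards [hF.posSemidef, hG.posSemidef, hmin.isUnit, R.norm_emb_sq, R.ae_inv_mul_inv,
      R.ae_inv_mul_root, hφ, hξ, Lp.coeFn_sub φ ξ] with x h1 h2 h3 h4 h5 h6 h7 h8 h9
    have e1 : F x * τ x = F x * (F x + G x)⁻¹ * σ x := by
      have : (F x + G x)⁻¹ = τ x * τ x := h5.symm
      rw [this, Matrix.mul_assoc, Matrix.mul_assoc, h6, Matrix.mul_one]
    have e2 : (φ - ξ : Lp (EuclideanSpace ℂ (Fin T)) 2 period) x =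
        emb σ (fun y => h y - Matrix.vecMul (symbolA S a y) (F y * (F y + G y)⁻¹)) x := by
      rw [h9, Pi.sub_apply, h7, h8]
      simp only [emb, e1, Matrix.sub_vecMul, Matrix.vecMul_vecMul, WithLp.toLp_sub]
    have e3 := congrArg Complex.re
      (error_decomposition h1.isHermitian h2.isHermitian h3 (symbolA S a x) (h x))
    rw [Complex.add_re, Complex.add_re] at e3
    rw [e2, h4]
    simp only [Pi.sub_apply]
    rw [← ENNReal.ofReal_add (re_form_nonneg h1 _) (re_form_nonneg h2 _), e3,
      ENNReal.ofReal_add (re_form_nonneg (h1.add h2) _)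
      (re_form_nonneg (posSemidef_mul_inv_mul h1 h2 h3) _)]
    rfl
  · exact (ENNReal.measurable_ofReal.comp_aemeasurable
      ((Lp.memLp (φ - ξ)).1.norm.pow 2).aemeasurable)
  · filter_upwards [hF.posSemidef, hG.posSemidef, hmin.isUnit] with x h1 h2 h3
    exact re_form_nonneg (posSemidef_mul_inv_mul h1 h2 h3) _

end Estimation

/-! ### The Pythagorean identity for estimates -/

section Pythagoras

variable {T : ℕ} {S : Set ℤ} {a : ℤ → Fin T → ℂ} {F G σ τ : ℝ → Matrix (Fin T) (Fin T) ℂ}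

/-- The error of any admissible estimate exceeds the error of the projection by the squared
distance between them. -/
lemma mse_eq_add (ha : Summable fun j : functionalIndex S => ∑ k : Fin T, ‖a j k‖)
    (hF : IsSpectralDensity F) (hG : IsSpectralDensity G)
    (hmin : Minimality (F + G)) (R : IsRoot (F + G) σ τ)
    {ξ : Lp (EuclideanSpace ℂ (Fin T)) 2 period}
    (hξ : ξ =ᵐ[period] emb (fun x => F x * τ x) (symbolA S a)) {h g : ℝ → Fin T → ℂ}
    (hm : AEStronglyMeasurable h period)
    (hh : (expoSpan σ (observed S)).starProjection ξ =ᵐ[period] emb σ h)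
    (hg : MemL2s S (F + G) g) :
    mse S a g F G =
      mse S a h F G + ENNReal.ofReal (1 / (2 * Real.pi)) * quad (F + G) (g - h) := by
  obtain ⟨hgm, φ, hφ, hφg⟩ := R.memL2s_iff.1 hg
  set K := expoSpan σ (observed S)
  have h1 : (φ - K.starProjection ξ : Lp (EuclideanSpace ℂ (Fin T)) 2 period) =ᵐ[period]
      emb σ (g - h) := by
    filter_upwards [Lp.coeFn_sub φ (K.starProjection ξ), hφg, hh] with x h1 h2 h3
    rw [h1, Pi.sub_apply, h2, h3, emb_sub]
  rw [mse_eq ha hF hG hmin R hgm hφg hξ, mse_eq ha hF hG hmin R hm hh hξ, R.quad_eq h1,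
    ← ENNReal.ofReal_mul (by positivity),
    ← ENNReal.ofReal_add (mul_nonneg (by positivity)
      (add_nonneg (by positivity) (residual_nonneg hF hG hmin))) (by positivity)]
  congr 1
  -- φ and the projection both lie in K, whereas ξ minus its projection is orthogonal to K.
  have horth : inner ℂ (φ - K.starProjection ξ) (K.starProjection ξ - ξ) = 0 := by
    rw [← neg_sub ξ, inner_neg_right, neg_eq_zero]
    exact K.sub_starProjection_mem_orthogonal ξ _
      (Submodule.sub_mem _ hφ (Submodule.starProjection_apply_mem K ξ))
  have h2 := norm_add_sq_eq_norm_sq_add_norm_sq_of_inner_eq_zero _ _ horth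
  rw [sub_add_sub_cancel] at h2
  rw [← sq, ← sq, ← sq] at h2
  rw [h2]
  ring

lemma mse_ne_top (ha : Summable fun j : functionalIndex S => ∑ k : Fin T, ‖a j k‖)
    (hF : IsSpectralDensity F) (hG : IsSpectralDensity G)
    (hmin : Minimality (F + G)) {g : ℝ → Fin T → ℂ}
    (hg : MemL2s S (F + G) g) : mse S a g F G ≠ ⊤ := by
  obtain ⟨σ, τ, R⟩ := exists_isRoot (P := F + G)
    ⟨fun i j => (hF.integrable i j).add (hG.integrable i j), by
      filter_upwards [hF.posSemidef, hG.posSemidef] with x h1 h2 using h1.add h2⟩ hmin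
  obtain ⟨hgm, φ, hφ, hφg⟩ := R.memL2s_iff.1 hg
  rw [mse_eq ha hF hG hmin R hgm hφg (memLp_centre ha hF hG hmin R).coeFn_toLp]
  exact ENNReal.ofReal_ne_top

lemma memL2s_of_starProjection (R : IsRoot (F + G) σ τ)
    {ξ : Lp (EuclideanSpace ℂ (Fin T)) 2 period} {h : ℝ → Fin T → ℂ}
    (hm : AEStronglyMeasurable h period)
    (hh : (expoSpan σ (observed S)).starProjection ξ =ᵐ[period] emb σ h) :
    MemL2s S (F + G) h :=
  R.memL2s_iff.2 ⟨hm, _, Submodule.starProjection_apply_mem _ _, hh⟩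

end Pythagoras

/-! ### The inverse of `B` as a projection -/

section Series

variable {T : ℕ} {S : Set ℤ}

/-- The trigonometric polynomial `∑_k c(k) e^{ikx}`. -/
def seriesPoly (T : ℕ) (S : Set ℤ) : (unobserved S →₀ (Fin T → ℂ)) →ₗ[ℂ] (ℝ → Fin T → ℂ) :=
  Finsupp.lsum ℂ fun k : unobserved S =>
    { toFun := fun v x => expo k x • v
      map_add' := fun v w => by ext; simp [mul_add]
      map_smul' := fun c v => by ext; simp; ring }

lemma seriesPoly_apply (u : unobserved S →₀ (Fin T → ℂ)) (x : ℝ) (i : Fin T) :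
    seriesPoly T S u x i = ∑ k ∈ u.support, expo k x * u k i := by
  simp [seriesPoly, Finsupp.sum, Finset.sum_apply]

lemma seriesPoly_mem (u : unobserved S →₀ (Fin T → ℂ)) :
    seriesPoly T S u ∈ expoPolys T (unobserved S) := by
  have h1 : seriesPoly T S u = ∑ k ∈ u.support, ∑ i : Fin T,
      u k i • fun x => (Pi.single i (expo k x) : Fin T → ℂ) := by
    ext x l
    rw [seriesPoly_apply]
    simp only [Finset.sum_apply, Pi.smul_apply, smul_eq_mul]
    refine Finset.sum_congr rfl fun k _ => ?_
    rw [Finset.sum_eq_single l]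
    · simp [mul_comm]
    · intro j _ hj
      simp [hj.symm]
    · simp
  rw [h1]
  exact Submodule.sum_mem _ fun k _ => Submodule.sum_mem _ fun i _ =>
    Submodule.smul_mem _ _ (Submodule.subset_span ⟨k, k.2, i, rfl⟩)

lemma exists_seriesPoly_eq {p : ℝ → Fin T → ℂ} (hp : p ∈ expoPolys T (unobserved S)) :
    ∃ u, seriesPoly T S u = p := by
  have hle : expoPolys T (unobserved S) ≤ LinearMap.range (seriesPoly T S) := by
    rw [expoPolys, Submodule.span_le]
    rintro _ ⟨n, hn, k, rfl⟩
    refine ⟨Finsupp.single ⟨n, hn⟩ (Pi.single k 1), ?_⟩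
    ext x i
    rw [seriesPoly, Finsupp.lsum_single]
    by_cases h : i = k
    · subst h
      simp
    · simp [h]
  exact hle hp

lemma coeff_seriesPoly (u : unobserved S →₀ (Fin T → ℂ)) (i : Fin T) (k : unobserved S) :
    coeff (fun x => seriesPoly T S u x i) k = u k i := by
  simp only [seriesPoly_apply]
  rw [coeff_sum _ fun k _ => (integrable_expo _).mul_const _]
  simp only [coeff_mul_const]
  rw [Finset.sum_eq_single k]
  · simp [coeff_expo_self]
  · intro j _ hj
    rw [coeff_expo_of_ne (fun h' => hj (Subtype.ext h')), zero_mul]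
  · intro h'
    rw [Finsupp.notMem_support_iff.1 h']
    simp

lemma coeff_seriesPoly_of_notMem (u : unobserved S →₀ (Fin T → ℂ)) (i : Fin T) {n : ℤ}
    (hn : n ∉ unobserved S) : coeff (fun x => seriesPoly T S u x i) n = 0 := by
  simp only [seriesPoly_apply]
  rw [coeff_sum _ fun k _ => (integrable_expo _).mul_const _]
  simp only [coeff_mul_const]
  refine Finset.sum_eq_zero fun k _ => ?_
  rw [coeff_expo_of_ne (show (k : ℤ) ≠ n from fun h' => hn (h' ▸ k.2)), zero_mul]

lemma pairing_coeff {f : ℝ → Fin T → ℂ} (hf : ∀ i, Integrable (fun x => f x i) period)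
    (u : unobserved S →₀ (Fin T → ℂ)) :
    2 * Real.pi * pairing (fun (k : unobserved S) i => coeff (fun x => f x i) k) u =
      ∫ x, f x ⬝ᵥ star (seriesPoly T S u x) ∂period := by
  have h1 : ∀ x, f x ⬝ᵥ star (seriesPoly T S u x) =
      ∑ k ∈ u.support, ∑ i, star (u k i) * (f x i * expo (-(k : ℤ)) x) := fun x => by
    rw [Finset.sum_comm]
    simp only [dotProduct, Pi.star_apply, seriesPoly_apply, star_sum, star_mul', star_expo,
      Finset.mul_sum]
    exact Finset.sum_congr rfl fun i _ => Finset.sum_congr rfl fun k _ => by ring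
  have h2 : ∀ (k : unobserved S) i,
      Integrable (fun x => star (u k i) * (f x i * expo (-(k : ℤ)) x)) period := fun k i =>
    (Integrable.mul_expo (hf i) _).const_mul _
  simp only [h1]
  rw [integral_finsetSum _ fun k _ => integrable_finsetSum _ fun i _ => h2 k i, pairing,
    Finsupp.sum, Finset.mul_sum]
  refine Finset.sum_congr rfl fun k _ => ?_
  rw [integral_finsetSum _ fun i _ => h2 k i, dotProduct, Finset.mul_sum]
  refine Finset.sum_congr rfl fun i _ => ?_
  rw [integral_const_mul, integral_mul_expo, Pi.star_apply]
  ring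

variable {F G σ τ : ℝ → Matrix (Fin T) (Fin T) ℂ}

/-- The Fourier coefficients of `φ τ`, for the frequencies in `U`. -/
def unobservedCoeff (S : Set ℤ) (τ : ℝ → Matrix (Fin T) (Fin T) ℂ)
    (φ : Lp (EuclideanSpace ℂ (Fin T)) 2 period) (k : unobserved S) (i : Fin T) : ℂ :=
  coeff (fun x => Matrix.vecMul (φ x) (τ x) i) k

/-- B is multiplication by (F+G)⁻¹ compressed to the frequencies in U, and (F+G)⁻¹ = τ·τ: one factor
embeds the polynomial in L², the other enters the coefficient functional. -/
lemma applyB_eq (hmin : Minimality (F + G)) (R : IsRoot (F + G) σ τ)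
    {u : unobserved S →₀ (Fin T → ℂ)} {ψ : Lp (EuclideanSpace ℂ (Fin T)) 2 period}
    (hψ : ψ =ᵐ[period] emb τ (seriesPoly T S u)) :
    applyB F G u = unobservedCoeff S τ ψ := by
  ext k i
  have h1 : (fun x => Matrix.vecMul (ψ x) (τ x) i) =ᵐ[period]
      fun x => ∑ j ∈ u.support, ∑ l, u j l * (expo j x * (F x + G x)⁻¹ l i) := by
    filter_upwards [hψ, R.ae_inv_mul_inv] with x h1 h2
    rw [h1, emb]
    simp only [Matrix.vecMul_vecMul, h2, Pi.add_apply]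
    simp only [Matrix.vecMul, dotProduct, seriesPoly_apply, Finset.sum_mul]
    rw [Finset.sum_comm]
    exact Finset.sum_congr rfl fun j _ => Finset.sum_congr rfl fun l _ => by ring
  have h2 : ∀ (j : unobserved S) l,
      Integrable (fun x => u j l * (expo j x * (F x + G x)⁻¹ l i)) period := fun j l =>
    (Integrable.expo_mul (hmin.integrable_inv l i) _).const_mul _
  rw [unobservedCoeff, coeff_congr h1,
    coeff_sum _ fun j _ => integrable_finsetSum _ fun l _ => h2 j l, applyB, Finsupp.sum,
    Finset.sum_apply]
  refine Finset.sum_congr rfl fun j _ => ?_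
  rw [coeff_sum _ fun l _ => h2 j l]
  simp only [Matrix.vecMul, dotProduct, blockB, matCoeff, Matrix.of_apply]
  refine Finset.sum_congr rfl fun l _ => ?_
  rw [coeff_const_mul, coeff_expo_mul]

lemma pairing_unobservedCoeff (R : IsRoot (F + G) σ τ)
    (φ : Lp (EuclideanSpace ℂ (Fin T)) 2 period)
    {u : unobserved S →₀ (Fin T → ℂ)} {ψ : Lp (EuclideanSpace ℂ (Fin T)) 2 period}
    (hψ : ψ =ᵐ[period] emb τ (seriesPoly T S u)) :
    2 * Real.pi * pairing (unobservedCoeff S τ φ) u = inner ℂ ψ φ := by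
  refine (pairing_coeff (integrable_vecMul (memLp_coord φ) R.memLp_inv) u).trans ?_
  rw [L2.inner_def]
  refine integral_congr_ae ?_
  filter_upwards [R.ae_isHermitian_inv, hψ] with x h1 h2
  rw [h2, EuclideanSpace.inner_eq_star_dotProduct, emb, dotProduct_star_vecMul h1]

lemma exists_emb_seriesPoly (R : IsRoot (F + G) σ τ) (u : unobserved S →₀ (Fin T → ℂ)) :
    ∃ ψ ∈ expoSpan τ (unobserved S), ψ =ᵐ[period] emb τ (seriesPoly T S u) := by
  obtain ⟨ψ, hψ, h⟩ := exists_mem_span_of_mem_expoPolys R.memLp_inv (seriesPoly_mem u)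
  exact ⟨ψ, Submodule.le_topologicalClosure _ hψ, h⟩

lemma tendsto_coeff_vecMul {M : ℝ → Matrix (Fin T) (Fin T) ℂ}
    (hM : ∀ i j, MemLp (fun x => M x i j) 2 period)
    (hMh : ∀ᵐ x ∂period, (M x).IsHermitian)
    {ψ : ℕ → Lp (EuclideanSpace ℂ (Fin T)) 2 period} {κ : Lp (EuclideanSpace ℂ (Fin T)) 2 period}
    (h : Tendsto ψ atTop (𝓝 κ)) (n : ℤ) (i : Fin T) :
    Tendsto (fun m => coeff (fun x => Matrix.vecMul (ψ m x) (M x) i) n) atTop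
      (𝓝 (coeff (fun x => Matrix.vecMul (κ x) (M x) i) n)) := by
  have hpi : (2 * Real.pi : ℂ) ≠ 0 := by simp [Real.pi_ne_zero]
  obtain ⟨u, -, hu⟩ := exists_mem_expoRows hM (Set.mem_univ n) i
  have h1 : ∀ φ : Lp (EuclideanSpace ℂ (Fin T)) 2 period,
      coeff (fun x => Matrix.vecMul (φ x) (M x) i) n = (2 * Real.pi : ℂ)⁻¹ * inner ℂ u φ :=
    fun φ => by rw [inner_expoRow hMh hu, inv_mul_cancel_left₀ hpi]
  simp only [h1]
  exact (((continuous_const.inner continuous_id).tendsto κ).comp h).const_mul _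

/-- Equality of the coefficients over U says that ξ - κ is orthogonal to every generator of the
span. -/
lemma eq_starProjection_of_unobservedCoeff (R : IsRoot (F + G) σ τ)
    {ξ κ : Lp (EuclideanSpace ℂ (Fin T)) 2 period} (hκ : κ ∈ expoSpan τ (unobserved S))
    (h : unobservedCoeff S τ κ = unobservedCoeff S τ ξ) :
    κ = (expoSpan τ (unobserved S)).starProjection ξ := by
  refine (Submodule.eq_starProjection_of_mem_orthogonal hκ ?_).symm
  rw [mem_expoSpan_orthogonal R.memLp_inv R.ae_isHermitian_inv]
  intro n hn k
  have h1 := congrFun (congrFun h ⟨n, hn⟩) k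
  have h2 : (fun x => Matrix.vecMul ((ξ - κ : Lp (EuclideanSpace ℂ (Fin T)) 2 period) x) (τ x) k)
      =ᵐ[period] fun x => Matrix.vecMul (ξ x) (τ x) k - Matrix.vecMul (κ x) (τ x) k := by
    filter_upwards [Lp.coeFn_sub ξ κ] with x hx
    rw [hx, Pi.sub_apply, WithLp.ofLp_sub, Matrix.sub_vecMul, Pi.sub_apply]
  rw [coeff_congr h2, coeff_sub (integrable_vecMul (memLp_coord ξ) R.memLp_inv k)
    (integrable_vecMul (memLp_coord κ) R.memLp_inv k)]
  exact sub_eq_zero.2 h1.symm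

/-- Sequences that approximate `B⁻¹ y` converge, in `L₂((F+G)⁻¹)`, to the projection on the
functions with unobserved frequencies. -/
lemma approximatesInverse_iff (hmin : Minimality (F + G)) (R : IsRoot (F + G) σ τ)
    {ξ : Lp (EuclideanSpace ℂ (Fin T)) 2 period} {u : ℕ → (unobserved S →₀ (Fin T → ℂ))}
    {ψ : ℕ → Lp (EuclideanSpace ℂ (Fin T)) 2 period}
    (hψ : ∀ n, ψ n =ᵐ[period] emb τ (seriesPoly T S (u n)))
    (hψm : ∀ n, ψ n ∈ expoSpan τ (unobserved S)) :
    ApproximatesInverse F G (unobservedCoeff S τ ξ) u ↔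
      Tendsto ψ atTop (𝓝 ((expoSpan τ (unobserved S)).starProjection ξ)) := by
  have hpi : (2 * Real.pi : ℂ) ≠ 0 := by simp [Real.pi_ne_zero]
  -- The form of B is, up to 2π, the squared L² norm of the embedded polynomial, so Cauchy for B
  -- means Cauchy in L².
  have hform : ∀ m n, (pairing (applyB F G (u m - u n)) (u m - u n)).re =
      (2 * Real.pi)⁻¹ * ‖ψ m - ψ n‖ ^ 2 := fun m n => by
    have h1 : (ψ m - ψ n : Lp (EuclideanSpace ℂ (Fin T)) 2 period) =ᵐ[period]
        emb τ (seriesPoly T S (u m - u n)) := by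
      filter_upwards [Lp.coeFn_sub (ψ m) (ψ n), hψ m, hψ n] with x h1 h2 h3
      rw [h1, Pi.sub_apply, h2, h3, map_sub, emb_sub]
    rw [applyB_eq hmin R h1]
    have h2 := pairing_unobservedCoeff R (ψ m - ψ n) h1
    rw [inner_self_eq_norm_sq_to_K] at h2
    have h3 : pairing (unobservedCoeff S τ (ψ m - ψ n)) (u m - u n) =
        (((2 * Real.pi)⁻¹ * ‖ψ m - ψ n‖ ^ 2 : ℝ) : ℂ) := by
      rw [eq_comm]
      push_cast
      rw [inv_mul_eq_iff_eq_mul₀ hpi, h2]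
      rfl
    rw [h3, Complex.ofReal_re]
  have happ : ∀ n, applyB F G (u n) = unobservedCoeff S τ (ψ n) := fun n => applyB_eq hmin R (hψ n)
  constructor
  · rintro ⟨hc, hl⟩
    have hcauchy : CauchySeq ψ := by
      refine Metric.cauchySeq_iff.2 fun ε hε => ?_
      obtain ⟨n₀, hn₀⟩ := hc ((2 * Real.pi)⁻¹ * ε ^ 2) (by positivity)
      refine ⟨n₀, fun m hm n hn => ?_⟩
      have := hn₀ m hm n hn
      rw [hform, mul_lt_mul_iff_right₀ (by positivity)] at this
      rw [dist_eq_norm]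
      exact lt_of_pow_lt_pow_left₀ 2 hε.le this
    obtain ⟨κ, hκ⟩ := cauchySeq_tendsto_of_complete hcauchy
    have hκm : κ ∈ expoSpan τ (unobserved S) :=
      (Submodule.isClosed_topologicalClosure _).mem_of_tendsto hκ (Eventually.of_forall hψm)
    -- The L² limit has the prescribed coefficients over U, by continuity of each coefficient, and
    -- this determines it within the span.
    rw [← eq_starProjection_of_unobservedCoeff R hκm]
    · exact hκ
    · ext k i
      refine tendsto_nhds_unique
        (tendsto_coeff_vecMul R.memLp_inv R.ae_isHermitian_inv hκ k i) ?_
      have := tendsto_pi_nhds.1 (hl k) i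
      simp only [happ] at this
      exact this
  · intro hlim
    refine ⟨fun ε hε => ?_, fun k => ?_⟩
    · obtain ⟨n₀, hn₀⟩ := Metric.cauchySeq_iff.1 hlim.cauchySeq (√(2 * Real.pi * ε))
        (Real.sqrt_pos.2 (by positivity))
      refine ⟨n₀, fun m hm n hn => ?_⟩
      have := hn₀ m hm n hn
      rw [dist_eq_norm, Real.lt_sqrt (norm_nonneg _)] at this
      rw [hform, inv_mul_lt_iff₀ (by positivity)]
      exact this
    · simp only [happ]
      refine tendsto_pi_nhds.2 fun i => ?_
      have h1 := tendsto_coeff_vecMul R.memLp_inv R.ae_isHermitian_inv hlim k i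
      have h2 : unobservedCoeff S τ ((expoSpan τ (unobserved S)).starProjection ξ) k i =
          unobservedCoeff S τ ξ k i := by
        have h3 := (mem_expoSpan_orthogonal R.memLp_inv R.ae_isHermitian_inv).1
          ((expoSpan τ (unobserved S)).sub_starProjection_mem_orthogonal ξ) k k.2 i
        set κ := (expoSpan τ (unobserved S)).starProjection ξ
        have h4 : (fun x => Matrix.vecMul
            ((ξ - κ : Lp (EuclideanSpace ℂ (Fin T)) 2 period) x) (τ x) i)
            =ᵐ[period] fun x => Matrix.vecMul (ξ x) (τ x) i - Matrix.vecMul (κ x) (τ x) i := by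
          filter_upwards [Lp.coeFn_sub ξ κ] with x hx
          rw [hx, Pi.sub_apply, WithLp.ofLp_sub, Matrix.sub_vecMul, Pi.sub_apply]
        rw [coeff_congr h4, coeff_sub (integrable_vecMul (memLp_coord ξ) R.memLp_inv i)
          (integrable_vecMul (memLp_coord κ) R.memLp_inv i)] at h3
        exact (sub_eq_zero.1 h3).symm
      rw [← h2]
      exact h1

end Series

/-! ### The objective and the formula in terms of projections -/

section Objective

variable {T : ℕ} {S : Set ℤ} {a : ℤ → Fin T → ℂ} {F G σ τ : ℝ → Matrix (Fin T) (Fin T) ℂ}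

lemma vecRa_eq (ha : Summable fun j : functionalIndex S => ∑ k : Fin T, ‖a j k‖)
    (hF : IsSpectralDensity F) (hG : IsSpectralDensity G)
    (hmin : Minimality (F + G)) (R : IsRoot (F + G) σ τ)
    {ξ : Lp (EuclideanSpace ℂ (Fin T)) 2 period}
    (hξ : ξ =ᵐ[period] emb (fun x => F x * τ x) (symbolA S a)) :
    vecRa S a F G = unobservedCoeff S τ ξ := by
  ext k i
  have h := hasSum_vecMul_matCoeff ha (integrable_mul_inv hF hG hmin R) (k : ℤ)
  rw [vecRa]
  simp only [blockR]
  rw [h.tsum_eq, unobservedCoeff]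
  refine coeff_congr ?_ _
  filter_upwards [hξ, R.ae_inv_mul_inv] with x h1 h2
  rw [h1, emb]
  simp only [Matrix.vecMul_vecMul, Matrix.mul_assoc, h2, Pi.add_apply]

lemma formQ_eq (ha : Summable fun j : functionalIndex S => ∑ k : Fin T, ‖a j k‖)
    (hF : IsSpectralDensity F) (hG : IsSpectralDensity G)
    (hmin : Minimality (F + G)) (R : IsRoot (F + G) σ τ) :
    (formQ S a F G).re = 1 / (2 * Real.pi) * residual S a F G := by
  have hW := integrable_mul_inv_mul hF hG hmin R
  have h1 : formQ S a F G = coeff (fun x => Matrix.vecMul (symbolA S a x)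
      (F x * (F x + G x)⁻¹ * G x) ⬝ᵥ star (symbolA S a x)) 0 := by
    rw [← tsum_coeff_mul_star ha (integrable_vecMul_symbolA ha hW), formQ]
    refine tsum_congr fun k => ?_
    rw [← (hasSum_vecMul_matCoeff ha hW (-(k : ℤ))).tsum_eq]
    simp only [blockQ, sub_eq_neg_add]
  have h2 : (1 / (2 * (Real.pi : ℂ))) = ((1 / (2 * Real.pi) : ℝ) : ℂ) := by push_cast; rfl
  rw [h1, coeff, h2, Complex.re_ofReal_mul]
  simp only [neg_zero, expo_zero, mul_one]
  congr 1
  exact (integral_re (integrable_residual ha hF hG hmin R)).symm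

/-- The objective of the extremum problem is defined under the minimality condition, and it
equals the squared distance from `Aᵀ F (F+G)⁻¹` to the admissible estimates, plus the residual. -/
lemma isObjective_iff (ha : Summable fun j : functionalIndex S => ∑ k : Fin T, ‖a j k‖)
    (hF : IsSpectralDensity F) (hG : IsSpectralDensity G)
    (hmin : Minimality (F + G)) (R : IsRoot (F + G) σ τ)
    {ξ : Lp (EuclideanSpace ℂ (Fin T)) 2 period}
    (hξ : ξ =ᵐ[period] emb (fun x => F x * τ x) (symbolA S a)) (t : ℝ) :
    IsObjective S a F G t ↔ t = 1 / (2 * Real.pi) *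
      (‖(expoSpan τ (unobserved S)).starProjection ξ‖ ^ 2 + residual S a F G) := by
  have hpi : (2 * Real.pi : ℂ) ≠ 0 := by simp [Real.pi_ne_zero]
  set U := expoSpan τ (unobserved S) with hU
  set κ := U.starProjection ξ with hκ
  -- For a projection, ⟨κ, ξ⟩ = ‖κ‖²; hence ⟨Ra, B⁻¹Ra⟩ is a squared norm.
  have hκξ : inner ℂ κ ξ = ((‖κ‖ ^ 2 : ℝ) : ℂ) := by
    have h1 : inner ℂ κ (ξ - κ) = 0 :=
      U.sub_starProjection_mem_orthogonal ξ _ (Submodule.starProjection_apply_mem U ξ)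
    rw [inner_sub_right, sub_eq_zero, inner_self_eq_norm_sq_to_K] at h1
    rw [h1]
    push_cast
    rfl
  have hlim : ∀ {u : ℕ → (unobserved S →₀ (Fin T → ℂ))}
      {ψ : ℕ → Lp (EuclideanSpace ℂ (Fin T)) 2 period},
      (∀ n, ψ n =ᵐ[period] emb τ (seriesPoly T S (u n))) → Tendsto ψ atTop (𝓝 κ) →
      Tendsto (fun n => pairing (unobservedCoeff S τ ξ) (u n)) atTop
        (𝓝 ((1 / (2 * Real.pi) * ‖κ‖ ^ 2 : ℝ) : ℂ)) := by
    intro u ψ hψ h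
    have h1 : ∀ n, pairing (unobservedCoeff S τ ξ) (u n) = (2 * Real.pi : ℂ)⁻¹ * inner ℂ (ψ n) ξ :=
      fun n => by rw [← pairing_unobservedCoeff R ξ (hψ n), inv_mul_cancel_left₀ hpi]
    simp only [h1]
    have h2 := (h.inner (𝕜 := ℂ) (tendsto_const_nhds (x := ξ))).const_mul (2 * Real.pi : ℂ)⁻¹
    rw [hκξ] at h2
    convert h2 using 2
    push_cast
    rw [one_div]
  rw [IsObjective, vecRa_eq ha hF hG hmin R hξ]
  constructor
  · rintro ⟨v, ⟨u, hu, hv⟩, rfl⟩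
    choose ψ hψm hψ using fun n => exists_emb_seriesPoly R (u n)
    have h1 := (approximatesInverse_iff hmin R hψ hψm).1 hu
    rw [tendsto_nhds_unique hv (hlim hψ h1), Complex.add_re, Complex.ofReal_re,
      formQ_eq ha hF hG hmin R]
    ring
  -- The value is attained: any approximation of κ from the span of the generators consists of
  -- embedded polynomials, whose coefficients approximate B⁻¹Ra.
  · rintro rfl
    have hκm : κ ∈ U := Submodule.starProjection_apply_mem U ξ
    obtain ⟨ψ, hψs, hψ⟩ := mem_closure_iff_seq_limit.1
      (show κ ∈ closure (Submodule.span ℂ (expoRows τ (unobserved S)) : Set _) from hκm)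
    have h1 : ∀ n, ∃ u, ψ n =ᵐ[period] emb τ (seriesPoly T S u) := fun n => by
      obtain ⟨p, hp, hp'⟩ := exists_mem_expoPolys_of_mem_span (hψs n)
      obtain ⟨u, rfl⟩ := exists_seriesPoly_eq hp
      exact ⟨u, hp'⟩
    choose u hu using h1
    refine ⟨_, ⟨u, (approximatesInverse_iff hmin R hu
      fun n => Submodule.le_topologicalClosure _ (hψs n)).2 hψ, hlim hu hψ⟩, ?_⟩
    rw [Complex.add_re, Complex.ofReal_re, formQ_eq ha hF hG hmin R]
    ring

/-- Multiplication by σ undoes τ on the approximating polynomials. In the limit κσ has the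
coefficients of C over U and none outside, so κσ = C by uniqueness of Fourier coefficients. -/
lemma ae_eq_of_isSeriesC (ha : Summable fun j : functionalIndex S => ∑ k : Fin T, ‖a j k‖)
    (hF : IsSpectralDensity F) (hG : IsSpectralDensity G)
    (hmin : Minimality (F + G)) (R : IsRoot (F + G) σ τ)
    {ξ : Lp (EuclideanSpace ℂ (Fin T)) 2 period}
    (hξ : ξ =ᵐ[period] emb (fun x => F x * τ x) (symbolA S a)) {C : ℝ → Fin T → ℂ}
    (hC : IsSeriesC S a F G C) :
    (expoSpan τ (unobserved S)).starProjection ξ =ᵐ[period] emb τ C := by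
  obtain ⟨c, ⟨u, hu, huc⟩, hCi, hCU, hC0⟩ := hC
  rw [vecRa_eq ha hF hG hmin R hξ] at hu
  choose ψ hψm hψ using fun n => exists_emb_seriesPoly R (u n)
  have hlim := (approximatesInverse_iff hmin R hψ hψm).1 hu
  set κ := (expoSpan τ (unobserved S)).starProjection ξ with hκ
  have hψσ : ∀ n i, (fun x => Matrix.vecMul (ψ n x) (σ x) i) =ᵐ[period]
      fun x => seriesPoly T S (u n) x i := fun n i => by
    filter_upwards [hψ n, R.ae_inv_mul_root] with x h1 h2
    rw [h1, emb, Matrix.vecMul_vecMul, h2, Matrix.vecMul_one]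
  have hcoef : ∀ i, (fun x => Matrix.vecMul (κ x) (σ x) i) =ᵐ[period] fun x => C x i := by
    intro i
    refine ae_eq_of_coeff_eq (integrable_vecMul (memLp_coord κ) R.memLp_root i) (hCi i)
      fun n => ?_
    have h1 := tendsto_coeff_vecMul R.memLp_root R.ae_isHermitian_root hlim n i
    simp only [coeff_congr (hψσ _ i)] at h1
    refine tendsto_nhds_unique h1 ?_
    by_cases hn : n ∈ unobserved S
    · have h2 := tendsto_pi_nhds.1 (huc ⟨n, hn⟩) i
      rw [← hCU ⟨n, hn⟩ i] at h2
      refine h2.congr fun m => ?_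
      exact (coeff_seriesPoly (u m) i ⟨n, hn⟩).symm
    · simp only [coeff_seriesPoly_of_notMem _ _ hn, hC0 n hn i]
      exact tendsto_const_nhds
  filter_upwards [ae_all_iff.2 hcoef, R.ae_root_mul_inv] with x h1 h2
  have h3 : C x = Matrix.vecMul (κ x) (σ x) := (funext fun i => h1 i).symm
  rw [emb, h3, Matrix.vecMul_vecMul, h2, Matrix.vecMul_one]

/-- The spectral characteristic given by the formula is the projection of `Aᵀ F (F+G)⁻¹` on the
space of admissible estimates. -/
lemma starProjection_ae_eq_charFormula (hS : S.Finite)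
    (ha : Summable fun j : functionalIndex S => ∑ k : Fin T, ‖a j k‖)
    (hF : IsSpectralDensity F) (hG : IsSpectralDensity G)
    (hmin : Minimality (F + G)) (R : IsRoot (F + G) σ τ)
    {ξ : Lp (EuclideanSpace ℂ (Fin T)) 2 period}
    (hξ : ξ =ᵐ[period] emb (fun x => F x * τ x) (symbolA S a)) {C : ℝ → Fin T → ℂ}
    (hC : IsSeriesC S a F G C) :
    (expoSpan σ (observed S)).starProjection ξ =ᵐ[period] emb σ (charFormula S a F G C) := by
  -- By duality the projection on the observed span is the identity minus the projection on the
  -- unobserved span. These two terms are the two terms of the formula.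
  have h1 : (expoSpan σ (observed S)).starProjection ξ =
      ξ - (expoSpan τ (unobserved S)).starProjection ξ := by
    simp only [← expoSpan_observed_orthogonal R hS, Submodule.starProjection_orthogonal']
    simp
  rw [h1]
  filter_upwards [Lp.coeFn_sub ξ ((expoSpan τ (unobserved S)).starProjection ξ), hξ,
    ae_eq_of_isSeriesC ha hF hG hmin R hξ hC, R.ae_inv_mul_inv, R.ae_inv_mul_root]
    with x h1 h2 h3 h4 h5
  have h6 : (F x + G x)⁻¹ * σ x = τ x := by
    have : (F x + G x)⁻¹ = τ x * τ x := h4.symm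
    rw [this, Matrix.mul_assoc, h5, Matrix.mul_one]
  rw [h1, Pi.sub_apply, h2, h3]
  simp only [emb, charFormula, Matrix.sub_vecMul, Matrix.vecMul_vecMul, Matrix.mul_assoc, h6,
    WithLp.toLp_sub]

lemma aestronglyMeasurable_charFormula
    (ha : Summable fun j : functionalIndex S => ∑ k : Fin T, ‖a j k‖)
    (hF : IsSpectralDensity F) (hmin : Minimality (F + G)) {C : ℝ → Fin T → ℂ}
    (hC : IsSeriesC S a F G C) : AEStronglyMeasurable (charFormula S a F G C) period := by
  obtain ⟨c, -, hCi, -, -⟩ := hC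
  refine AEStronglyMeasurable.sub ?_ ?_
  · exact aestronglyMeasurable_pi_iff.2 fun j => aestronglyMeasurable_vecMul
      (fun i => (continuous_symbolA ha i).aestronglyMeasurable)
      (aestronglyMeasurable_mul (fun i j => (hF.integrable i j).1)
        (fun i j => (hmin.integrable_inv i j).1)) j
  · exact aestronglyMeasurable_pi_iff.2 fun j => aestronglyMeasurable_vecMul
      (fun i => (hCi i).1) (fun i j => (hmin.integrable_inv i j).1) j

end Objective

/-! ### Optimal estimates and the minimal error -/

section Optimal

variable {T : ℕ} {S : Set ℤ} {a : ℤ → Fin T → ℂ} {F G : ℝ → Matrix (Fin T) (Fin T) ℂ}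

lemma IsSpectralDensity.add (hF : IsSpectralDensity F) (hG : IsSpectralDensity G) :
    IsSpectralDensity (F + G) :=
  ⟨fun i j => (hF.integrable i j).add (hG.integrable i j), by
    filter_upwards [hF.posSemidef, hG.posSemidef] with x h1 h2 using h1.add h2⟩

/-- `h` is an estimate relative to which the errors of all estimates satisfy the Pythagorean
identity. -/
structure IsProjection (S : Set ℤ) (a : ℤ → Fin T → ℂ) (F G : ℝ → Matrix (Fin T) (Fin T) ℂ)
    (h : ℝ → Fin T → ℂ) : Prop where
  memL2s : MemL2s S (F + G) h
  mse_eq_add : ∀ g, MemL2s S (F + G) g →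
    mse S a g F G = mse S a h F G + ENNReal.ofReal (1 / (2 * Real.pi)) * quad (F + G) (g - h)

lemma IsProjection.isOptimal {h : ℝ → Fin T → ℂ} (hh : IsProjection S a F G h) :
    IsOptimal S a F G h :=
  ⟨hh.memL2s, fun g hg => by rw [hh.mse_eq_add g hg]; exact le_self_add⟩

/-- By duality, ξ minus its projection on the observed span is its projection on the unobserved
span, whose squared norm is the one in the objective. -/
lemma mse_eq_ofReal_objective (hS : S.Finite) {σ τ : ℝ → Matrix (Fin T) (Fin T) ℂ}
    (ha : Summable fun j : functionalIndex S => ∑ k : Fin T, ‖a j k‖)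
    (hF : IsSpectralDensity F) (hG : IsSpectralDensity G)
    (hmin : Minimality (F + G)) (R : IsRoot (F + G) σ τ)
    {ξ : Lp (EuclideanSpace ℂ (Fin T)) 2 period}
    (hξ : ξ =ᵐ[period] emb (fun x => F x * τ x) (symbolA S a)) {h : ℝ → Fin T → ℂ}
    (hm : AEStronglyMeasurable h period)
    (hh : (expoSpan σ (observed S)).starProjection ξ =ᵐ[period] emb σ h) {t : ℝ}
    (ht : IsObjective S a F G t) : mse S a h F G = ENNReal.ofReal t := by
  rw [mse_eq ha hF hG hmin R hm hh hξ, (isObjective_iff ha hF hG hmin R hξ t).1 ht]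
  simp only [← expoSpan_observed_orthogonal R hS, Submodule.starProjection_orthogonal']
  rw [← norm_neg, neg_sub]
  rfl

/-- The projection is pulled back through τ, so no integrable series C is needed. This serves the
convex combinations, for which no C is given. -/
lemma exists_isProjection (hS : S.Finite)
    (ha : Summable fun j : functionalIndex S => ∑ k : Fin T, ‖a j k‖)
    (hF : IsSpectralDensity F) (hG : IsSpectralDensity G) (hmin : Minimality (F + G)) :
    ∃ h t, IsProjection S a F G h ∧ IsObjective S a F G t ∧ mse S a h F G = ENNReal.ofReal t := by
  obtain ⟨σ, τ, R⟩ := exists_isRoot (hF.add hG) hmin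
  have hξ := (memLp_centre ha hF hG hmin R).coeFn_toLp
  set ξ := (memLp_centre ha hF hG hmin R).toLp
  have hh := R.emb_unemb ((expoSpan σ (observed S)).starProjection ξ)
  have hm := R.aestronglyMeasurable_unemb ((expoSpan σ (observed S)).starProjection ξ)
  have ht := (isObjective_iff ha hF hG hmin R hξ _).2 rfl
  exact ⟨_, _, ⟨memL2s_of_starProjection R hm hh,
    fun g hg => mse_eq_add ha hF hG hmin R hξ hm hh hg⟩, ht,
    mse_eq_ofReal_objective hS ha hF hG hmin R hξ hm hh ht⟩

lemma isProjection_charFormula (hS : S.Finite)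
    (ha : Summable fun j : functionalIndex S => ∑ k : Fin T, ‖a j k‖)
    (hF : IsSpectralDensity F) (hG : IsSpectralDensity G) (hmin : Minimality (F + G))
    {C : ℝ → Fin T → ℂ} (hC : IsSeriesC S a F G C) :
    IsProjection S a F G (charFormula S a F G C) ∧
      ∀ t, IsObjective S a F G t → mse S a (charFormula S a F G C) F G = ENNReal.ofReal t := by
  obtain ⟨σ, τ, R⟩ := exists_isRoot (hF.add hG) hmin
  have hξ := (memLp_centre ha hF hG hmin R).coeFn_toLp
  have hm := aestronglyMeasurable_charFormula ha hF hmin hC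
  have hh := starProjection_ae_eq_charFormula hS ha hF hG hmin R hξ hC
  exact ⟨⟨memL2s_of_starProjection R hm hh, fun g hg => mse_eq_add ha hF hG hmin R hξ hm hh hg⟩,
    fun t ht => mse_eq_ofReal_objective hS ha hF hG hmin R hξ hm hh ht⟩

end Optimal

/-! ### Convex combinations of densities -/

section Mix

variable {T : ℕ}

/-- The convex combination `(1 - ε) F + ε F'`. -/
def mix (ε : ℝ) (F F' : ℝ → Matrix (Fin T) (Fin T) ℂ) : ℝ → Matrix (Fin T) (Fin T) ℂ :=
  fun x => ((1 - ε : ℝ) : ℂ) • F x + ((ε : ℝ) : ℂ) • F' x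

lemma mix_add (ε : ℝ) (F F' G : ℝ → Matrix (Fin T) (Fin T) ℂ) :
    mix ε F F' + G = mix ε (F + G) (F' + G) := by
  ext x i j
  simp [mix]
  ring

variable {F F' G W W' : ℝ → Matrix (Fin T) (Fin T) ℂ} {ε : ℝ}

lemma isSpectralDensity_mix (h0 : 0 ≤ ε) (h1 : ε ≤ 1) (hF : IsSpectralDensity F)
    (hF' : IsSpectralDensity F') : IsSpectralDensity (mix ε F F') := by
  refine ⟨fun i j => ((hF.integrable i j).const_mul _).add ((hF'.integrable i j).const_mul _), ?_⟩
  filter_upwards [hF.posSemidef, hF'.posSemidef] with x h2 h3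
  exact (h2.smul (by exact_mod_cast sub_nonneg.2 h1)).add (h3.smul (by exact_mod_cast h0))

lemma quad_mix (h0 : 0 ≤ ε) (h1 : ε ≤ 1) (hW : IsSpectralDensity W)
    (hW' : IsSpectralDensity W') {v : ℝ → Fin T → ℂ} (hv : AEStronglyMeasurable v period) :
    quad (mix ε W W') v = ENNReal.ofReal (1 - ε) * quad W v + ENNReal.ofReal ε * quad W' v := by
  rw [quad, quad, quad, ← lintegral_const_mul' _ _ ENNReal.ofReal_ne_top,
    ← lintegral_const_mul' _ _ ENNReal.ofReal_ne_top, ← lintegral_add_left'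
    ((aemeasurable_form (fun i j => (hW.integrable i j).1) hv).const_mul _)]
  refine lintegral_congr_ae ?_
  filter_upwards [hW.posSemidef, hW'.posSemidef] with x h2 h3
  rw [← ENNReal.ofReal_mul (sub_nonneg.2 h1), ← ENNReal.ofReal_mul h0, ← ENNReal.ofReal_add
    (mul_nonneg (sub_nonneg.2 h1) (re_form_nonneg h2 _)) (mul_nonneg h0 (re_form_nonneg h3 _))]
  congr 1
  rw [mix, Matrix.vecMul_add, add_dotProduct, Matrix.vecMul_smul, Matrix.vecMul_smul,
    smul_dotProduct, smul_dotProduct, Complex.add_re, smul_eq_mul, smul_eq_mul,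
    Complex.re_ofReal_mul, Complex.re_ofReal_mul]

/-- For a fixed estimate the error is affine in F; the noise term is split with the same weights. -/
lemma mse_mix {S : Set ℤ} {a : ℤ → Fin T → ℂ}
    (ha : Summable fun j : functionalIndex S => ∑ k : Fin T, ‖a j k‖)
    (h0 : 0 ≤ ε) (h1 : ε ≤ 1) (hF : IsSpectralDensity F)
    (hF' : IsSpectralDensity F') {h : ℝ → Fin T → ℂ} (hh : AEStronglyMeasurable h period) :
    mse S a h (mix ε F F') G =
      ENNReal.ofReal (1 - ε) * mse S a h F G + ENNReal.ofReal ε * mse S a h F' G := by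
  have hA : AEStronglyMeasurable (symbolA S a) period :=
    aestronglyMeasurable_pi_iff.2 fun i => (continuous_symbolA ha i).aestronglyMeasurable
  have h2 : quad G h = ENNReal.ofReal (1 - ε) * quad G h + ENNReal.ofReal ε * quad G h := by
    rw [← add_mul, ← ENNReal.ofReal_add (sub_nonneg.2 h1) h0, sub_add_cancel,
      ENNReal.ofReal_one, one_mul]
  unfold mse
  conv_lhs => rw [quad_mix h0 h1 hF hF' (hA.sub hh), h2]
  ring

lemma measurable_inv_entry (i j : Fin T) :
    Measurable fun A : Fin T → Fin T → ℂ => (Matrix.of A)⁻¹ i j := by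
  have h1 : Continuous fun A : Fin T → Fin T → ℂ => (Matrix.of A).det :=
    Continuous.matrix_det (by fun_prop)
  have h2 : Continuous fun A : Fin T → Fin T → ℂ => (Matrix.of A).adjugate :=
    Continuous.matrix_adjugate (by fun_prop)
  have h3 : Continuous fun A : Fin T → Fin T → ℂ => (Matrix.of A).adjugate i j :=
    h2.matrix_elem i j
  simp only [Matrix.inv_def, Ring.inverse_eq_inv', Matrix.smul_apply, smul_eq_mul]
  exact h1.measurable.inv.mul h3.measurable

/-- Inversion reverses the order: with w = eB⁻¹, the difference of the two entries is the A-form of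
eA⁻¹ - w plus the (B-A)-form of w, and both are nonnegative. -/
lemma re_inv_diag_le {A B : Matrix (Fin T) (Fin T) ℂ} (hA : A.PosDef) (hB : B.PosDef)
    (hAB : (B - A).PosSemidef) (i : Fin T) : (B⁻¹ i i).re ≤ (A⁻¹ i i).re := by
  have hdA : IsUnit A.det := (Matrix.isUnit_iff_isUnit_det _).1 hA.isUnit
  have hdB : IsUnit B.det := (Matrix.isUnit_iff_isUnit_det _).1 hB.isUnit
  set e : Fin T → ℂ := Pi.single i 1 with he
  have hentry : ∀ M : Matrix (Fin T) (Fin T) ℂ, Matrix.vecMul e M ⬝ᵥ star e = M i i := fun M => by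
    rw [he, ← Pi.single_star]
    simp
  set w := Matrix.vecMul e B⁻¹ with hw
  have h1 : 0 ≤ (Matrix.vecMul (Matrix.vecMul e A⁻¹ - w) A ⬝ᵥ
      star (Matrix.vecMul e A⁻¹ - w)).re := re_form_nonneg hA.posSemidef _
  have h2 : 0 ≤ (Matrix.vecMul w (B - A) ⬝ᵥ star w).re := re_form_nonneg hAB _
  have e1 : Matrix.vecMul (Matrix.vecMul e A⁻¹) A = e := by
    rw [Matrix.vecMul_vecMul, Matrix.nonsing_inv_mul _ hdA, Matrix.vecMul_one]
  have e2 : Matrix.vecMul w B = e := by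
    rw [hw, Matrix.vecMul_vecMul, Matrix.nonsing_inv_mul _ hdB, Matrix.vecMul_one]
  have e3 : ∀ v : Fin T → ℂ, v ⬝ᵥ star (Matrix.vecMul e A⁻¹) = Matrix.vecMul v A⁻¹ ⬝ᵥ star e :=
    fun v => dotProduct_star_vecMul hA.isHermitian.inv v e
  have e4 : ∀ v : Fin T → ℂ, v ⬝ᵥ star w = Matrix.vecMul v B⁻¹ ⬝ᵥ star e :=
    fun v => dotProduct_star_vecMul hB.isHermitian.inv v e
  have e5 : Matrix.vecMul (Matrix.vecMul w A) A⁻¹ = w := by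
    rw [Matrix.vecMul_vecMul, Matrix.mul_nonsing_inv _ hdA, Matrix.vecMul_one]
  rw [form_sub_sub, e1, e3, e3, e5, e4 e, hentry] at h1
  rw [Matrix.vecMul_sub, sub_dotProduct, e2, e4 e] at h2
  rw [hw, hentry] at h1 h2
  simp only [Complex.sub_re, Complex.add_re] at h1 h2
  linarith

/-- The combination dominates (1-ε)W, so the diagonal of its inverse is at most (1-ε)⁻¹ times that
of W⁻¹. Only W has to be minimal. -/
lemma minimality_mix (h0 : 0 ≤ ε) (h1 : ε < 1) (hW : IsSpectralDensity W)
    (hW' : IsSpectralDensity W') (hmin : Minimality W) : Minimality (mix ε W W') := by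
  have hM := isSpectralDensity_mix h0 h1.le hW hW'
  have hpos : ∀ᵐ x ∂period, (mix ε W W' x).PosDef ∧
      ∀ i, ((mix ε W W' x)⁻¹ i i).re ≤ (1 - ε)⁻¹ * ((W x)⁻¹ i i).re := by
    filter_upwards [hW.posSemidef, hW'.posSemidef, hmin.isUnit] with x h2 h3 h4
    have hpd : (W x).PosDef := h2.posDef_iff_isUnit.2 h4
    have h5 : (0 : ℂ) < ((1 - ε : ℝ) : ℂ) := by exact_mod_cast sub_pos.2 h1
    have h6 : (((1 - ε : ℝ) : ℂ) • W x).PosDef := hpd.smul h5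
    have h7 : (((ε : ℝ) : ℂ) • W' x).PosSemidef := h3.smul (by exact_mod_cast h0)
    have h8 : (mix ε W W' x).PosDef := h6.add_posSemidef h7
    refine ⟨h8, fun i => ?_⟩
    have h9 := re_inv_diag_le h6 h8 (by simpa [mix] using h7) i
    refine h9.trans_eq ?_
    have hd : IsUnit (W x).det := (Matrix.isUnit_iff_isUnit_det _).1 h4
    have h10 : (((1 - ε : ℝ) : ℂ) • W x)⁻¹ = (((1 - ε)⁻¹ : ℝ) : ℂ) • (W x)⁻¹ := by
      refine Matrix.inv_eq_right_inv ?_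
      rw [Matrix.smul_mul, Matrix.mul_smul, smul_smul, Matrix.mul_nonsing_inv _ hd,
        ← Complex.ofReal_mul, mul_inv_cancel₀ (sub_pos.2 h1).ne', Complex.ofReal_one, one_smul]
    rw [h10, Matrix.smul_apply, smul_eq_mul, Complex.re_ofReal_mul]
  have hmeas : ∀ i j, AEStronglyMeasurable (fun x => (mix ε W W' x)⁻¹ i j) period := fun i j => by
    have h2 : AEMeasurable (fun x i j => mix ε W W' x i j : ℝ → Fin T → Fin T → ℂ) period :=
      aemeasurable_pi_lambda _ fun i => aemeasurable_pi_lambda _ fun j =>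
        (hM.integrable i j).1.aemeasurable
    exact ((measurable_inv_entry i j).comp_aemeasurable h2).aestronglyMeasurable
  refine ⟨hpos.mono fun x hx => hx.1.isUnit, ?_⟩
  have hdiag : ∀ i, Integrable (fun x => (mix ε W W' x)⁻¹ i i) period := fun i => by
    refine Integrable.mono ((hmin.integrable_inv i i).re.const_mul (1 - ε)⁻¹) (hmeas i i) ?_
    filter_upwards [hpos] with x hx
    have h2 := Complex.le_def.1 (hx.1.inv.posSemidef.diag_nonneg (i := i))
    have h3 : (mix ε W W' x)⁻¹ i i = ((((mix ε W W' x)⁻¹ i i).re : ℝ) : ℂ) :=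
      Complex.ext (by simp) (by simpa using h2.2.symm)
    rw [h3, Complex.norm_real, Real.norm_of_nonneg h2.1]
    exact (hx.2 i).trans (le_abs_self _)
  -- Off-diagonal entries: the root of the inverse has entries in L², because the diagonal is
  -- integrable, and products of two such entries are integrable.
  obtain ⟨f, hfm, hf⟩ := measurable_sqrt_piecewise T
  have hsm : ∀ i j, AEStronglyMeasurable (fun x => f ((mix ε W W' x)⁻¹) i j) period := fun i j => by
    have h2 : AEMeasurable (fun x i j => (mix ε W W' x)⁻¹ i j : ℝ → Fin T → Fin T → ℂ) period :=
      aemeasurable_pi_lambda _ fun i => aemeasurable_pi_lambda _ fun j => (hmeas i j).aemeasurable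
    exact ((hfm i j).comp_aemeasurable h2).aestronglyMeasurable
  have hroot : ∀ᵐ x ∂period, (f ((mix ε W W' x)⁻¹)).IsHermitian ∧
      f ((mix ε W W' x)⁻¹) * f ((mix ε W W' x)⁻¹) = (mix ε W W' x)⁻¹ :=
    hpos.mono fun x hx => hf _ hx.1.inv.posSemidef
  have hL := memLp_entry_of_mul_self hdiag hsm hroot
  intro i j
  have h3 : Integrable (fun x => ∑ k, f ((mix ε W W' x)⁻¹) i k * f ((mix ε W W' x)⁻¹) k j)
      period := integrable_finsetSum _ fun k _ => MemLp.integrable_mul_two (hL i k) (hL k j)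
  refine h3.congr (hroot.mono fun x hx => ?_)
  simp only
  rw [← Matrix.mul_apply, hx.2]

end Mix

/-! ### Limits of estimates -/

section Limits

variable {T : ℕ} {W : ℝ → Matrix (Fin T) (Fin T) ℂ}

lemma lintegral_le_of_tendsto_ae {f : ℕ → ℝ → ENNReal} {g : ℝ → ENNReal} {B : ENNReal}
    (hf : ∀ k, AEMeasurable (f k) period)
    (hlim : ∀ᵐ x ∂period, Tendsto (fun k => f k x) atTop (𝓝 (g x)))
    (hB : ∀ᶠ k in atTop, ∫⁻ x, f k x ∂period ≤ B) : ∫⁻ x, g x ∂period ≤ B :=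
  calc ∫⁻ x, g x ∂period = ∫⁻ x, liminf (fun k => f k x) atTop ∂period :=
        lintegral_congr_ae (hlim.mono fun _ hx => hx.liminf_eq.symm)
    _ ≤ liminf (fun k => ∫⁻ x, f k x ∂period) atTop := lintegral_liminf_le' hf
    _ ≤ B := liminf_le_of_frequently_le' hB.frequently

lemma tendsto_form (M : Matrix (Fin T) (Fin T) ℂ) {v : ℕ → Fin T → ℂ} {w : Fin T → ℂ}
    (h : Tendsto v atTop (𝓝 w)) :
    Tendsto (fun k => ENNReal.ofReal (Matrix.vecMul (v k) M ⬝ᵥ star (v k)).re) atTop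
      (𝓝 (ENNReal.ofReal (Matrix.vecMul w M ⬝ᵥ star w).re)) := by
  have hc : Continuous fun v : Fin T → ℂ => (Matrix.vecMul v M ⬝ᵥ star v).re := by
    refine Complex.continuous_re.comp ?_
    exact (continuous_id.matrix_vecMul continuous_const).dotProduct continuous_id.star
  exact ENNReal.tendsto_ofReal ((hc.tendsto w).comp h)

lemma quad_le_of_tendsto_ae (hW : IsSpectralDensity W) {v : ℕ → ℝ → Fin T → ℂ}
    {w : ℝ → Fin T → ℂ} (hv : ∀ k, AEStronglyMeasurable (v k) period)
    (hlim : ∀ᵐ x ∂period, Tendsto (fun k => v k x) atTop (𝓝 (w x))) {B : ENNReal}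
    (hB : ∀ᶠ k in atTop, quad W (v k) ≤ B) : quad W w ≤ B :=
  lintegral_le_of_tendsto_ae
    (fun k => aemeasurable_form (fun i j => (hW.integrable i j).1) (hv k))
    (hlim.mono fun _ hx => tendsto_form _ hx) hB

lemma mse_le_of_tendsto_ae {S : Set ℤ} {a : ℤ → Fin T → ℂ}
    (ha : Summable fun j : functionalIndex S => ∑ k : Fin T, ‖a j k‖)
    {F G : ℝ → Matrix (Fin T) (Fin T) ℂ}
    (hF : IsSpectralDensity F) (hG : IsSpectralDensity G) {v : ℕ → ℝ → Fin T → ℂ}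
    {w : ℝ → Fin T → ℂ} (hv : ∀ k, AEStronglyMeasurable (v k) period)
    (hw : AEStronglyMeasurable w period)
    (hlim : ∀ᵐ x ∂period, Tendsto (fun k => v k x) atTop (𝓝 (w x))) {B : ENNReal}
    (hB : ∀ k, mse S a (v k) F G ≤ B) : mse S a w F G ≤ B := by
  have hA : AEStronglyMeasurable (symbolA S a) period :=
    aestronglyMeasurable_pi_iff.2 fun i => (continuous_symbolA ha i).aestronglyMeasurable
  have hm : ∀ {u : ℝ → Fin T → ℂ}, AEStronglyMeasurable u period →
      AEMeasurable (fun x => ENNReal.ofReal (Matrix.vecMul ((symbolA S a - u) x) (F x) ⬝ᵥ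
        star ((symbolA S a - u) x)).re) period := fun hu =>
    aemeasurable_form (fun i j => (hF.integrable i j).1) (hA.sub hu)
  have hm' : ∀ {u : ℝ → Fin T → ℂ}, AEStronglyMeasurable u period →
      AEMeasurable (fun x => ENNReal.ofReal (Matrix.vecMul (u x) (G x) ⬝ᵥ
        star (u x)).re) period := fun hu =>
    aemeasurable_form (fun i j => (hG.integrable i j).1) hu
  have e : ∀ {u : ℝ → Fin T → ℂ}, AEStronglyMeasurable u period → mse S a u F G =
      ∫⁻ x, ENNReal.ofReal (1 / (2 * Real.pi)) * (ENNReal.ofReal (Matrix.vecMul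
        ((symbolA S a - u) x) (F x) ⬝ᵥ star ((symbolA S a - u) x)).re +
        ENNReal.ofReal (Matrix.vecMul (u x) (G x) ⬝ᵥ star (u x)).re) ∂period := fun hu => by
    rw [lintegral_const_mul' _ _ ENNReal.ofReal_ne_top, lintegral_add_left' (hm hu), mse, quad,
      quad]
  rw [e hw]
  refine lintegral_le_of_tendsto_ae (fun k => ((hm (hv k)).add (hm' (hv k))).const_mul _) ?_
    (Eventually.of_forall fun k => (e (hv k)).symm.trans_le (hB k))
  refine hlim.mono fun x hx => ?_
  exact ENNReal.Tendsto.const_mul ((tendsto_form _ (tendsto_const_nhds.sub hx)).add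
    (tendsto_form _ hx)) (Or.inr ENNReal.ofReal_ne_top)

/-- After multiplication by σ this is L² convergence, which gives convergence in measure and an
almost everywhere convergent subsequence; multiplication by τ returns to v. -/
lemma IsRoot.exists_seq_tendsto_ae {P σ τ : ℝ → Matrix (Fin T) (Fin T) ℂ} (R : IsRoot P σ τ)
    {v : ℕ → ℝ → Fin T → ℂ} (hv : ∀ k, AEStronglyMeasurable (v k) period)
    (h : Tendsto (fun k => quad P (v k)) atTop (𝓝 0)) :
    ∃ ns : ℕ → ℕ, StrictMono ns ∧
      ∀ᵐ x ∂period, Tendsto (fun k => v (ns k) x) atTop (𝓝 0) := by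
  have h1 : ∀ k, eLpNorm (emb σ (v k) - 0) 2 period = quad P (v k) ^ (1 / 2 : ℝ) := fun k => by
    rw [sub_zero, eLpNorm_eq_lintegral_rpow_enorm_toReal two_ne_zero (by simp),
      R.quad_eq_lintegral]
    simp only [ENNReal.toReal_ofNat, ENNReal.rpow_ofNat]
    congr 2
    ext x
    rw [ENNReal.ofReal_pow (norm_nonneg _), ofReal_norm]
  have h2 : TendstoInMeasure period (fun k => emb σ (v k)) atTop 0 := by
    refine tendstoInMeasure_of_tendsto_eLpNorm (p := 2) two_ne_zero
      (fun k => R.aestronglyMeasurable_emb (hv k)) aestronglyMeasurable_zero ?_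
    simp only [h1]
    simpa using h.ennrpow_const (1 / 2 : ℝ)
  obtain ⟨ns, hns, hlim⟩ := h2.exists_seq_tendsto_ae
  refine ⟨ns, hns, ?_⟩
  filter_upwards [hlim, R.ae_root_mul_inv] with x hx h3
  have hc : Continuous fun y : EuclideanSpace ℂ (Fin T) => Matrix.vecMul y.ofLp (τ x) :=
    (PiLp.continuous_ofLp 2 _).matrix_vecMul continuous_const
  have h4 := (hc.tendsto 0).comp hx
  simp only [Function.comp_def] at h4
  simpa [emb, Matrix.vecMul_vecMul, h3] using h4

lemma quad_sub_comm (v w : ℝ → Fin T → ℂ) : quad W (v - w) = quad W (w - v) := by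
  unfold quad
  congr 1
  ext x
  simp only [Pi.sub_apply, form_sub_sub]
  congr 2
  ring

lemma quad_sub_le (hW : IsSpectralDensity W) {u v w : ℝ → Fin T → ℂ}
    (hu : AEStronglyMeasurable u period) (hv : AEStronglyMeasurable v period) :
    quad W (u - w) ≤ 2 * (quad W (u - v) + quad W (v - w)) := by
  unfold quad
  rw [← lintegral_add_left' (aemeasurable_form (fun i j => (hW.integrable i j).1) (hu.sub hv)),
    ← lintegral_const_mul' _ _ (by simp)]
  refine lintegral_mono_ae (hW.posSemidef.mono fun x hx => ?_)
  have h1 : (2 : ENNReal) = ENNReal.ofReal 2 := by simp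
  rw [← ENNReal.ofReal_add (re_form_nonneg hx _) (re_form_nonneg hx _), h1,
    ← ENNReal.ofReal_mul (by norm_num)]
  refine ENNReal.ofReal_le_ofReal ?_
  -- Parallelogram inequality: nonnegativity of the form at the difference of the two increments
  -- bounds the form at their sum.
  have h2 := re_form_nonneg hx ((u - v) x - (v - w) x)
  have h3 : (u - w) x = (u - v) x - -(v - w) x := by simp
  rw [h3, form_sub_sub]
  rw [form_sub_sub] at h2
  simp only [Matrix.neg_vecMul, star_neg, neg_dotProduct, dotProduct_neg, Complex.add_re,
    Complex.sub_re, Complex.neg_re] at h2 ⊢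
  linarith

lemma aestronglyMeasurable_of_mem_observedPolys {S : Set ℤ} {p : ℝ → Fin T → ℂ}
    (hp : p ∈ observedPolys T S) : AEStronglyMeasurable p period := by
  induction hp using Submodule.span_induction with
  | mem p hp =>
    obtain ⟨n, -, k, rfl⟩ := hp
    exact aestronglyMeasurable_pi_iff.2 fun i => aestronglyMeasurable_single_expo n k i
  | zero => exact aestronglyMeasurable_zero
  | add p q _ _ hp hq => exact hp.add hq
  | smul c p _ hp => exact hp.const_smul c

/-- Membership passes to a dominated weight. No root of W is used, so W may be degenerate. -/
lemma MemL2s.of_quad_le {S : Set ℤ} {W' : ℝ → Matrix (Fin T) (Fin T) ℂ} {h : ℝ → Fin T → ℂ}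
    (hh : MemL2s S W' h) {c : ℝ} (hc : 0 < c)
    (hle : ∀ v, AEStronglyMeasurable v period → quad W v ≤ ENNReal.ofReal c * quad W' v) :
    MemL2s S W h := by
  refine ⟨hh.1, fun ε hε => ?_⟩
  have hc0 : ENNReal.ofReal c ≠ 0 := by simpa using hc
  obtain ⟨p, hp, hq⟩ := hh.2 (ε / ENNReal.ofReal c) (ENNReal.div_pos hε.ne' ENNReal.ofReal_ne_top)
  refine ⟨p, hp, (hle _ (hh.1.sub (aestronglyMeasurable_of_mem_observedPolys hp))).trans_lt ?_⟩
  rw [mul_comm]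
  exact (ENNReal.lt_div_iff_mul_lt (Or.inl hc0) (Or.inl ENNReal.ofReal_ne_top)).1 hq

/-- Closedness is proved directly from polynomial approximation, since the weight need not be
invertible. -/
lemma MemL2s.of_tendsto {S : Set ℤ} (hW : IsSpectralDensity W) {v : ℕ → ℝ → Fin T → ℂ}
    {h : ℝ → Fin T → ℂ} (hh : AEStronglyMeasurable h period) (hv : ∀ n, MemL2s S W (v n))
    (hlim : Tendsto (fun n => quad W (h - v n)) atTop (𝓝 0)) : MemL2s S W h := by
  refine ⟨hh, fun ε hε => ?_⟩
  have hε4 : 0 < ε / 4 := ENNReal.div_pos hε.ne' (by simp)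
  obtain ⟨n, hn⟩ := (hlim.eventually_lt_const hε4).exists
  obtain ⟨p, hp, hq⟩ := (hv n).2 _ hε4
  refine ⟨p, hp, (quad_sub_le hW hh (hv n).1).trans_lt ?_⟩
  have h1 : quad W (h - v n) + quad W (v n - p) < ε / 4 + ε / 4 := ENNReal.add_lt_add hn hq
  have h2 : 2 * (ε / 4 + ε / 4) = ε := by
    rw [← two_mul, ← mul_assoc, show (2 : ENNReal) * 2 = 4 by norm_num]
    exact ENNReal.mul_div_cancel (by simp) (by simp)
  rw [← h2]
  exact (ENNReal.mul_lt_mul_iff_right (by simp) (by simp)).2 h1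

end Limits

/-! ### Minimax estimates -/

section Minimax

variable {T : ℕ} {S : Set ℤ} {a : ℤ → Fin T → ℂ} {F₀ F G : ℝ → Matrix (Fin T) (Fin T) ℂ}

lemma ne_top_of_mul_ne_top {x y : ENNReal} (h : x * y ≠ ⊤) (hx : x ≠ 0) : y ≠ ⊤ := by
  rintro rfl
  exact h (ENNReal.mul_top hx)

/-- Two minimisers of `(1 - r) q₀ + r q₁` for the parameters `r = s < t` are closer, in the norm of
`q₁`, than the difference of their values of `q₁`. -/
lemma sub_le_of_regularized {s t x y x' y' α β : ℝ} (hs : 0 < s) (hst : s < t) (ht : t < 1)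
    (hα : 0 ≤ α) (hβ : 0 ≤ β)
    (h1 : (1 - t) * x' + t * y' = ((1 - t) * x + t * y) + ((1 - t) * α + t * β))
    (h2 : (1 - s) * x + s * y = ((1 - s) * x' + s * y') + ((1 - s) * α + s * β)) :
    β ≤ y' - y := by
  -- If x < x', optimality at t and at s puts the negative number x - x' under the two ratios
  -- (1-t)/t < (1-s)/s in incompatible ways.
  have hX : 0 ≤ x - x' := by
    by_contra hneg
    have hneg := not_le.1 hneg
    have e1 : t * (y' - y) ≥ (1 - t) * (x - x') := by nlinarith
    have e2 : s * (y' - y) ≤ (1 - s) * (x - x') := by nlinarith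
    nlinarith
  have e3 : t * β ≤ t * (y' - y) := by nlinarith
  exact le_of_mul_le_mul_left e3 (hs.trans hst)

/-- If the optimal error for `F₀` is not exceeded by the optimal errors for the convex combinations
of `F₀` and `F`, then the optimal estimate for `F₀` is admissible for `F`, and its error for `F` is
at most its error for `F₀`. -/
theorem memL2s_and_mse_le_of_mix
    (ha : Summable fun j : functionalIndex S => ∑ k : Fin T, ‖a j k‖)
    (hF₀ : IsSpectralDensity F₀) (hF : IsSpectralDensity F) (hG : IsSpectralDensity G)
    (hmin : Minimality (F₀ + G)) {h₀ : ℝ → Fin T → ℂ} (hh₀ : IsProjection S a F₀ G h₀)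
    (hmix : ∀ ε : ℝ, 0 < ε → ε < 1 → ∃ h, IsProjection S a (mix ε F₀ F) G h ∧
      mse S a h (mix ε F₀ F) G ≤ mse S a h₀ F₀ G) :
    MemL2s S (F + G) h₀ ∧ mse S a h₀ F G ≤ mse S a h₀ F₀ G := by
  -- The shift by 2 gives ε_n ≤ 1/2, hence 1 - ε_n ≥ 1/2, which is used when the weights for
  -- different n are compared.
  set ε : ℕ → ℝ := fun n => 1 / ((n : ℝ) + 2) with hε
  have hε0 : ∀ n, 0 < ε n := fun n => by positivity
  have hε2 : ∀ n, ε n ≤ 1 / 2 := fun n =>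
    one_div_le_one_div_of_le two_pos (by linarith [(n.cast_nonneg : (0 : ℝ) ≤ n)])
  have hε1 : ∀ n, ε n < 1 := fun n => (hε2 n).trans_lt (by norm_num)
  have hεanti : StrictAnti ε := fun n m hnm =>
    one_div_lt_one_div_of_lt (by positivity) (by
      have : (n : ℝ) < m := by exact_mod_cast hnm
      linarith)
  have hεlim : Tendsto ε atTop (𝓝 0) :=
    tendsto_const_nhds.div_atTop (tendsto_atTop_add_const_right _ _ tendsto_natCast_atTop_atTop)
  choose h hproj hle using fun n => hmix (ε n) (hε0 n) (hε1 n)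
  set P₀ := F₀ + G with hP₀
  set P := F + G with hP
  have hsP₀ : IsSpectralDensity P₀ := hF₀.add hG
  have hsP : IsSpectralDensity P := hF.add hG
  have hm : ∀ n, AEStronglyMeasurable (h n) period := fun n => (hproj n).memL2s.1
  have hm₀ : AEStronglyMeasurable h₀ period := hh₀.memL2s.1
  have hmixadd : ∀ n, mix (ε n) F₀ F + G = mix (ε n) P₀ P := fun n => mix_add _ _ _ _
  have hquad : ∀ n {v : ℝ → Fin T → ℂ}, AEStronglyMeasurable v period →
      quad (mix (ε n) P₀ P) v =
        ENNReal.ofReal (1 - ε n) * quad P₀ v + ENNReal.ofReal (ε n) * quad P v := fun n v hv =>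
    quad_mix (hε0 n).le (hε1 n).le hsP₀ hsP hv
  have hmse : ∀ n {v : ℝ → Fin T → ℂ}, AEStronglyMeasurable v period →
      mse S a v (mix (ε n) F₀ F) G =
        ENNReal.ofReal (1 - ε n) * mse S a v F₀ G + ENNReal.ofReal (ε n) * mse S a v F G :=
    fun n v hv => mse_mix ha (hε0 n).le (hε1 n).le hF₀ hF hv
  have hc1 : ∀ n, 0 < ENNReal.ofReal (1 - ε n) := fun n => by simpa using hε1 n
  have hc2 : ∀ n, 0 < ENNReal.ofReal (ε n) := fun n => by simpa using hε0 n
  have hmem : ∀ n, MemL2s S (mix (ε n) P₀ P) (h n) := fun n => hmixadd n ▸ (hproj n).memL2s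
  have hmem₀ : ∀ n, MemL2s S P₀ (h n) := fun n => by
    refine (hmem n).of_quad_le (c := (1 - ε n)⁻¹) (inv_pos.2 (sub_pos.2 (hε1 n))) fun v hv => ?_
    rw [hquad n hv, mul_add, ← mul_assoc,
      ← ENNReal.ofReal_mul (inv_pos.2 (sub_pos.2 (hε1 n))).le,
      inv_mul_cancel₀ (sub_pos.2 (hε1 n)).ne', ENNReal.ofReal_one, one_mul]
    exact le_self_add
  have hmem₁ : ∀ n, MemL2s S P (h n) := fun n => by
    refine (hmem n).of_quad_le (c := (ε n)⁻¹) (inv_pos.2 (hε0 n)) fun v hv => ?_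
    rw [hquad n hv, mul_add, ← mul_assoc _ _ (quad P v), ← ENNReal.ofReal_mul (inv_pos.2 (hε0 n)).le,
      inv_mul_cancel₀ (hε0 n).ne', ENNReal.ofReal_one, one_mul]
    exact le_add_self
  have hmemn : ∀ n m, MemL2s S (mix (ε n) P₀ P) (h m) := fun n m => by
    have hd : 0 < ε n / ε m := div_pos (hε0 n) (hε0 m)
    -- The 2 compensates 1 - ε_m ≥ 1/2 in front of P₀; the quotient matches the coefficients of P.
    refine (hmem m).of_quad_le (c := 2 + ε n / ε m) (by positivity) fun v hv => ?_
    rw [hquad n hv, hquad m hv, mul_add, ← mul_assoc, ← mul_assoc,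
      ← ENNReal.ofReal_mul (by positivity), ← ENNReal.ofReal_mul (by positivity)]
    have e1 : 1 - ε n ≤ (2 + ε n / ε m) * (1 - ε m) := by
      nlinarith [hε0 n, hε2 m]
    have e2 : ε n ≤ (2 + ε n / ε m) * ε m := by
      rw [add_mul, div_mul_cancel₀ _ (hε0 m).ne']
      linarith [hε0 m]
    gcongr
  have hfin : mse S a h₀ F₀ G ≠ ⊤ := mse_ne_top ha hF₀ hG hmin hh₀.memL2s
  have hfin₀ : ∀ n, mse S a (h n) F₀ G ≠ ⊤ := fun n => mse_ne_top ha hF₀ hG hmin (hmem₀ n)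
  have hmin_le : ∀ n, mse S a h₀ F₀ G ≤ mse S a (h n) F₀ G := fun n =>
    hh₀.isOptimal.2 _ (hmem₀ n)
  -- Replacing the error of h_n for F₀ by the smaller one of h₀ and cancelling (1-ε)Δ(h₀; F₀, G)
  -- leaves the bound on the error for F.
  have hfin₁ : ∀ n, mse S a (h n) F G ≤ mse S a h₀ F₀ G := fun n => by
    have h1 := hle n
    rw [hmse n (hm n)] at h1
    have h2 : ENNReal.ofReal (1 - ε n) * mse S a h₀ F₀ G + ENNReal.ofReal (ε n) * mse S a (h n) F G ≤
        ENNReal.ofReal (1 - ε n) * mse S a h₀ F₀ G + ENNReal.ofReal (ε n) * mse S a h₀ F₀ G := by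
      calc _ ≤ ENNReal.ofReal (1 - ε n) * mse S a (h n) F₀ G +
            ENNReal.ofReal (ε n) * mse S a (h n) F G := by gcongr; exact hmin_le n
        _ ≤ mse S a h₀ F₀ G := h1
        _ = _ := by
          rw [← add_mul, ← ENNReal.ofReal_add (sub_nonneg.2 (hε1 n).le) (hε0 n).le,
            sub_add_cancel, ENNReal.ofReal_one, one_mul]
    rw [ENNReal.add_le_add_iff_left (ENNReal.mul_ne_top ENNReal.ofReal_ne_top hfin)] at h2
    exact (ENNReal.mul_le_mul_iff_right (hc2 n).ne' ENNReal.ofReal_ne_top).1 h2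
  have hfin₁' : ∀ n, mse S a (h n) F G ≠ ⊤ := fun n => ((hfin₁ n).trans_lt hfin.lt_top).ne
  set c : ℝ := 1 / (2 * Real.pi) with hc
  have hc0 : 0 < c := by positivity
  set q₀ : ℕ → ℝ := fun n => (mse S a (h n) F₀ G).toReal with hq₀
  set q₁ : ℕ → ℝ := fun n => (mse S a (h n) F G).toReal with hq₁
  set M : ℝ := (mse S a h₀ F₀ G).toReal with hM
  -- Pythagorean identity for the n-th combination with h_m as competitor, expanded by affinity in
  -- the density.
  have hident : ∀ n m, ENNReal.ofReal (1 - ε n) * mse S a (h m) F₀ G +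
      ENNReal.ofReal (ε n) * mse S a (h m) F G =
      (ENNReal.ofReal (1 - ε n) * mse S a (h n) F₀ G +
      ENNReal.ofReal (ε n) * mse S a (h n) F G) + ENNReal.ofReal c *
      (ENNReal.ofReal (1 - ε n) * quad P₀ (h m - h n) +
        ENNReal.ofReal (ε n) * quad P (h m - h n)) := fun n m => by
    have h1 := (hproj n).mse_eq_add (h m) (by rw [hmixadd n]; exact hmemn n m)
    rwa [hmixadd n, hquad n ((hm m).sub (hm n)), hmse n (hm n), hmse n (hm m)] at h1
  have hquadfin : ∀ n m, quad P₀ (h m - h n) ≠ ⊤ ∧ quad P (h m - h n) ≠ ⊤ := fun n m => by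
    have h1 : ENNReal.ofReal c * (ENNReal.ofReal (1 - ε n) * quad P₀ (h m - h n) +
        ENNReal.ofReal (ε n) * quad P (h m - h n)) ≠ ⊤ := by
      refine ne_top_of_le_ne_top ?_ (le_of_le_of_eq le_add_self (hident n m).symm)
      exact ENNReal.add_ne_top.2 ⟨ENNReal.mul_ne_top ENNReal.ofReal_ne_top (hfin₀ m),
        ENNReal.mul_ne_top ENNReal.ofReal_ne_top (hfin₁' m)⟩
    have h2 := ENNReal.add_ne_top.1 (ne_top_of_mul_ne_top h1
      (by simpa using hc0))
    exact ⟨ne_top_of_mul_ne_top h2.1 (hc1 n).ne',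
      ne_top_of_mul_ne_top h2.2 (hc2 n).ne'⟩
  have hident' : ∀ n m, (1 - ε n) * q₀ m + ε n * q₁ m = ((1 - ε n) * q₀ n + ε n * q₁ n) +
      ((1 - ε n) * (c * (quad P₀ (h m - h n)).toReal) +
        ε n * (c * (quad P (h m - h n)).toReal)) := fun n m => by
    have h1 := congrArg ENNReal.toReal (hident n m)
    have f1 := hfin₀ m
    have f2 := hfin₀ n
    have f3 := hfin₁' m
    have f4 := hfin₁' n
    obtain ⟨f5, f6⟩ := hquadfin n m
    have g1 := (sub_pos.2 (hε1 n)).le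
    have g2 := (hε0 n).le
    rw [ENNReal.toReal_add (by finiteness) (by finiteness),
      ENNReal.toReal_add (by finiteness) (by finiteness),
      ENNReal.toReal_add (by finiteness) (by finiteness)] at h1
    simp only [ENNReal.toReal_mul] at h1
    rw [ENNReal.toReal_add (by finiteness) (by finiteness)] at h1
    simp only [ENNReal.toReal_mul, ENNReal.toReal_ofReal g1, ENNReal.toReal_ofReal g2,
      ENNReal.toReal_ofReal hc0.le] at h1
    rw [h1]
    ring
  -- Here s = ε_m < t = ε_n. The increments of the errors for F control the L₂(P) distances, so a
  -- bounded monotone sequence of errors yields a Cauchy sequence of estimates.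
  have hstep : ∀ n m, n < m → c * (quad P (h m - h n)).toReal ≤ q₁ m - q₁ n := fun n m hnm => by
    have h2 := hident' m n
    rw [quad_sub_comm (W := P₀), quad_sub_comm (W := P)] at h2
    exact sub_le_of_regularized (hε0 m) (hεanti hnm) (hε1 n)
      (mul_nonneg hc0.le ENNReal.toReal_nonneg) (mul_nonneg hc0.le ENNReal.toReal_nonneg)
      (hident' n m) h2
  have hmono : Monotone q₁ := monotone_nat_of_le_succ fun n => by
    have h1 := hstep n (n + 1) n.lt_succ_self
    have h2 : 0 ≤ c * (quad P (h (n + 1) - h n)).toReal :=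
      mul_nonneg hc0.le ENNReal.toReal_nonneg
    linarith
  have hbdd : BddAbove (Set.range q₁) := by
    refine ⟨M, ?_⟩
    rintro _ ⟨n, rfl⟩
    exact ENNReal.toReal_mono hfin (hfin₁ n)
  set L := ⨆ n, q₁ n with hL
  have hq₁lim : Tendsto q₁ atTop (𝓝 L) := tendsto_atTop_ciSup hmono hbdd
  have hbound : ∀ n m, n < m → quad P (h m - h n) ≤ ENNReal.ofReal (c⁻¹ * (L - q₁ n)) :=
    fun n m hnm => by
      rw [← ENNReal.ofReal_toReal (hquadfin n m).2]
      refine ENNReal.ofReal_le_ofReal ?_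
      rw [le_inv_mul_iff₀ hc0]
      exact (hstep n m hnm).trans (sub_le_sub_right (le_ciSup hbdd m) _)
  -- From (1-ε)Δ(h_n; F₀, G) ≤ M the excess over the minimum M is at most M/(1-ε) - M, and the
  -- Pythagorean identity turns this excess into distance.
  have hlim₀ : Tendsto (fun n => quad P₀ (h n - h₀)) atTop (𝓝 0) := by
    have h1 : ∀ n, quad P₀ (h n - h₀) ≤ ENNReal.ofReal (c⁻¹ * (M / (1 - ε n) - M)) := fun n => by
      have h2 := hh₀.mse_eq_add (h n) (hmem₀ n)
      have h3 : quad P₀ (h n - h₀) ≠ ⊤ := by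
        refine ne_top_of_mul_ne_top
          (ne_top_of_le_ne_top (hfin₀ n) (le_of_le_of_eq le_add_self h2.symm)) ?_
        exact (ENNReal.ofReal_pos.2 hc0).ne'
      have h4 := congrArg ENNReal.toReal h2
      rw [ENNReal.toReal_add hfin (by finiteness), ENNReal.toReal_mul,
        ENNReal.toReal_ofReal hc0.le] at h4
      have h5 := ENNReal.toReal_mono hfin (hle n)
      have f1 := hfin₀ n
      have f2 := hfin₁' n
      rw [hmse n (hm n), ENNReal.toReal_add (by finiteness) (by finiteness), ENNReal.toReal_mul,
        ENNReal.toReal_mul, ENNReal.toReal_ofReal (sub_pos.2 (hε1 n)).le,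
        ENNReal.toReal_ofReal (hε0 n).le] at h5
      have h6 : 0 ≤ ε n * (mse S a (h n) F G).toReal :=
        mul_nonneg (hε0 n).le ENNReal.toReal_nonneg
      rw [← ENNReal.ofReal_toReal h3]
      refine ENNReal.ofReal_le_ofReal ?_
      rw [le_inv_mul_iff₀ hc0, le_sub_iff_add_le, le_div_iff₀ (sub_pos.2 (hε1 n))]
      have h7 : c * (quad P₀ (h n - h₀)).toReal + M = (mse S a (h n) F₀ G).toReal := by
        rw [h4]; ring
      rw [h7, mul_comm]
      linarith
    refine tendsto_of_tendsto_of_tendsto_of_le_of_le tendsto_const_nhds ?_ (fun _ => zero_le) h1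
    have h8 : Tendsto (fun n => c⁻¹ * (M / (1 - ε n) - M)) atTop (𝓝 (c⁻¹ * (M / (1 - 0) - M))) :=
      (((tendsto_const_nhds (x := M)).div ((tendsto_const_nhds (x := (1 : ℝ))).sub hεlim)
        (by norm_num)).sub_const M).const_mul _
    simpa using ENNReal.tendsto_ofReal h8
  obtain ⟨σ, τ, R⟩ := exists_isRoot hsP₀ hmin
  obtain ⟨ns, hns, hae⟩ := R.exists_seq_tendsto_ae (fun n => (hm n).sub hm₀) hlim₀
  have hae' : ∀ᵐ x ∂period, Tendsto (fun k => h (ns k) x) atTop (𝓝 (h₀ x)) :=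
    hae.mono fun x hx => by simpa using hx.add_const (h₀ x)
  refine ⟨MemL2s.of_tendsto hsP hm₀ hmem₁ ?_,
    mse_le_of_tendsto_ae ha hF hG (fun k => hm (ns k)) hm₀ hae' fun k => hfin₁ (ns k)⟩
  -- Letting m → ∞ along the almost everywhere convergent subsequence identifies the L₂(P) limit
  -- with h₀ without inverting P.
  have hfatou : ∀ n, quad P (h₀ - h n) ≤ ENNReal.ofReal (c⁻¹ * (L - q₁ n)) := fun n => by
    refine quad_le_of_tendsto_ae hsP (fun k => (hm (ns k)).sub (hm n))
      (hae'.mono fun x hx => hx.sub_const (h n x)) ?_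
    filter_upwards [hns.tendsto_atTop.eventually_gt_atTop n] with k hk using hbound n _ hk
  refine tendsto_of_tendsto_of_tendsto_of_le_of_le tendsto_const_nhds ?_ (fun _ => zero_le) hfatou
  have h8 : Tendsto (fun n => c⁻¹ * (L - q₁ n)) atTop (𝓝 (c⁻¹ * (L - L))) :=
    (hq₁lim.const_sub L).const_mul _
  simpa using ENNReal.tendsto_ofReal h8

end Minimax

/-! ### The saddle point -/

section SaddlePoint

variable {T : ℕ} {S : Set ℤ} {a : ℤ → Fin T → ℂ} {F G F₀ : ℝ → Matrix (Fin T) (Fin T) ℂ}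
  {h h' : ℝ → Fin T → ℂ}

lemma finite_missing {s : ℕ} (M N : Fin s → ℕ) : (missing M N).Finite :=
  Set.finite_iUnion fun _ => Set.finite_Icc _ _

lemma quad_congr {W : ℝ → Matrix (Fin T) (Fin T) ℂ} (hh : h =ᵐ[period] h') :
    quad W h = quad W h' :=
  lintegral_congr_ae (hh.mono fun x hx => by simp only [hx])

lemma mse_congr (hh : h =ᵐ[period] h') : mse S a h F G = mse S a h' F G := by
  have h1 : symbolA S a - h =ᵐ[period] symbolA S a - h' := (EventuallyEq.refl _ _).sub hh
  rw [mse, mse, quad_congr hh, quad_congr h1]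

lemma MemL2s.congr {W : ℝ → Matrix (Fin T) (Fin T) ℂ} (hm : MemL2s S W h)
    (hh : h =ᵐ[period] h') : MemL2s S W h' := by
  refine ⟨hm.1.congr hh, fun ε hε => ?_⟩
  obtain ⟨p, hp, h1⟩ := hm.2 ε hε
  refine ⟨p, hp, ?_⟩
  rwa [quad_congr (hh.symm.sub (EventuallyEq.refl _ p))]

lemma ae_eq_of_quad_sub_eq_zero {P : ℝ → Matrix (Fin T) (Fin T) ℂ} (hP : IsSpectralDensity P)
    (hmin : Minimality P) (hh : AEStronglyMeasurable h period)
    (hh' : AEStronglyMeasurable h' period) (h0 : quad P (h - h') = 0) : h =ᵐ[period] h' := by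
  obtain ⟨σ, τ, R⟩ := exists_isRoot hP hmin
  -- A constant sequence that tends to 0 almost everywhere is 0 almost everywhere.
  obtain ⟨ns, -, hae⟩ := R.exists_seq_tendsto_ae (v := fun _ => h - h')
    (fun _ => hh.sub hh') (by simp only [h0]; exact tendsto_const_nhds)
  filter_upwards [hae] with x hx
  exact sub_eq_zero.1 (tendsto_nhds_unique tendsto_const_nhds hx)

/-- Within a star-shaped class, a density solving the extremum problem is least favorable, and its
optimal characteristic is the only minimax-robust one. -/
theorem isLeastFavorable_and_minimaxGivenByFormula (hS : S.Finite)
    (ha : Summable fun j : functionalIndex S => ∑ k : Fin T, ‖a j k‖)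
    {D : Set (ℝ → Matrix (Fin T) (Fin T) ℂ)} (hD : ∀ F ∈ D, IsSpectralDensity F)
    (hmixD : ∀ F ∈ D, ∀ ε : ℝ, 0 < ε → ε < 1 → mix ε F₀ F ∈ D)
    (hG : IsSpectralDensity G) (hmin : Minimality (F₀ + G)) (hC : ∃ C, IsSeriesC S a F₀ G C)
    (hext : SolvesExtremum S a D G F₀) :
    IsLeastFavorable S a D G F₀ ∧ MinimaxGivenByFormula S a D G F₀ := by
  obtain ⟨C, hC⟩ := hC
  obtain ⟨hF₀D, t₀, ht₀, hmax⟩ := hext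
  have hF₀ := hD F₀ hF₀D
  obtain ⟨hproj, hval⟩ := isProjection_charFormula hS ha hF₀ hG hmin hC
  set h₀ := charFormula S a F₀ G C with hh₀
  -- Saddle point: each convex combination lies in D and is minimal with G, so its minimal error is
  -- a value of the objective, and extremality bounds it by the error at F₀.
  have hsaddle : ∀ F ∈ D, MemL2s S (F + G) h₀ ∧ mse S a h₀ F G ≤ mse S a h₀ F₀ G := by
    intro F hF
    refine memL2s_and_mse_le_of_mix ha hF₀ (hD F hF) hG hmin hproj fun ε h0 h1 => ?_
    have hm : Minimality (mix ε F₀ F + G) := by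
      rw [mix_add]
      exact minimality_mix h0.le h1 (hF₀.add hG) ((hD F hF).add hG) hmin
    have hmixF := hmixD F hF ε h0 h1
    obtain ⟨h, t, hh, ht, htv⟩ := exists_isProjection hS ha (hD _ hmixF) hG hm
    refine ⟨h, hh, ?_⟩
    rw [htv, hval t₀ ht₀]
    exact ENNReal.ofReal_le_ofReal (hmax _ hmixF hm t ht)
  have hworst : worstError S a D G h₀ = mse S a h₀ F₀ G :=
    le_antisymm (iSup₂_le fun F hF => (hsaddle F hF).2)
      (le_iSup₂ (f := fun F (_ : F ∈ D) => mse S a h₀ F G) F₀ hF₀D)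
  have hle : ∀ h, mse S a h F₀ G ≤ worstError S a D G h := fun h =>
    le_iSup₂ (f := fun F (_ : F ∈ D) => mse S a h F G) F₀ hF₀D
  refine ⟨⟨hF₀D, h₀, hproj.isOptimal, fun F hF =>
    (iInf₂_le h₀ (hsaddle F hF).1).trans (hsaddle F hF).2⟩, C, hC, fun h => ⟨?_, fun hh => ?_⟩⟩
  · rintro ⟨hh, -, hbest⟩
    have h1 : mse S a h F₀ G ≤ mse S a h₀ F₀ G :=
      -- A minimax h does no worse than h₀ at F₀, so the distance term in the Pythagorean identity
      -- vanishes.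
      (hle h).trans ((hbest h₀ fun F hF => (hsaddle F hF).1).trans_eq hworst)
    have hfin := mse_ne_top ha hF₀ hG hmin hproj.memL2s
    rw [hproj.mse_eq_add h (hh F₀ hF₀D)] at h1
    have h2 : ENNReal.ofReal (1 / (2 * Real.pi)) * quad (F₀ + G) (h - h₀) = 0 := by
      refine nonpos_iff_eq_zero.1 ?_
      rwa [← ENNReal.add_le_add_iff_left hfin, add_zero]
    have h3 : ENNReal.ofReal (1 / (2 * Real.pi)) ≠ 0 := by
      simpa using Real.pi_pos
    exact ae_eq_of_quad_sub_eq_zero (hF₀.add hG) hmin (hh F₀ hF₀D).1 hproj.memL2s.1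
      ((mul_eq_zero.1 h2).resolve_left h3)
  · have hw : worstError S a D G h = mse S a h₀ F₀ G := by
      rw [← hworst]
      exact iSup_congr fun F => iSup_congr fun _ => mse_congr hh
    refine ⟨fun F hF => (hsaddle F hF).1.congr hh.symm, ⟨F₀, hF₀D, ?_⟩, fun g hg => ?_⟩
    · rw [hw, mse_congr hh]
    · rw [hw]
      exact (hproj.isOptimal.2 g (hg F₀ hF₀D)).trans (hle g)

end SaddlePoint

/-! ### The classes are star-shaped -/

section Classes

variable {T : ℕ}

lemma meanAbs_mix_le {f g : ℝ → ℂ} (hf : Integrable f period) (hg : Integrable g period)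
    {ε b : ℝ} (h0 : 0 < ε) (h1 : ε < 1) (hfb : meanAbs f ≤ b) (hgb : meanAbs g ≤ b) :
    meanAbs (fun x => ((1 - ε : ℝ) : ℂ) * f x + ((ε : ℝ) : ℂ) * g x) ≤ b := by
  have h2 : meanAbs (fun x => ((1 - ε : ℝ) : ℂ) * f x + ((ε : ℝ) : ℂ) * g x) ≤
      (1 - ε) * meanAbs f + ε * meanAbs g := by
    have h3 : ∫ x, ‖((1 - ε : ℝ) : ℂ) * f x + ((ε : ℝ) : ℂ) * g x‖ ∂period ≤
        ∫ x, ((1 - ε) * ‖f x‖ + ε * ‖g x‖) ∂period := by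
      refine integral_mono ((hf.const_mul _).add (hg.const_mul _)).norm
        ((hf.norm.const_mul _).add (hg.norm.const_mul _)) fun x => ?_
      refine (norm_add_le _ _).trans_eq ?_
      rw [norm_mul, norm_mul, Complex.norm_real, Complex.norm_real,
        Real.norm_of_nonneg (sub_pos.2 h1).le, Real.norm_of_nonneg h0.le]
    rw [integral_add (hf.norm.const_mul _) (hg.norm.const_mul _), integral_const_mul,
      integral_const_mul] at h3
    have h4 := mul_le_mul_of_nonneg_left h3 (show 0 ≤ 1 / (2 * Real.pi) by positivity)
    unfold meanAbs
    linarith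
  nlinarith [mul_le_mul_of_nonneg_left hfb (sub_pos.2 h1).le,
    mul_le_mul_of_nonneg_left hgb h0.le]

/-- Conditions `(2π)⁻¹ ∫ |L (F - F₁)| ≤ b` with a linear functional `L` are inherited by convex
combinations. -/
lemma meanAbs_linear_mix_le (L : Matrix (Fin T) (Fin T) ℂ →ₗ[ℂ] ℂ)
    {F F' F₁ : ℝ → Matrix (Fin T) (Fin T) ℂ} (hF : IsSpectralDensity F)
    (hF' : IsSpectralDensity F') (hF₁ : IsSpectralDensity F₁) {ε b : ℝ} (h0 : 0 < ε) (h1 : ε < 1)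
    (hb : meanAbs (fun x => L (F x - F₁ x)) ≤ b) (hb' : meanAbs (fun x => L (F' x - F₁ x)) ≤ b) :
    meanAbs (fun x => L (mix ε F F' x - F₁ x)) ≤ b := by
  have hint : ∀ {H : ℝ → Matrix (Fin T) (Fin T) ℂ}, IsSpectralDensity H →
      Integrable (fun x => L (H x - F₁ x)) period := fun {H} hH => by
    -- Expansion over matrix units reduces integrability of the functional to that of the entries.
    have h2 : ∀ x, L (H x - F₁ x) =
        ∑ i, ∑ j, (H x i j - F₁ x i j) * L (Matrix.single i j 1) := fun x => by
      conv_lhs => rw [Matrix.matrix_eq_sum_single (H x - F₁ x)]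
      simp only [map_sum]
      refine Finset.sum_congr rfl fun i _ => Finset.sum_congr rfl fun j _ => ?_
      rw [← smul_eq_mul, ← map_smul, Matrix.smul_single, smul_eq_mul, mul_one, Matrix.sub_apply]
    simp only [h2]
    exact integrable_finsetSum _ fun i _ => integrable_finsetSum _ fun j _ =>
      ((hH.integrable i j).sub (hF₁.integrable i j)).mul_const _
  have h2 := meanAbs_mix_le (hint hF) (hint hF') h0 h1 hb hb'
  convert h2 using 3 with x
  rw [← smul_eq_mul, ← smul_eq_mul, ← map_smul, ← map_smul, ← map_add, mix]
  congr 1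
  ext i j
  simp
  ring

/-- The bracket `⟨B, ·⟩` as a linear functional. -/
def bracketLinear (B : Matrix (Fin T) (Fin T) ℂ) : Matrix (Fin T) (Fin T) ℂ →ₗ[ℂ] ℂ where
  toFun := bracket B
  map_add' V W := by simp [bracket, mul_add, Finset.sum_add_distrib]
  map_smul' c W := by
    simp only [bracket, Matrix.smul_apply, smul_eq_mul, RingHom.id_apply, Finset.mul_sum]
    exact Finset.sum_congr rfl fun i _ => Finset.sum_congr rfl fun j _ => by ring

variable {F F' F₁ : ℝ → Matrix (Fin T) (Fin T) ℂ} {ε : ℝ}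

lemma mix_mem_class1 (hF₁ : IsSpectralDensity F₁) (h0 : 0 < ε) (h1 : ε < 1) {δ : ℝ}
    (hF : F ∈ class1 F₁ δ) (hF' : F' ∈ class1 F₁ δ) : mix ε F F' ∈ class1 F₁ δ :=
  ⟨isSpectralDensity_mix h0.le h1.le hF.1 hF'.1,
    meanAbs_linear_mix_le (Matrix.traceLinearMap (Fin T) ℂ ℂ) hF.1 hF'.1 hF₁ h0 h1 hF.2 hF'.2⟩

lemma mix_mem_class2 (hF₁ : IsSpectralDensity F₁) (h0 : 0 < ε) (h1 : ε < 1) {δ : Fin T → ℝ}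
    (hF : F ∈ class2 F₁ δ) (hF' : F' ∈ class2 F₁ δ) : mix ε F F' ∈ class2 F₁ δ :=
  ⟨isSpectralDensity_mix h0.le h1.le hF.1 hF'.1, fun k =>
    meanAbs_linear_mix_le (Matrix.entryLinearMap ℂ ℂ k k) hF.1 hF'.1 hF₁ h0 h1 (hF.2 k) (hF'.2 k)⟩

lemma mix_mem_class3 (hF₁ : IsSpectralDensity F₁) (h0 : 0 < ε) (h1 : ε < 1)
    {B₁ : Matrix (Fin T) (Fin T) ℂ} {δ : ℝ}
    (hF : F ∈ class3 F₁ B₁ δ) (hF' : F' ∈ class3 F₁ B₁ δ) : mix ε F F' ∈ class3 F₁ B₁ δ :=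
  ⟨isSpectralDensity_mix h0.le h1.le hF.1 hF'.1,
    meanAbs_linear_mix_le (bracketLinear B₁) hF.1 hF'.1 hF₁ h0 h1 hF.2 hF'.2⟩

lemma mix_mem_class4 (hF₁ : IsSpectralDensity F₁) (h0 : 0 < ε) (h1 : ε < 1)
    {δ : Fin T → Fin T → ℝ}
    (hF : F ∈ class4 F₁ δ) (hF' : F' ∈ class4 F₁ δ) : mix ε F F' ∈ class4 F₁ δ :=
  ⟨isSpectralDensity_mix h0.le h1.le hF.1 hF'.1, fun i j =>
    meanAbs_linear_mix_le (Matrix.entryLinearMap ℂ ℂ i j) hF.1 hF'.1 hF₁ h0 h1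
      (hF.2 i j) (hF'.2 i j)⟩

end Classes

end Filtering

end

/-! ### The theorem for the four classes -/

theorem corollary6 {T s : ℕ} (M N : Fin s → ℕ) (S : Set ℤ) (hS : S = Filtering.missing M N)
    (a : ℤ → Fin T → ℂ)
    (ha : Summable fun j : Filtering.functionalIndex S => ∑ k : Fin T, ‖a j k‖)
    (G F₁ F₀ : ℝ → Matrix (Fin T) (Fin T) ℂ)
    (hG : Filtering.IsSpectralDensity G) (hF₁ : Filtering.IsSpectralDensity F₁)
    (hF₀ : Filtering.IsSpectralDensity F₀) (hmin : Filtering.Minimality (F₀ + G))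
    (B₁ : Matrix (Fin T) (Fin T) ℂ) (hB₁ : B₁.PosDef)
    (δ : ℝ) (δ₂ : Fin T → ℝ) (δ₄ : Fin T → Fin T → ℝ) :
    (Filtering.Relations1 S a F₁ G F₀ δ →
      Filtering.SolvesExtremum S a (Filtering.class1 F₁ δ) G F₀ →
      Filtering.IsLeastFavorable S a (Filtering.class1 F₁ δ) G F₀ ∧
      Filtering.MinimaxGivenByFormula S a (Filtering.class1 F₁ δ) G F₀) ∧
    (Filtering.Relations2 S a F₁ G F₀ δ₂ →
      Filtering.SolvesExtremum S a (Filtering.class2 F₁ δ₂) G F₀ →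
      Filtering.IsLeastFavorable S a (Filtering.class2 F₁ δ₂) G F₀ ∧
      Filtering.MinimaxGivenByFormula S a (Filtering.class2 F₁ δ₂) G F₀) ∧
    (Filtering.Relations3 S a F₁ G F₀ B₁ δ →
      Filtering.SolvesExtremum S a (Filtering.class3 F₁ B₁ δ) G F₀ →
      Filtering.IsLeastFavorable S a (Filtering.class3 F₁ B₁ δ) G F₀ ∧
      Filtering.MinimaxGivenByFormula S a (Filtering.class3 F₁ B₁ δ) G F₀) ∧
    (Filtering.Relations4 S a F₁ G F₀ δ₄ →
      Filtering.SolvesExtremum S a (Filtering.class4 F₁ δ₄) G F₀ →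
      Filtering.IsLeastFavorable S a (Filtering.class4 F₁ δ₄) G F₀ ∧
      Filtering.MinimaxGivenByFormula S a (Filtering.class4 F₁ δ₄) G F₀) := by
  have hfin : S.Finite := hS ▸ Filtering.finite_missing M N
  refine ⟨fun hR hext => ?_, fun hR hext => ?_, fun hR hext => ?_, fun hR hext => ?_⟩
  -- In each case the relations supply C. What is left is that the class contains the segments from
  -- F₀ to its elements, since each constraint bounds a mean of |L(F - F₁)| with L linear.
  all_goals
    obtain ⟨⟨C, hC, -⟩, -⟩ := hR
    refine Filtering.isLeastFavorable_and_minimaxGivenByFormula hfin ha (fun F hF => hF.1)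
      (fun F hF ε h0 h1 => ?_) hG hmin ⟨C, hC⟩ hext
  · exact Filtering.mix_mem_class1 hF₁ h0 h1 hext.1 hF
  · exact Filtering.mix_mem_class2 hF₁ h0 h1 hext.1 hF
  · exact Filtering.mix_mem_class3 hF₁ h0 h1 hext.1 hF
  · exact Filtering.mix_mem_class4 hF₁ h0 h1 hext.1 hF
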